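/- Let $n\ge 0$, $r\ge 0$, $m\ge 1$, let $-\infty=l_0<l_1<\dots<l_n<l_{n+1}=\infty$ and call $(l_{k-1},l_k)\times\mathbb R^m$, $k=1,\dots,n+1$, the layers. Let $A_k$ ($k=1,\dots,n+1$) be positive definite Hermitian $r\times r$ matrices and, for $k=1,\dots,n$ and $q,i\in\{1,2\}$, let $\alpha^k_{qi},\beta^k_{qi}$ be complex $r\times r$ matrices such that the block matrices $$M_{i,k}=\begin{pmatrix}\alpha^k_{1i}&\beta^k_{1i}\\ \alpha^k_{2i}&\beta^k_{2i}\end{pmatrix},\qquad i=1,2,$$ are invertible. *Eigenfunctions.* For every $s\in\mathbb R$ let $\varphi_k(\cdot,s)$, $k=1,\dots,n+1$, be the $r\times r$-matrix solutions of $$A_k^2\varphi_k''+s^2\varphi_k=0 \text{ on } (l_{k-1},l_k),\qquad \alpha^k_{q1}\varphi_k'+\beta^k_{q1}\varphi_k=\alpha^k_{q2}\varphi_{k+1}'+\beta^k_{q2}\varphi_{k+1}\ \text{ at } x=l_k\ (q=1,2),\qquad \varphi_{n+1}(x,s)=e^{\,isxA_{n+1}^{-1}},$$ and let $\varphi_k^*(\cdot,s)$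 be the solutions of the dual problem $$(\varphi_k^{*})''A_k^2+s^2\varphi^*_k=0 \text{ on } (l_{k-1},l_k),\qquad \big(\varphi_k^*A_k^2,\,-(\varphi_k^{*})'A_k^2\big)M_{1,k}^{-1}=\big(\varphi_{k+1}^*A_{k+1}^2,\,-(\varphi_{k+1}^{*})'A_{k+1}^2\big)M_{2,k}^{-1}\ \text{ at } x=l_k,\qquad \varphi^*_{n+1}(x,s)=e^{-isxA_{n+1}^{-1}}.$$ (For $r=1$ the dual coupling condition reads $\frac{a_k^2}{\det M_{1,k}}[\alpha^k_{q1}\varphi_k^{*\prime}+\beta^k_{q1}\varphi^*_k]=\frac{a_{k+1}^2}{\det M_{2,k}}[\alpha^k_{q2}\varphi_{k+1}^{*\prime}+\beta^k_{q2}\varphi_{k+1}^*]$, $q=1,2$, where $A_k=a_k$.) *Transform.* With the Bessel function $J_\nu$ of the first kind put $$\varphi_{k,j}(\lambda,x,\xi,d)=\int_0^\pi \sin^{m/2}\theta\;\frac{J_{\frac{m-2}2}(\lambda d\sin\theta)}{d^{\frac{m-2}2}}\;\varphi_k(x,\lambda\cos\theta)\,\varphi_j^*(\xi,\lambda\cos\theta)\,d\theta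 ,$$ and for $f=(f_1,\dots,f_{n+1})$, with $f_j$ a $\mathbb C^r$-valued function on the $j$-th layer, $x\in(l_{k-1},l_k)$, $y\in\mathbb R^m$, $\lambda>0$, put $$F_n[f](x,y,\lambda)=\frac1{(\sqrt{2\pi})^m}\int_{\mathbb R^m}\sum_{j=1}^{n+1}\int_{l_{j-1}}^{l_j}\varphi_{k,j}(\lambda,x,\xi,|y-\eta|)\,f_j(\xi,\eta)\,d\xi\,d\eta .$$ Say that $F_n[f](x,y,\lambda)$ converges absolutely if each function $(\xi,\eta)\mapsto\varphi_{k,j}(\lambda,x,\xi,|y-\eta|)f_j(\xi,\eta)$ is integrable on the $j$-th layer. Let $B$ be the operator $(Bf)_k=A_k^2\,\partial^2f_k/\partial x^2+\Delta_yf_k$ on the $k$-th layer. **Theorem.** Let each $f_k$ be twice continuously differentiable and integrable on the $k$-th layer, and assume: 1. for fixed $y$: $f_{n+1},\ \partial f_{n+1}/\partial x\to0$ as $x\to+\infty$, and $f_1,\ \partial f_1/\partial x\to0$ as $x\to-\infty$; 2. for every $k$ and every $j=1,\dots,m$: $f_k,\ \partial f_k/\partial y_j\to 0$ as $y_j\to\pm\infty$,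 the other variables being fixed; 3. for every $k=1,\dots,n$ and $y\in\mathbb R^m$, the functions $f_k,\partial f_k/\partial x$ and $f_{k+1},\partial f_{k+1}/\partial x$ have limits at the point $(l_k,y)$ from within their layers (as functions of all the variables), and these limits satisfy the coupling conditions $$\alpha^k_{q1}\frac{\partial f_k}{\partial x}+\beta^k_{q1}f_k=\alpha^k_{q2}\frac{\partial f_{k+1}}{\partial x}+\beta^k_{q2}f_{k+1},\qquad x=l_k,\ q=1,2 .$$ Then $$F_n[Bf](x,y,\lambda)=-\lambda^2F_n[f](x,y,\lambda)$$ for all $x\in(l_{k-1},l_k)$, $k=1,\dots,n+1$, $y\in\mathbb R^m$ and $\lambda>0$ at which $F_n[f](x,y,\lambda)$ and $F_n[Bf](x,y,\lambda)$ converge absolutely. -/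

import Mathlib

open scoped ComplexOrder Matrix Topology
open MeasureTheory Filter

noncomputable section

namespace LayeredFourier

/-- The Bessel function of the first kind of real order `ν`, by its power series (for `z > 0`). -/
def besselJ (ν z : ℝ) : ℝ :=
  ∑' p : ℕ, (-1 : ℝ) ^ p / (p.factorial * Real.Gamma (p + ν + 1)) * (z / 2) ^ (2 * (p : ℝ) + ν)

/-- The data of a piecewise-homogeneous medium with `n` parallel interfaces `x = l i`, hence `n + 1`
layers, for vector functions with `r` components. The layers adjacent to the interface `i : Fin n`
are `i.castSucc` (on its left) and `i.succ` (on its right). The coefficients `α₁ i q`, `β₁ i q`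
(resp. `α₂ i q`, `β₂ i q`) act on the left (resp. right) layer in the `q`-th of the two coupling
conditions at the interface `i`. -/
structure Medium (n r : ℕ) where
  /-- positions of the interfaces -/
  l : Fin n → ℝ
  /-- the coefficient matrix of each layer -/
  A : Fin (n + 1) → Matrix (Fin r) (Fin r) ℂ
  α₁ : Fin n → Fin 2 → Matrix (Fin r) (Fin r) ℂ
  β₁ : Fin n → Fin 2 → Matrix (Fin r) (Fin r) ℂ
  α₂ : Fin n → Fin 2 → Matrix (Fin r) (Fin r) ℂ
  β₂ : Fin n → Fin 2 → Matrix (Fin r) (Fin r) ℂ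
  strictMono_l : StrictMono l
  posDef_A : ∀ k, (A k).PosDef
  det₁_ne_zero : ∀ i, (Matrix.fromBlocks (α₁ i 0) (β₁ i 0) (α₁ i 1) (β₁ i 1)).det ≠ 0
  det₂_ne_zero : ∀ i, (Matrix.fromBlocks (α₂ i 0) (β₂ i 0) (α₂ i 1) (β₂ i 1)).det ≠ 0

variable {n r m : ℕ}

/-- The `2 × 2` block matrix of the coupling coefficients acting on the left of interface `i`. -/
def Medium.M₁ (D : Medium n r) (i : Fin n) : Matrix (Fin r ⊕ Fin r) (Fin r ⊕ Fin r) ℂ :=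
  Matrix.fromBlocks (D.α₁ i 0) (D.β₁ i 0) (D.α₁ i 1) (D.β₁ i 1)

/-- The `2 × 2` block matrix of the coupling coefficients acting on the right of interface `i`. -/
def Medium.M₂ (D : Medium n r) (i : Fin n) : Matrix (Fin r ⊕ Fin r) (Fin r ⊕ Fin r) ℂ :=
  Matrix.fromBlocks (D.α₂ i 0) (D.β₂ i 0) (D.α₂ i 1) (D.β₂ i 1)

/-- The `k`-th layer: the open interval between consecutive interfaces (the first and the last
layer are unbounded). -/
def Medium.layer (D : Medium n r) (k : Fin (n + 1)) : Set ℝ :=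
  {x | (∀ i : Fin n, i.castSucc < k → D.l i < x) ∧ ∀ i : Fin n, k ≤ i.castSucc → x < D.l i}

/-- The `k`-th slab, `layer k × ℝᵐ`. -/
def Medium.slab (D : Medium n r) (m : ℕ) (k : Fin (n + 1)) :
    Set (ℝ × EuclideanSpace ℝ (Fin m)) :=
  D.layer k ×ˢ Set.univ

/-- Entrywise derivative of a matrix-valued function. -/
def matDeriv (g : ℝ → Matrix (Fin r) (Fin r) ℂ) (x : ℝ) : Matrix (Fin r) (Fin r) ℂ :=
  Matrix.of fun a b => deriv (fun t => g t a b) x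

/-- `φ k x s` is the component in layer `k` of the (matrix) eigenfunction of the direct
Sturm-Liouville problem with spectral parameter `s`. Since the equation has constant coefficients
in each layer, its solution in layer `k` is taken together with its unique extension to `ℝ`, so
that its values at the end points of the layer are its one-sided limits there. -/
structure IsDirectEigenfunction (D : Medium n r)
    (φ : Fin (n + 1) → ℝ → ℝ → Matrix (Fin r) (Fin r) ℂ) : Prop where
  contDiff : ∀ k s a b, ContDiff ℝ 2 (fun x => φ k x s a b)
  ode : ∀ k s x,
    D.A k ^ 2 * matDeriv (matDeriv fun t => φ k t s) x + ((s : ℂ) ^ 2) • φ k x s = 0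
  coupling : ∀ (i : Fin n) (q : Fin 2) (s : ℝ),
    D.α₁ i q * matDeriv (fun t => φ i.castSucc t s) (D.l i) + D.β₁ i q * φ i.castSucc (D.l i) s =
      D.α₂ i q * matDeriv (fun t => φ i.succ t s) (D.l i) + D.β₂ i q * φ i.succ (D.l i) s
  normalization : ∀ s x,
    φ (Fin.last n) x s = NormedSpace.exp ((Complex.I * s * x) • (D.A (Fin.last n))⁻¹)

/-- `ψ k x s` is the component in layer `k` of the (matrix) eigenfunction of the dual
Sturm-Liouville problem, in which matrices act from the right. For `r = 1` the coupling condition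
`(ψₖ Aₖ², -ψₖ' Aₖ²) M₁⁻¹ = (ψₖ₊₁ Aₖ₊₁², -ψₖ₊₁' Aₖ₊₁²) M₂⁻¹` is the pair of equations
`aₖ² / det M₁ * (α₁ q ψₖ' + β₁ q ψₖ) = aₖ₊₁² / det M₂ * (α₂ q ψₖ₊₁' + β₂ q ψₖ₊₁)`. -/
structure IsDualEigenfunction (D : Medium n r)
    (ψ : Fin (n + 1) → ℝ → ℝ → Matrix (Fin r) (Fin r) ℂ) : Prop where
  contDiff : ∀ k s a b, ContDiff ℝ 2 (fun x => ψ k x s a b)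
  ode : ∀ k s x,
    matDeriv (matDeriv fun t => ψ k t s) x * D.A k ^ 2 + ((s : ℂ) ^ 2) • ψ k x s = 0
  coupling : ∀ (i : Fin n) (s : ℝ),
    Matrix.fromCols (ψ i.castSucc (D.l i) s * D.A i.castSucc ^ 2)
        (-(matDeriv (fun t => ψ i.castSucc t s) (D.l i) * D.A i.castSucc ^ 2)) * (D.M₁ i)⁻¹ =
      Matrix.fromCols (ψ i.succ (D.l i) s * D.A i.succ ^ 2)
        (-(matDeriv (fun t => ψ i.succ t s) (D.l i) * D.A i.succ ^ 2)) * (D.M₂ i)⁻¹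
  normalization : ∀ s x,
    ψ (Fin.last n) x s = NormedSpace.exp ((-(Complex.I * s * x)) • (D.A (Fin.last n))⁻¹)

/-- The non-separated kernel `φ_{k,j}(ρ, x, ξ, d)`, with `d = |y - η|`. -/
def kernel (m : ℕ) (φ ψ : Fin (n + 1) → ℝ → ℝ → Matrix (Fin r) (Fin r) ℂ) (k j : Fin (n + 1))
    (ρ x ξ d : ℝ) : Matrix (Fin r) (Fin r) ℂ :=
  Matrix.of fun a b => ∫ θ in (0 : ℝ)..Real.pi,
    ((Real.sin θ ^ ((m : ℝ) / 2) *
      (besselJ (((m : ℝ) - 2) / 2) (ρ * Real.sin θ * d) / d ^ (((m : ℝ) - 2) / 2)) : ℝ) : ℂ) *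
      (φ k x (ρ * Real.cos θ) * ψ j ξ (ρ * Real.cos θ)) a b

/-- The multidimensional Fourier transform `F_n[f](x, y, lam)`, for `x` in layer `k`. -/
def fourierTransform (D : Medium n r)
    (φ ψ : Fin (n + 1) → ℝ → ℝ → Matrix (Fin r) (Fin r) ℂ)
    (f : Fin (n + 1) → ℝ → EuclideanSpace ℝ (Fin m) → Fin r → ℂ)
    (k : Fin (n + 1)) (x : ℝ) (y : EuclideanSpace ℝ (Fin m)) (lam : ℝ) : Fin r → ℂ :=
  (1 / Real.sqrt (2 * Real.pi) ^ m) •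
    ∫ η : EuclideanSpace ℝ (Fin m), ∑ j, ∫ ξ in D.layer j,
      kernel m φ ψ k j lam x ξ ‖y - η‖ *ᵥ f j ξ η

/-- Absolute convergence of the integrals that define `F_n[f](x, y, lam)`. -/
def TransformConverges (D : Medium n r)
    (φ ψ : Fin (n + 1) → ℝ → ℝ → Matrix (Fin r) (Fin r) ℂ)
    (f : Fin (n + 1) → ℝ → EuclideanSpace ℝ (Fin m) → Fin r → ℂ)
    (k : Fin (n + 1)) (x : ℝ) (y : EuclideanSpace ℝ (Fin m)) (lam : ℝ) : Prop :=
  ∀ j, IntegrableOn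
    (fun p : ℝ × EuclideanSpace ℝ (Fin m) =>
      kernel m φ ψ k j lam x p.1 ‖y - p.2‖ *ᵥ f j p.1 p.2) (D.slab m j)

/-- The partial derivative `∂f/∂x`. -/
def dx (g : ℝ → EuclideanSpace ℝ (Fin m) → Fin r → ℂ) :
    ℝ → EuclideanSpace ℝ (Fin m) → Fin r → ℂ :=
  fun x y => deriv (fun t => g t y) x

/-- The piecewise operator `B`: on layer `k` it is `A_k² ∂²/∂x² + Δ_y`. -/
def opB (D : Medium n r) (f : Fin (n + 1) → ℝ → EuclideanSpace ℝ (Fin m) → Fin r → ℂ) :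
    Fin (n + 1) → ℝ → EuclideanSpace ℝ (Fin m) → Fin r → ℂ :=
  fun k x y => (D.A k ^ 2) *ᵥ dx (dx (f k)) x y + Laplacian.laplacian (f k x) y

/-- The coupling conditions at the interfaces: at every point `(l i, y)`, `f` and `∂f/∂x` have
limits from both adjacent slabs, and these satisfy the two coupling equations. -/
def SatisfiesCoupling (D : Medium n r)
    (f : Fin (n + 1) → ℝ → EuclideanSpace ℝ (Fin m) → Fin r → ℂ) : Prop :=
  ∀ (i : Fin n) (y : EuclideanSpace ℝ (Fin m)), ∃ u₁ v₁ u₂ v₂ : Fin r → ℂ,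
    Tendsto (fun p : ℝ × EuclideanSpace ℝ (Fin m) => f i.castSucc p.1 p.2)
      (𝓝[D.slab m i.castSucc] (D.l i, y)) (𝓝 u₁) ∧
    Tendsto (fun p : ℝ × EuclideanSpace ℝ (Fin m) => dx (f i.castSucc) p.1 p.2)
      (𝓝[D.slab m i.castSucc] (D.l i, y)) (𝓝 v₁) ∧
    Tendsto (fun p : ℝ × EuclideanSpace ℝ (Fin m) => f i.succ p.1 p.2)
      (𝓝[D.slab m i.succ] (D.l i, y)) (𝓝 u₂) ∧
    Tendsto (fun p : ℝ × EuclideanSpace ℝ (Fin m) => dx (f i.succ) p.1 p.2)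
      (𝓝[D.slab m i.succ] (D.l i, y)) (𝓝 v₂) ∧
    ∀ q : Fin 2, D.α₁ i q *ᵥ v₁ + D.β₁ i q *ᵥ u₁ = D.α₂ i q *ᵥ v₂ + D.β₂ i q *ᵥ u₂

/-- The conditions at infinity, in `x` for the two unbounded layers and in each `y_i` for all
layers, the other variables being fixed. -/
structure VanishesAtInfinity (D : Medium n r)
    (f : Fin (n + 1) → ℝ → EuclideanSpace ℝ (Fin m) → Fin r → ℂ) : Prop where
  x_top : ∀ y, Tendsto (fun x => f (Fin.last n) x y) atTop (𝓝 0) ∧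
    Tendsto (fun x => dx (f (Fin.last n)) x y) atTop (𝓝 0)
  x_bot : ∀ y, Tendsto (fun x => f 0 x y) atBot (𝓝 0) ∧
    Tendsto (fun x => dx (f 0) x y) atBot (𝓝 0)
  y_infty : ∀ k, ∀ x ∈ D.layer k, ∀ (y : EuclideanSpace ℝ (Fin m)) (i : Fin m),
    ∀ F ∈ ({atTop, atBot} : Set (Filter ℝ)),
      Tendsto (fun t : ℝ => f k x (y + t • EuclideanSpace.single i 1)) F (𝓝 0) ∧
      Tendsto (fun t : ℝ => lineDeriv ℝ (f k x) (y + t • EuclideanSpace.single i 1)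
        (EuclideanSpace.single i 1)) F (𝓝 0)

end LayeredFourier

end

noncomputable section

namespace LayeredFourier

/-! ### Linear second order equations with constant coefficients -/

/-! Fix `x`, `y`, `lam` and one row `Φ` of the direct eigenfunction at `x`. Since `J_ν(z) / z^ν` is
an entire function of `z²`, the corresponding row of the kernel is, off `η = y`, a superposition
over `θ` of products of a weight, a radial solution of `Δu = -(lam sin θ)² u` centred at `y`, and `Φ
ψ_j(ξ, lam cos θ)`. The resulting row `P` is `C²` also at `η = y`. The transposed operator `Y ↦ Y_ξξ
A² + Δ_η Y` multiplies every product by `-lam² cos² θ - lam² sin² θ = -lam²`, so `P` is an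
eigenfunction (`testRow_adj`). It inherits the dual coupling conditions from `ψ`
(`testRow_coupling`).

By Green's identity, the integral of `P · Bf + lam² P · f` over all layers reduces to fluxes through
the interfaces and contributions from infinity. The flux is the pairing of `(P A², -P_ξ A²) M⁻¹`
with `M (f_ξ, f)`. The dual coupling makes the first factor agree on the two sides of an interface
and the direct coupling the second, so the interface fluxes cancel (`flux_eq_flux`,
`sum_integral_defect_eq_zero`).

Infinity is handled by cutoffs at scale `R`. The row and its first derivatives grow at most linearly
in `ξ`, so the commutator of the operator with the cutoff is `O((1 + |ξ|) / R)`. It tends to `0`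
pointwise and stays bounded because the cutoff vanishes for `|ξ| > 2R`. Integrability of `f` and
dominated convergence then remove it (`sum_integral_eq_zero`).

The growth bound has two sources. An energy inequality bounds the Bessel factor and its gradient
(`besselClifford_energy_le`). Diagonalising `A_j` reduces `ψ_j` to scalar oscillators
(`linearGrowth_of_ode`), whose Cauchy data depend continuously on the frequency by induction from
the last layer to the left. -/

theorem hasDerivAt_mul_sinc (ω p t : ℝ) :
    HasDerivAt (fun t : ℝ => (t - p) * Real.sinc (ω * (t - p))) (Real.cos (ω * (t - p))) t := by
  rcases eq_or_ne ω 0 with rfl | hω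
  · simpa using (hasDerivAt_id t).sub_const p
  · have h : (fun t : ℝ => (t - p) * Real.sinc (ω * (t - p))) =
        fun t => Real.sin (ω * (t - p)) / ω := by
      funext t
      rcases eq_or_ne t p with rfl | ht
      · simp
      · rw [Real.sinc_of_ne_zero (mul_ne_zero hω (sub_ne_zero.2 ht))]
        field_simp [sub_ne_zero.2 ht]
    rw [h]
    have h1 : HasDerivAt (fun t : ℝ => ω * (t - p)) ω t := by
      simpa using ((hasDerivAt_id t).sub_const p).const_mul ω
    simpa [hω] using h1.sin.div_const ω

/-- The factor `t * sinc (ω t)` continues `sin (ω t) / ω` to `ω = 0`. This case cannot be excluded,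
because the frequency `ρ cos θ` vanishes at `θ = π / 2`. -/
theorem mul_mul_sinc (ω t : ℝ) : ω * (t * Real.sinc (ω * t)) = Real.sin (ω * t) := by
  rcases eq_or_ne (ω * t) 0 with h | h
  · rw [← mul_assoc, h]; simp
  · rw [Real.sinc_of_ne_zero h, ← mul_assoc, ← mul_div_assoc, mul_div_cancel_left₀ _ h]

/-- The solution of `u'' + ω² u = 0` in terms of its Cauchy data at `p`. -/
theorem harmonic_oscillator_eq {ω p : ℝ} {u v : ℝ → ℂ} (hu : ∀ t, HasDerivAt u (v t) t)
    (hv : ∀ t, HasDerivAt v (-(ω : ℂ) ^ 2 * u t) t) (t : ℝ) :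
    u t = (Real.cos (ω * (t - p)) : ℝ) * u p +
        ((t - p) * Real.sinc (ω * (t - p)) : ℝ) * v p ∧
      v t = -((ω * Real.sin (ω * (t - p)) : ℝ) : ℂ) * u p +
        (Real.cos (ω * (t - p)) : ℝ) * v p := by
  have hlin : ∀ t, HasDerivAt (fun t : ℝ => ω * (t - p)) ω t := fun t => by
    simpa using ((hasDerivAt_id t).sub_const p).const_mul ω
  have hc : ∀ t, HasDerivAt (fun t : ℝ => ((Real.cos (ω * (t - p)) : ℝ) : ℂ))
      ((-Real.sin (ω * (t - p)) * ω : ℝ) : ℂ) t := fun t => (hlin t).cos.ofReal_comp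
  have hs : ∀ t, HasDerivAt (fun t : ℝ => ((Real.sin (ω * (t - p)) : ℝ) : ℂ))
      ((Real.cos (ω * (t - p)) * ω : ℝ) : ℂ) t := fun t => (hlin t).sin.ofReal_comp
  have hS : ∀ t, HasDerivAt (fun t : ℝ => (((t - p) * Real.sinc (ω * (t - p)) : ℝ) : ℂ))
      ((Real.cos (ω * (t - p)) : ℝ) : ℂ) t := fun t => (hasDerivAt_mul_sinc ω p t).ofReal_comp
  have key : ∀ t, (ω : ℂ) * (((t - p) * Real.sinc (ω * (t - p)) : ℝ) : ℂ) =
      ((Real.sin (ω * (t - p)) : ℝ) : ℂ) := fun t => by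
    rw [← Complex.ofReal_mul, mul_mul_sinc]
  have trig : ∀ t, ((Real.cos (ω * (t - p)) : ℝ) : ℂ) ^ 2 +
      ((Real.sin (ω * (t - p)) : ℝ) : ℂ) ^ 2 = 1 := fun t => by
    rw [← Complex.ofReal_pow, ← Complex.ofReal_pow, ← Complex.ofReal_add,
      Real.cos_sq_add_sin_sq, Complex.ofReal_one]
  -- The Cauchy data at `p` are recovered by running the flow backwards from `t`. The two resulting
  -- combinations have zero derivative, and `cos² + sin² = 1` inverts the system.
  have h1 : ∀ t, ((Real.cos (ω * (t - p)) : ℝ) : ℂ) * u t -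
      (((t - p) * Real.sinc (ω * (t - p)) : ℝ) : ℂ) * v t = u p := by
    have hd : ∀ t, HasDerivAt (fun t => ((Real.cos (ω * (t - p)) : ℝ) : ℂ) * u t -
        (((t - p) * Real.sinc (ω * (t - p)) : ℝ) : ℂ) * v t) 0 t := fun t => by
      refine (((hc t).mul (hu t)).sub ((hS t).mul (hv t))).congr_deriv ?_
      have := key t
      push_cast at this ⊢
      linear_combination (ω : ℂ) * u t * this
    intro t
    have := is_const_of_deriv_eq_zero (fun t => (hd t).differentiableAt) (fun t => (hd t).deriv) t p
    simpa using this
  have h2 : ∀ t, (ω : ℂ) * ((Real.sin (ω * (t - p)) : ℝ) : ℂ) * u t +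
      ((Real.cos (ω * (t - p)) : ℝ) : ℂ) * v t = v p := by
    have hd : ∀ t, HasDerivAt (fun t => (ω : ℂ) * ((Real.sin (ω * (t - p)) : ℝ) : ℂ) * u t +
      ((Real.cos (ω * (t - p)) : ℝ) : ℂ) * v t) 0 t := fun t => by
      refine ((((hs t).const_mul (ω : ℂ)).mul (hu t)).add ((hc t).mul (hv t))).congr_deriv ?_
      push_cast
      ring
    intro t
    have := is_const_of_deriv_eq_zero (fun t => (hd t).differentiableAt) (fun t => (hd t).deriv) t p
    simpa using this
  rw [← h1 t, ← h2 t]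
  have k := key t
  have r := trig t
  push_cast at k r ⊢
  constructor
  · linear_combination -u t * r - Complex.sin (ω * (t - p)) * u t * k
  · linear_combination -v t * r - Complex.sin (ω * (t - p)) * v t * k

/-- A function `u t s`, jointly continuous, that grows at most linearly in `t`, uniformly for `s`
in bounded sets. -/
structure LinearGrowth (u : ℝ → ℝ → ℂ) : Prop where
  cont : Continuous fun q : ℝ × ℝ => u q.1 q.2
  bound : ∀ Λ, ∃ C, ∀ t s, |s| ≤ Λ → ‖u t s‖ ≤ C * (1 + |t|)

namespace LinearGrowth

theorem add {u v : ℝ → ℝ → ℂ} (hu : LinearGrowth u) (hv : LinearGrowth v) :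
    LinearGrowth fun t s => u t s + v t s where
  cont := hu.cont.add hv.cont
  bound Λ := by
    obtain ⟨C, hC⟩ := hu.bound Λ
    obtain ⟨C', hC'⟩ := hv.bound Λ
    refine ⟨C + C', fun t s hs => (norm_add_le _ _).trans ?_⟩
    rw [add_mul]
    exact add_le_add (hC t s hs) (hC' t s hs)

theorem zero : LinearGrowth fun _ _ => 0 where
  cont := continuous_const
  bound _ := ⟨0, fun t s _ => by simp⟩

theorem sum {ι : Type*} (S : Finset ι) {u : ι → ℝ → ℝ → ℂ} (hu : ∀ i ∈ S, LinearGrowth (u i)) :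
    LinearGrowth fun t s => ∑ i ∈ S, u i t s := by
  classical
  induction S using Finset.induction_on with
  | empty => simpa using zero
  | insert i S hi ih =>
    simp only [Finset.sum_insert hi]
    exact (hu i (by simp)).add (ih fun j hj => hu j (by simp [hj]))

theorem mul_left {c : ℝ → ℂ} (hc : Continuous c) {u : ℝ → ℝ → ℂ} (hu : LinearGrowth u) :
    LinearGrowth fun t s => c s * u t s where
  cont := (hc.comp continuous_snd).mul hu.cont
  bound Λ := by
    obtain ⟨C, hC⟩ := hu.bound Λ
    obtain ⟨M, hM⟩ := (isCompact_Icc (a := -Λ) (b := Λ)).exists_bound_of_continuousOn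
      hc.continuousOn
    refine ⟨M * C, fun t s hs => ?_⟩
    rw [norm_mul, mul_assoc]
    exact mul_le_mul (hM s (abs_le.1 hs)) (hC t s hs) (norm_nonneg _)
      ((norm_nonneg _).trans (hM s (abs_le.1 hs)))

theorem mul_right {c : ℝ → ℂ} (hc : Continuous c) {u : ℝ → ℝ → ℂ} (hu : LinearGrowth u) :
    LinearGrowth fun t s => u t s * c s := by
  simpa only [mul_comm] using hu.mul_left hc

theorem continuous_right {u : ℝ → ℝ → ℂ} (hu : LinearGrowth u) (t : ℝ) : Continuous (u t) :=
  hu.cont.comp (Continuous.prodMk_right t)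

/-- Growth is linear and not bounded because at zero frequency the solutions are affine in `t`. The
bound `|sinc| ≤ 1` makes the estimate uniform near that frequency. -/
theorem of_harmonic_oscillator {d p : ℝ} {u v : ℝ → ℝ → ℂ}
    (hu : ∀ t s, HasDerivAt (fun t => u t s) (v t s) t)
    (hv : ∀ t s, HasDerivAt (fun t => v t s) (-((s / d : ℝ) : ℂ) ^ 2 * u t s) t)
    (hup : Continuous (u p)) (hvp : Continuous (v p)) : LinearGrowth u ∧ LinearGrowth v := by
  have hcos : LinearGrowth fun t s => ((Real.cos (s / d * (t - p)) : ℝ) : ℂ) := by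
    refine ⟨by fun_prop, fun Λ => ⟨1, fun t s _ => ?_⟩⟩
    rw [Complex.norm_real, Real.norm_eq_abs]
    have := Real.abs_cos_le_one (s / d * (t - p))
    have := abs_nonneg t
    linarith
  have hsin : LinearGrowth fun t s => ((Real.sin (s / d * (t - p)) : ℝ) : ℂ) := by
    refine ⟨by fun_prop, fun Λ => ⟨1, fun t s _ => ?_⟩⟩
    rw [Complex.norm_real, Real.norm_eq_abs]
    have := Real.abs_sin_le_one (s / d * (t - p))
    have := abs_nonneg t
    linarith
  have hsinc : LinearGrowth fun t s => (((t - p) * Real.sinc (s / d * (t - p)) : ℝ) : ℂ) := by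
    -- The constant comes from `|t - p| ≤ |t| + |p| ≤ (1 + |p|) (1 + |t|)`.
    refine ⟨?_, fun Λ => ⟨1 + |p|, fun t s _ => ?_⟩⟩
    · have : Continuous fun q : ℝ × ℝ => q.2 / d * (q.1 - p) := by fun_prop
      have := Real.continuous_sinc.comp this
      exact Complex.continuous_ofReal.comp ((continuous_fst.sub continuous_const).mul this)
    · rw [Complex.norm_real, Real.norm_eq_abs, abs_mul]
      have h1 := Real.abs_sinc_le_one (s / d * (t - p))
      have h2 := abs_sub t p
      have h3 := mul_le_mul_of_nonneg_left h1 (abs_nonneg (t - p))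
      nlinarith [abs_nonneg t, abs_nonneg p]
  have e := fun t s => harmonic_oscillator_eq (p := p) (fun t => hu t s) (fun t => hv t s) t
  constructor
  · have := (hcos.mul_right hup).add (hsinc.mul_right hvp)
    convert this using 3 with t s
    exact (e t s).1
  · have := (hsin.mul_left (c := fun s => -((s / d : ℝ) : ℂ) * u p s) (by fun_prop)).add
      (hcos.mul_right hvp)
    convert this using 3 with t s
    rw [(e t s).2]
    push_cast
    ring

end LinearGrowth

/-- Solutions of `Y'' A² + s² Y = 0` whose Cauchy data depend continuously on `s`. -/
theorem linearGrowth_of_ode {r : ℕ} {A : Matrix (Fin r) (Fin r) ℂ} (hA : A.PosDef) {p : ℝ}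
    {Y Y' Y'' : ℝ → ℝ → Matrix (Fin r) (Fin r) ℂ}
    (hY : ∀ t s a b, HasDerivAt (fun t => Y t s a b) (Y' t s a b) t)
    (hY' : ∀ t s a b, HasDerivAt (fun t => Y' t s a b) (Y'' t s a b) t)
    (hode : ∀ t s, Y'' t s * A ^ 2 + ((s : ℂ) ^ 2) • Y t s = 0)
    (hp : ∀ a b, Continuous fun s => Y p s a b) (hp' : ∀ a b, Continuous fun s => Y' p s a b)
    (a b : Fin r) :
    LinearGrowth (fun t s => Y t s a b) ∧ LinearGrowth (fun t s => Y' t s a b) := by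
  -- In an eigenbasis of `A` the columns of `Y U` decouple: column `b` is an oscillator of frequency
  -- `s / d b`.
  set U : Matrix (Fin r) (Fin r) ℂ := 
    (hA.isHermitian.eigenvectorUnitary : Matrix (Fin r) (Fin r) ℂ) with hU
  set d := hA.isHermitian.eigenvalues with hd
  have hdpos : ∀ b, 0 < d b := hA.eigenvalues_pos
  have hUU : U * star U = 1 := Unitary.coe_mul_star_self _
  have hUU' : star U * U = 1 := Unitary.coe_star_mul_self _
  have hAU : A * U = U * Matrix.diagonal (fun b => (d b : ℂ)) := by
    have h := hA.isHermitian.spectral_theorem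
    rw [Unitary.conjStarAlgAut_apply] at h
    conv_lhs => rw [h]
    change U * _ * star U * U = _
    rw [Matrix.mul_assoc, hUU', Matrix.mul_one]
    rfl
  have hA2U : A ^ 2 * U = U * Matrix.diagonal (fun b => (d b : ℂ) ^ 2) := by
    rw [pow_two, Matrix.mul_assoc, hAU, ← Matrix.mul_assoc, hAU, Matrix.mul_assoc,
      Matrix.diagonal_mul_diagonal]
    simp only [pow_two]
  have hder : ∀ {Z Z' : ℝ → ℝ → Matrix (Fin r) (Fin r) ℂ},
      (∀ t s a b, HasDerivAt (fun t => Z t s a b) (Z' t s a b) t) → ∀ t s a b,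
      HasDerivAt (fun t => (Z t s * U) a b) ((Z' t s * U) a b) t := by
    intro Z Z' hZ t s a b
    simp only [Matrix.mul_apply]
    exact HasDerivAt.fun_sum fun c _ => (hZ t s a c).mul_const _
  have hZ'' : ∀ t s a b, (Y'' t s * U) a b = -((s / d b : ℝ) : ℂ) ^ 2 * (Y t s * U) a b := by
    intro t s a b
    have h := congrArg (fun M => (M * U) a b) (hode t s)
    simp only [Matrix.add_mul, Matrix.mul_assoc, hA2U, Matrix.zero_mul, Matrix.smul_mul] at h
    rw [← Matrix.mul_assoc] at h
    simp only [Matrix.add_apply, Matrix.mul_diagonal, Matrix.smul_apply, smul_eq_mul,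
      Matrix.zero_apply] at h
    have hdb : (d b : ℂ) ≠ 0 := by exact_mod_cast (hdpos b).ne'
    push_cast
    field_simp
    linear_combination h
  have hcont : ∀ {W : ℝ → Matrix (Fin r) (Fin r) ℂ}, (∀ a b, Continuous fun s => W s a b) →
      ∀ a b, Continuous fun s => (W s * U) a b := by
    intro W hW a b
    simp only [Matrix.mul_apply]
    exact continuous_finsetSum _ fun c _ => (hW a c).mul continuous_const
  have hmain : ∀ b, LinearGrowth (fun t s => (Y t s * U) a b) ∧
      LinearGrowth (fun t s => (Y' t s * U) a b) := fun b =>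
    LinearGrowth.of_harmonic_oscillator (d := d b) (p := p) (fun t s => hder hY t s a b)
      (fun t s => by rw [← hZ'']; exact hder hY' t s a b) (hcont hp a b) (hcont hp' a b)
  have hback : ∀ W : Matrix (Fin r) (Fin r) ℂ, W a b = ∑ c, (W * U) a c * star U c b := by
    intro W
    rw [← Matrix.mul_apply, Matrix.mul_assoc, hUU, Matrix.mul_one]
  constructor
  · have := LinearGrowth.sum Finset.univ fun c _ =>
      (hmain c).1.mul_right (c := fun _ => star U c b) continuous_const
    convert this using 3 with t s
    exact hback _
  · have := LinearGrowth.sum Finset.univ fun c _ =>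
      (hmain c).2.mul_right (c := fun _ => star U c b) continuous_const
    convert this using 3 with t s
    exact hback _

/-! ### Dependence of the eigenfunctions on the spectral parameter -/

section Eigenfunctions

variable {n r : ℕ}

theorem hasDerivAt_matDeriv {g : ℝ → Matrix (Fin r) (Fin r) ℂ} {a b : Fin r}
    (hg : ContDiff ℝ 2 fun t => g t a b) (t : ℝ) :
    HasDerivAt (fun t => g t a b) (matDeriv g t a b) t :=
  (hg.differentiable (by norm_num) t).hasDerivAt

theorem hasDerivAt_matDeriv_matDeriv {g : ℝ → Matrix (Fin r) (Fin r) ℂ} {a b : Fin r}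
    (hg : ContDiff ℝ 2 fun t => g t a b) (t : ℝ) :
    HasDerivAt (fun t => matDeriv g t a b) (matDeriv (matDeriv g) t a b) t := by
  have : ContDiff ℝ 1 (deriv fun t => g t a b) :=
    (contDiff_succ_iff_deriv (n := 1).1 (by simpa [one_add_one_eq_two] using hg)).2.2
  exact (this.differentiable (by norm_num) t).hasDerivAt

section Exp

attribute [local instance] Matrix.linftyOpNormedRing Matrix.linftyOpNormedAlgebra

/-- Supplies the Cauchy data at `x = 0` in the last layer, where the normalization prescribes an
exponential. -/
theorem hasDerivAt_exp_smul_apply_zero (B : Matrix (Fin r) (Fin r) ℂ) (a b : Fin r) :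
    HasDerivAt (fun t : ℝ => NormedSpace.exp (t • B) a b) (B a b) 0 := by
  have h := hasDerivAt_exp_smul_const (𝕂 := ℝ) B (0 : ℝ)
  rw [zero_smul, NormedSpace.exp_zero, one_mul] at h
  let e : Matrix (Fin r) (Fin r) ℂ →L[ℝ] ℂ :=
    LinearMap.toContinuousLinearMap (Matrix.entryLinearMap ℝ ℂ a b)
  exact e.hasFDerivAt.comp_hasDerivAt (0 : ℝ) h

end Exp

theorem Medium.A_sq_mul_inv (D : Medium n r) (k : Fin (n + 1)) :
    D.A k ^ 2 * (D.A k ^ 2)⁻¹ = 1 :=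
  Matrix.mul_nonsing_inv _ (by
    rw [Matrix.det_pow]; exact ((D.posDef_A k).isUnit.map Matrix.detMonoidHom).pow 2)

namespace IsDualEigenfunction

variable {D : Medium n r} {ψ : Fin (n + 1) → ℝ → ℝ → Matrix (Fin r) (Fin r) ℂ}

theorem linearGrowth_of_continuous (hψ : IsDualEigenfunction D ψ) (k : Fin (n + 1)) (p : ℝ)
    (h0 : Continuous fun s => ψ k p s)
    (h1 : Continuous fun s => matDeriv (fun t => ψ k t s) p) (a b : Fin r) :
    LinearGrowth (fun t s => ψ k t s a b) ∧
      LinearGrowth (fun t s => matDeriv (fun t => ψ k t s) t a b) :=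
  linearGrowth_of_ode (D.posDef_A k) (p := p) (Y := ψ k)
    (Y' := fun t s => matDeriv (fun t => ψ k t s) t)
    (Y'' := fun t s => matDeriv (matDeriv (fun t => ψ k t s)) t)
    (fun t s a b => hasDerivAt_matDeriv (hψ.contDiff k s a b) t)
    (fun t s a b => hasDerivAt_matDeriv_matDeriv (hψ.contDiff k s a b) t)
    (fun t s => hψ.ode k s t) (fun a b => h0.matrix_elem a b) (fun a b => h1.matrix_elem a b) a b

/-- Continuity in `s` is not assumed. It is explicit in the last layer and moves left across each
interface: the dual coupling multiplied by `M₁` expresses the left Cauchy data through the right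
ones, and `A²` is invertible. -/
theorem linearGrowth (hψ : IsDualEigenfunction D ψ) (k : Fin (n + 1)) (a b : Fin r) :
    LinearGrowth (fun t s => ψ k t s a b) ∧
      LinearGrowth (fun t s => matDeriv (fun t => ψ k t s) t a b) := by
  induction k using Fin.reverseInduction generalizing a b with
  | last =>
    -- The point `0` need not lie in the last layer, but the solution is extended to `ℝ`. Its data
    -- there are `1` and `-i s A⁻¹`.
    refine hψ.linearGrowth_of_continuous _ 0 ?_ ?_ a b
    · simp only [hψ.normalization]
      simpa using continuous_const
    · have : ∀ s : ℝ, matDeriv (fun t => ψ (Fin.last n) t s) 0 =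
          (-(Complex.I * s)) • (D.A (Fin.last n))⁻¹ := by
        intro s
        ext a b
        have h := hasDerivAt_exp_smul_apply_zero ((-(Complex.I * s)) • (D.A (Fin.last n))⁻¹) a b
        rw [← h.deriv]
        simp only [matDeriv, Matrix.of_apply, hψ.normalization]
        congr 1
        funext t
        rw [← Complex.coe_smul t, smul_smul]
        rw [show (t : ℂ) * -(Complex.I * s) = -(Complex.I * s * t) by ring]
      simp only [this]
      fun_prop
  | cast i ih =>
    have hs0 : Continuous fun s => ψ i.succ (D.l i) s :=
      continuous_matrix fun a b => (ih a b).1.continuous_right _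
    have hs1 : Continuous fun s => matDeriv (fun t => ψ i.succ t s) (D.l i) :=
      continuous_matrix fun a b => (ih a b).2.continuous_right _
    have hM : IsUnit (D.M₁ i).det := isUnit_iff_ne_zero.2 (D.det₁_ne_zero i)
    have hR : Continuous fun s => Matrix.fromCols (ψ i.succ (D.l i) s * D.A i.succ ^ 2)
        (-(matDeriv (fun t => ψ i.succ t s) (D.l i) * D.A i.succ ^ 2)) * (D.M₂ i)⁻¹ * D.M₁ i := by
      refine ((continuous_matrix fun a b => ?_).matrix_mul continuous_const).matrix_mul
        continuous_const
      rcases b with b | b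
      · exact (hs0.matrix_mul continuous_const).matrix_elem a b
      · exact (hs1.matrix_mul continuous_const).neg.matrix_elem a b
    have e : ∀ s, Matrix.fromCols (ψ i.castSucc (D.l i) s * D.A i.castSucc ^ 2)
        (-(matDeriv (fun t => ψ i.castSucc t s) (D.l i) * D.A i.castSucc ^ 2)) =
        Matrix.fromCols (ψ i.succ (D.l i) s * D.A i.succ ^ 2)
        (-(matDeriv (fun t => ψ i.succ t s) (D.l i) * D.A i.succ ^ 2)) * (D.M₂ i)⁻¹ * D.M₁ i := by
      intro s
      rw [← hψ.coupling i s, Matrix.mul_assoc, Matrix.nonsing_inv_mul _ hM, Matrix.mul_one]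
    simp only [← e] at hR
    refine hψ.linearGrowth_of_continuous _ (D.l i) ?_ ?_ a b
    · have h : Continuous fun s => ψ i.castSucc (D.l i) s * D.A i.castSucc ^ 2 :=
        continuous_matrix fun a b => hR.matrix_elem a (Sum.inl b)
      have := h.matrix_mul (continuous_const (y := (D.A i.castSucc ^ 2)⁻¹))
      simpa only [Matrix.mul_assoc, D.A_sq_mul_inv, Matrix.mul_one] using this
    · have h : Continuous fun s =>
          -(matDeriv (fun t => ψ i.castSucc t s) (D.l i) * D.A i.castSucc ^ 2) :=
        continuous_matrix fun a b => hR.matrix_elem a (Sum.inr b)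
      have := h.neg.matrix_mul (continuous_const (y := (D.A i.castSucc ^ 2)⁻¹))
      simpa only [Pi.neg_apply, neg_neg, Matrix.mul_assoc, D.A_sq_mul_inv, Matrix.mul_one] using this

end IsDualEigenfunction

namespace IsDirectEigenfunction

variable {D : Medium n r} {φ : Fin (n + 1) → ℝ → ℝ → Matrix (Fin r) (Fin r) ℂ}

/-- As `A` is Hermitian and `s` is real, the conjugate transpose of a direct solution solves the
equation with matrices acting from the right. Hence the `star` and the exchange of indices. -/
theorem linearGrowth_of_continuous (hφ : IsDirectEigenfunction D φ) (k : Fin (n + 1)) (p : ℝ)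
    (h0 : Continuous fun s => φ k p s)
    (h1 : Continuous fun s => matDeriv (fun t => φ k t s) p) (a b : Fin r) :
    LinearGrowth (fun t s => star (φ k t s a b)) ∧
      LinearGrowth (fun t s => star (matDeriv (fun t => φ k t s) t a b)) :=
  linearGrowth_of_ode (D.posDef_A k) (p := p) (Y := fun t s => (φ k t s)ᴴ)
    (Y' := fun t s => (matDeriv (fun t => φ k t s) t)ᴴ)
    (Y'' := fun t s => (matDeriv (matDeriv (fun t => φ k t s)) t)ᴴ)
    (fun t s a b => (hasDerivAt_matDeriv (hφ.contDiff k s b a) t).star)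
    (fun t s a b => (hasDerivAt_matDeriv_matDeriv (hφ.contDiff k s b a) t).star)
    (fun t s => by
      have := congrArg Matrix.conjTranspose (hφ.ode k s t)
      rw [Matrix.conjTranspose_add, Matrix.conjTranspose_mul, Matrix.conjTranspose_pow,
        (D.posDef_A k).isHermitian.eq, Matrix.conjTranspose_smul] at this
      simpa using this)
    (fun a b => h0.star.matrix_elem a b) (fun a b => h1.star.matrix_elem a b) b a

/-- The point `x` is fixed in the transform, so only continuity in `s` is needed of `φ`. The
induction runs leftwards as for the dual problem. -/
theorem continuous_param (hφ : IsDirectEigenfunction D φ) (k : Fin (n + 1)) :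
    ∀ t, (Continuous fun s => φ k t s) ∧ Continuous fun s => matDeriv (fun t => φ k t s) t := by
  have key : ∀ k p, (Continuous fun s => φ k p s) →
      (Continuous fun s => matDeriv (fun t => φ k t s) p) → ∀ t, (Continuous fun s => φ k t s) ∧
      Continuous fun s => matDeriv (fun t => φ k t s) t := by
    intro k p h0 h1 t
    have h := hφ.linearGrowth_of_continuous k p h0 h1
    exact ⟨continuous_matrix fun a b => by
        simpa only [star_star] using ((h a b).1.continuous_right t).star,
      continuous_matrix fun a b => by
        simpa only [star_star] using ((h a b).2.continuous_right t).star⟩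
  induction k using Fin.reverseInduction with
  | last =>
    refine key _ 0 ?_ ?_
    · simp only [hφ.normalization]
      simpa using continuous_const
    · have : ∀ s : ℝ, matDeriv (fun t => φ (Fin.last n) t s) 0 =
          (Complex.I * s) • (D.A (Fin.last n))⁻¹ := by
        intro s
        ext a b
        have h := hasDerivAt_exp_smul_apply_zero ((Complex.I * s) • (D.A (Fin.last n))⁻¹) a b
        rw [← h.deriv]
        simp only [matDeriv, Matrix.of_apply, hφ.normalization]
        congr 1
        funext t
        rw [← Complex.coe_smul t, smul_smul]
        rw [show (t : ℂ) * (Complex.I * s) = Complex.I * s * t by ring]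
      simp only [this]
      fun_prop
  | cast i ih =>
    have hM : IsUnit (D.M₁ i).det := isUnit_iff_ne_zero.2 (D.det₁_ne_zero i)
    have hrows : ∀ (a : Fin 2 → Matrix (Fin r) (Fin r) ℂ) (b : Fin 2 → Matrix (Fin r) (Fin r) ℂ)
        (X Y : Matrix (Fin r) (Fin r) ℂ),
        Matrix.fromBlocks (a 0) (b 0) (a 1) (b 1) * Matrix.fromRows X Y =
        Matrix.fromRows (a 0 * X + b 0 * Y) (a 1 * X + b 1 * Y) := by
      intro a b X Y
      rw [← Matrix.fromRows_fromCols_eq_fromBlocks, Matrix.fromRows_mul, Matrix.fromCols_mul_fromRows,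
        Matrix.fromCols_mul_fromRows]
    -- The two coupling equations, stacked as block rows, read `M₁ (φ', φ) = M₂ (φ', φ)` and are
    -- solved for the left data.
    have e : ∀ s, Matrix.fromRows (matDeriv (fun t => φ i.castSucc t s) (D.l i))
        (φ i.castSucc (D.l i) s) = (D.M₁ i)⁻¹ * Matrix.fromRows
          (D.α₂ i 0 * matDeriv (fun t => φ i.succ t s) (D.l i) + D.β₂ i 0 * φ i.succ (D.l i) s)
          (D.α₂ i 1 * matDeriv (fun t => φ i.succ t s) (D.l i) +
            D.β₂ i 1 * φ i.succ (D.l i) s) := by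
      intro s
      rw [← hφ.coupling, ← hφ.coupling, ← hrows, ← Medium.M₁, ← Matrix.mul_assoc,
        Matrix.nonsing_inv_mul _ hM, Matrix.one_mul]
    obtain ⟨h0, h1⟩ := ih (D.l i)
    have hR : Continuous fun s => Matrix.fromRows (matDeriv (fun t => φ i.castSucc t s) (D.l i))
        (φ i.castSucc (D.l i) s) := by
      simp only [e]
      refine continuous_const.matrix_mul (continuous_matrix fun a b => ?_)
      have hc : ∀ q, Continuous fun s =>
          D.α₂ i q * matDeriv (fun t => φ i.succ t s) (D.l i) + D.β₂ i q * φ i.succ (D.l i) s :=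
        fun q => (continuous_const.matrix_mul h1).add (continuous_const.matrix_mul h0)
      rcases a with a | a
      · exact (hc 0).matrix_elem a b
      · exact (hc 1).matrix_elem a b
    exact key _ (D.l i) (continuous_matrix fun a b => hR.matrix_elem (Sum.inr a) b)
      (continuous_matrix fun a b => hR.matrix_elem (Sum.inl a) b)

end IsDirectEigenfunction

end Eigenfunctions

/-! ### The entire function `z ↦ (z / 2) ^ (-ν) J_ν(z)` as a function of `z ^ 2` -/

/-- The coefficients of `besselClifford`. -/
def besselCoeff (μ : ℝ) (p : ℕ) : ℝ := (-1 / 4) ^ p / (p.factorial * Real.Gamma (p + μ))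

/-- The entire function `w ↦ ∑ (-w/4)ᵖ / (p! Γ(p + μ))`; with `μ = ν + 1` its value at `z²` is
`(z / 2)^(-ν) J_ν(z)`. -/
def besselClifford (μ w : ℝ) : ℝ := ∑' p : ℕ, besselCoeff μ p * w ^ p

theorem exists_le_Gamma_nat_add {μ : ℝ} (hμ : 0 < μ) :
    ∃ c, 0 < c ∧ ∀ p : ℕ, c ≤ Real.Gamma (p + μ) := by
  have h1 : 0 < Real.Gamma (1 + μ) := Real.Gamma_pos_of_pos (by linarith)
  -- `Γ` may decrease between `μ` and `1 + μ` when `μ < 1`, so `p = 0` is treated apart. From `p =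
  -- 1` on, each step multiplies by a factor at least `1`.
  refine ⟨min (Real.Gamma μ) (Real.Gamma (1 + μ)), lt_min (Real.Gamma_pos_of_pos hμ) h1, ?_⟩
  have h : ∀ p : ℕ, Real.Gamma (1 + μ) ≤ Real.Gamma ((p + 1 : ℕ) + μ) := by
    intro p
    induction p with
    | zero => simp
    | succ p ih =>
      refine ih.trans ?_
      have e : ((p + 1 + 1 : ℕ) : ℝ) + μ = ((p + 1 : ℕ) + μ) + 1 := by push_cast; ring
      have hpos : (0 : ℝ) ≤ p := p.cast_nonneg
      rw [e, Real.Gamma_add_one (by push_cast; linarith)]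
      refine le_mul_of_one_le_left (h1.le.trans ih) ?_
      push_cast
      linarith
  intro p
  rcases p with _ | p
  · simp
  · exact (min_le_right _ _).trans (h p)

theorem exists_abs_besselCoeff_le {μ : ℝ} (hμ : 0 < μ) :
    ∃ C, ∀ p, |besselCoeff μ p| ≤ C * (1 / p.factorial) := by
  obtain ⟨c, hc, h⟩ := exists_le_Gamma_nat_add hμ
  refine ⟨1 / c, fun p => ?_⟩
  have hf : (0 : ℝ) < p.factorial := by exact_mod_cast p.factorial_pos
  have hG := hc.trans_le (h p)
  rw [besselCoeff, abs_div, abs_pow, abs_of_pos (mul_pos hf hG), div_mul_div_comm, one_mul]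
  refine div_le_div₀ zero_le_one ?_ (mul_pos hc hf) ?_
  · exact pow_le_one₀ (abs_nonneg _) (by norm_num [abs_le])
  · rw [mul_comm]
    exact mul_le_mul_of_nonneg_left (h p) hf.le

theorem summable_besselCoeff {μ : ℝ} (hμ : 0 < μ) (w : ℝ) :
    Summable fun p : ℕ => besselCoeff μ p * w ^ p := by
  obtain ⟨C, hC⟩ := exists_abs_besselCoeff_le hμ
  refine Summable.of_norm_bounded ((Real.summable_pow_div_factorial |w|).mul_left C) fun p => ?_
  rw [norm_mul, norm_pow, Real.norm_eq_abs, Real.norm_eq_abs]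
  calc _ ≤ C * (1 / p.factorial) * |w| ^ p := by
        gcongr
        exact hC p
    _ = _ := by ring

theorem besselCoeff_succ (μ : ℝ) (p : ℕ) :
    besselCoeff μ (p + 1) * (p + 1) = -1 / 4 * besselCoeff (μ + 1) p := by
  have hf : (p.factorial : ℝ) ≠ 0 := by exact_mod_cast p.factorial_ne_zero
  have hp : (p : ℝ) + 1 ≠ 0 := by positivity
  rw [besselCoeff, besselCoeff, Nat.factorial_succ, pow_succ]
  push_cast
  rw [show (p : ℝ) + 1 + μ = p + (μ + 1) by ring]
  rw [div_mul_eq_mul_div, mul_div_assoc', show ((p : ℝ) + 1) * p.factorial * Real.Gamma (p + (μ + 1))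
    = (p + 1) * (p.factorial * Real.Gamma (p + (μ + 1))) by ring, mul_comm _ ((p : ℝ) + 1),
    mul_div_mul_left _ _ hp]
  ring

/-- Termwise differentiation, dominated on a ball about `0` that contains `w`. Differentiation only
raises the parameter, so differential equations become relations between neighbouring parameters. -/
theorem hasDerivAt_besselClifford {μ : ℝ} (hμ : 0 < μ) (w : ℝ) :
    HasDerivAt (besselClifford μ) (-1 / 4 * besselClifford (μ + 1) w) w := by
  obtain ⟨C, hC⟩ := exists_abs_besselCoeff_le hμ
  have hC0 : 0 ≤ C := by simpa using (abs_nonneg _).trans (hC 0)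
  set R := |w| + 1 with hR
  have hw : w ∈ Metric.ball (0 : ℝ) R := by simp [hR]
  have hsum : Summable fun p : ℕ => C * (1 / p.factorial * (p * R ^ (p - 1))) := by
    refine Summable.mul_left C ?_
    rw [← summable_nat_add_iff 1]
    refine (Real.summable_pow_div_factorial R).congr fun p => ?_
    have hp : (p : ℝ) + 1 ≠ 0 := by positivity
    rw [Nat.factorial_succ]
    push_cast
    field_simp
  have h := hasDerivAt_tsum_of_isPreconnected hsum Metric.isOpen_ball
    (convex_ball (0 : ℝ) R).isPreconnected
    (g := fun p w => besselCoeff μ p * w ^ p) (g' := fun p w => besselCoeff μ p * (p * w ^ (p - 1)))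
    (fun p v _ => (hasDerivAt_pow p v).const_mul _)
    (fun p v hv => by
      rw [norm_mul, norm_mul, norm_pow, Real.norm_eq_abs, Real.norm_natCast, ← mul_assoc C]
      have : ‖v‖ ≤ R := by simpa using (Metric.mem_ball.1 hv).le
      gcongr
      exact hC p)
    hw (summable_besselCoeff hμ w) hw
  refine h.congr_deriv ?_
  rw [besselClifford, ← tsum_mul_left, tsum_eq_zero_add']
  · simp only [Nat.cast_zero, zero_mul, mul_zero, zero_add]
    congr 1
    funext p
    rw [← mul_assoc, ← mul_assoc, ← besselCoeff_succ]
    simp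
  · refine ((summable_besselCoeff (μ := μ + 1) (by linarith) w).mul_left (-1 / 4)).congr fun p => ?_
    rw [← mul_assoc, ← mul_assoc, ← besselCoeff_succ]
    simp

theorem continuous_besselClifford {μ : ℝ} (hμ : 0 < μ) : Continuous (besselClifford μ) :=
  continuous_iff_continuousAt.2 fun w => (hasDerivAt_besselClifford hμ w).continuousAt

/-- Contiguity, equivalent to the Bessel equation. -/
theorem besselClifford_contiguous {μ : ℝ} (hμ : 0 < μ) (w : ℝ) :
    w / 4 * besselClifford (μ + 1 + 1) w - μ * besselClifford (μ + 1) w + besselClifford μ w = 0 := by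
  have h0 := (summable_besselCoeff hμ w).hasSum
  have h1 := (summable_besselCoeff (μ := μ + 1) (by linarith) w).hasSum
  have h2 := (summable_besselCoeff (μ := μ + 1 + 1) (by linarith) w).hasSum
  have h2' : HasSum (fun p : ℕ => -((p : ℝ) * besselCoeff (μ + 1) p * w ^ p))
      (w / 4 * besselClifford (μ + 1 + 1) w) := by
    rw [← hasSum_nat_add_iff' 1]
    simp only [Finset.sum_range_one, Nat.cast_zero, zero_mul, neg_zero, sub_zero]
    refine (h2.mul_left (w / 4)).congr_fun fun p => ?_
    have := besselCoeff_succ (μ + 1) p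
    push_cast
    rw [pow_succ]
    linear_combination -w ^ p * w * this
  have h := (h2'.sub (h1.mul_left μ)).add h0
  refine h.unique ?_
  convert hasSum_zero using 2 with p
  have hp : (0 : ℝ) ≤ p := p.cast_nonneg
  have hG : Real.Gamma (p + (μ + 1)) = (p + μ) * Real.Gamma (p + μ) := by
    rw [← add_assoc, Real.Gamma_add_one (by linarith)]
  have key : (p + μ) * besselCoeff (μ + 1) p = besselCoeff μ p := by
    have : (p : ℝ) + μ ≠ 0 := by linarith
    rw [besselCoeff, besselCoeff, hG]
    field_simp
  rw [← key]
  ring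

/-- For `v(z) = besselClifford μ (z²)` the left side is `v'² + v²` at `w = z²`. The equation `v'' +
(2μ - 1) v' / z + v = 0` has nonnegative damping exactly when `μ ≥ 1 / 2`, so the energy does not
increase. With `μ = m / 2` this covers every `m ≥ 1`. -/
theorem besselClifford_energy_le {μ : ℝ} (hμ : 1 / 2 ≤ μ) {w : ℝ} (hw : 0 ≤ w) :
    4 * w * (-1 / 4 * besselClifford (μ + 1) w) ^ 2 + besselClifford μ w ^ 2 ≤
      besselClifford μ 0 ^ 2 := by
  have hμ0 : 0 < μ := by linarith
  have hd : ∀ w, HasDerivAt (fun w => 4 * w * (-1 / 4 * besselClifford (μ + 1) w) ^ 2 +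
      besselClifford μ w ^ 2) (-(2 * μ - 1) / 4 * besselClifford (μ + 1) w ^ 2) w := by
    intro w
    have h0 := hasDerivAt_besselClifford hμ0 w
    have h1 := (hasDerivAt_besselClifford (μ := μ + 1) (by linarith) w).const_mul (-1 / 4)
    refine ((((hasDerivAt_id w).const_mul 4).mul (h1.pow 2)).add (h0.pow 2)).congr_deriv ?_
    have := besselClifford_contiguous hμ0 w
    simp
    linear_combination (-1 / 2 * besselClifford (μ + 1) w) * this
  have hanti := antitone_of_hasDerivAt_nonpos hd fun w => by
    have := sq_nonneg (besselClifford (μ + 1) w)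
    simp only [Pi.zero_apply]
    nlinarith
  simpa using hanti hw

theorem abs_besselClifford_le {μ : ℝ} (hμ : 1 / 2 ≤ μ) {w : ℝ} (hw : 0 ≤ w) :
    |besselClifford μ w| ≤ |besselClifford μ 0| := by
  have h := besselClifford_energy_le hμ hw
  refine sq_le_sq.1 ?_
  nlinarith [sq_nonneg (-1 / 4 * besselClifford (μ + 1) w)]

/-- The quantity on the left is the derivative of `z ↦ besselClifford μ (z²)`, the kinetic part of
the energy. -/
theorem abs_deriv_besselClifford_le {μ : ℝ} (hμ : 1 / 2 ≤ μ) (z : ℝ) :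
    |2 * z * (-1 / 4 * besselClifford (μ + 1) (z ^ 2))| ≤ |besselClifford μ 0| := by
  have h := besselClifford_energy_le hμ (sq_nonneg z)
  refine sq_le_sq.1 ?_
  nlinarith [sq_nonneg (besselClifford μ (z ^ 2))]

theorem besselJ_eq {ν z : ℝ} (hz : 0 < z) :
    besselJ ν z = (z / 2) ^ ν * besselClifford (ν + 1) (z ^ 2) := by
  rw [besselJ, besselClifford, ← tsum_mul_left]
  congr 1
  funext p
  rw [Real.rpow_add (by positivity), ← Nat.cast_ofNat (R := ℝ), ← Nat.cast_mul, Real.rpow_natCast,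
    pow_mul, besselCoeff, div_pow, div_pow, div_pow, ← pow_mul, ← add_assoc]
  push_cast
  have : ((2 : ℝ) ^ 2) = 4 := by norm_num
  rw [this]
  ring

/-- The scalar factor of the kernel, away from the diagonal. -/
theorem sin_rpow_mul_besselJ {m : ℕ} (hm : 1 ≤ m) {ρ d θ : ℝ} (hρ : 0 < ρ) (hd : 0 < d)
    (hθ : 0 < Real.sin θ) :
    Real.sin θ ^ ((m : ℝ) / 2) *
      (besselJ (((m : ℝ) - 2) / 2) (ρ * Real.sin θ * d) / d ^ (((m : ℝ) - 2) / 2)) =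
    (ρ / 2) ^ (((m : ℝ) - 2) / 2) * Real.sin θ ^ (m - 1) *
      besselClifford (m / 2) ((ρ * Real.sin θ) ^ 2 * d ^ 2) := by
  have hd' : d ^ (((m : ℝ) - 2) / 2) ≠ 0 := (Real.rpow_pos_of_pos hd _).ne'
  -- The factor `(z / 2) ^ ν` of the Bessel function contributes `d ^ ν`, which cancels the
  -- denominator, and a power of `sin θ` that completes `m / 2` to the integer exponent `m - 1`.
  have e : Real.sin θ ^ (m - 1) = Real.sin θ ^ ((m : ℝ) / 2) * Real.sin θ ^ (((m : ℝ) - 2) / 2) := by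
    rw [← Real.rpow_add hθ, ← Real.rpow_natCast, Nat.cast_sub hm]
    congr 1
    push_cast
    ring
  rw [besselJ_eq (by positivity), e, show ((m : ℝ) - 2) / 2 + 1 = m / 2 by ring,
    show ρ * Real.sin θ * d / 2 = ρ / 2 * Real.sin θ * d by ring,
    Real.mul_rpow (by positivity) hd.le, Real.mul_rpow (by positivity) hθ.le, mul_pow _ d]
  field_simp

/-! ### Radial solutions of the Helmholtz equation -/

section Radial

variable {m : ℕ} (y : EuclideanSpace ℝ (Fin m))

/-- The radial solution of `Δ u = -c² u` centred at `y`. -/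
def radial (c : ℝ) (η : EuclideanSpace ℝ (Fin m)) : ℝ :=
  besselClifford (m / 2) (c ^ 2 * ‖y - η‖ ^ 2)

/-- The first partial derivatives of `radial`. -/
def radialPartial (i : Fin m) (c : ℝ) (η : EuclideanSpace ℝ (Fin m)) : ℝ :=
  -1 / 4 * besselClifford (m / 2 + 1) (c ^ 2 * ‖y - η‖ ^ 2) * (c ^ 2 * (2 * (η i - y i)))

/-- The pure second partial derivatives of `radial`. -/
def radialPartialPartial (i : Fin m) (c : ℝ) (η : EuclideanSpace ℝ (Fin m)) : ℝ :=
  1 / 16 * besselClifford (m / 2 + 1 + 1) (c ^ 2 * ‖y - η‖ ^ 2) * (c ^ 2 * (2 * (η i - y i))) ^ 2 +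
    -1 / 4 * besselClifford (m / 2 + 1) (c ^ 2 * ‖y - η‖ ^ 2) * (c ^ 2 * 2)

theorem hasDerivAt_norm_sub_sq (η : EuclideanSpace ℝ (Fin m)) (i : Fin m) (t : ℝ) :
    HasDerivAt (fun t : ℝ => ‖y - (η + t • EuclideanSpace.single i 1)‖ ^ 2)
      (2 * ((η + t • EuclideanSpace.single i (1 : ℝ)) i - y i)) t := by
  have h : (fun t : ℝ => ‖y - (η + t • EuclideanSpace.single i (1 : ℝ))‖ ^ 2) =
      fun t => ‖y - η‖ ^ 2 - 2 * (t * (y i - η i)) + t ^ 2 := by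
    funext t
    rw [← sub_sub, norm_sub_sq_real, inner_smul_right, norm_smul, mul_pow]
    simp [EuclideanSpace.inner_single_right]
  rw [h]
  refine ((((hasDerivAt_id t).mul_const (y i - η i)).const_mul 2).const_sub (‖y - η‖ ^ 2)
    |>.add ((hasDerivAt_id t).pow 2)).congr_deriv ?_
  simp
  ring

variable (hm : 1 ≤ m)
include hm

theorem hasDerivAt_radial (c : ℝ) (η : EuclideanSpace ℝ (Fin m)) (i : Fin m) (t : ℝ) :
    HasDerivAt (fun t : ℝ => radial y c (η + t • EuclideanSpace.single i 1))
      (radialPartial y i c (η + t • EuclideanSpace.single i 1)) t := by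
  have hm0 : (0 : ℝ) < m / 2 := by positivity
  exact (hasDerivAt_besselClifford hm0 _).comp t ((hasDerivAt_norm_sub_sq y η i t).const_mul (c ^ 2))

theorem hasDerivAt_radialPartial (c : ℝ) (η : EuclideanSpace ℝ (Fin m)) (i : Fin m) (t : ℝ) :
    HasDerivAt (fun t : ℝ => radialPartial y i c (η + t • EuclideanSpace.single i 1))
      (radialPartialPartial y i c (η + t • EuclideanSpace.single i 1)) t := by
  have hm0 : (0 : ℝ) < m / 2 + 1 := by positivity
  have h1 := (hasDerivAt_besselClifford hm0 _).comp t
    ((hasDerivAt_norm_sub_sq y η i t).const_mul (c ^ 2))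
  have h2 : HasDerivAt (fun t : ℝ => c ^ 2 * (2 * ((η + t • EuclideanSpace.single i (1 : ℝ)) i - y i)))
      (c ^ 2 * 2) t := by
    simpa using (((hasDerivAt_id t).const_add (η i)).sub_const (y i)).const_mul 2 |>.const_mul (c ^ 2)
  refine ((h1.const_mul (-1 / 4)).mul h2).congr_deriv ?_
  simp only [radialPartialPartial, Function.comp_apply]
  ring

theorem continuous_radial :
    Continuous fun q : ℝ × EuclideanSpace ℝ (Fin m) => radial y q.1 q.2 := by
  have hm0 : (0 : ℝ) < m / 2 := by positivity
  exact (continuous_besselClifford hm0).comp (by fun_prop)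

theorem continuous_radialPartial (i : Fin m) :
    Continuous fun q : ℝ × EuclideanSpace ℝ (Fin m) => radialPartial y i q.1 q.2 := by
  have h1 := continuous_besselClifford (μ := m / 2 + 1) (by positivity)
  unfold radialPartial
  exact (continuous_const.mul (h1.comp (by fun_prop))).mul (by fun_prop)

theorem continuous_radialPartialPartial (i : Fin m) :
    Continuous fun q : ℝ × EuclideanSpace ℝ (Fin m) => radialPartialPartial y i q.1 q.2 := by
  have h1 := continuous_besselClifford (μ := m / 2 + 1) (by positivity)
  have h2 := continuous_besselClifford (μ := m / 2 + 1 + 1) (by positivity)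
  unfold radialPartialPartial
  exact ((continuous_const.mul (h2.comp (by fun_prop))).mul (by fun_prop)).add
    ((continuous_const.mul (h1.comp (by fun_prop))).mul (by fun_prop))

/-- This is the contiguity relation at `w = c² ‖y - η‖²`. Summing the `m` equal terms with the first
derivative produces the coefficient `μ = m / 2`. -/
theorem sum_radialPartialPartial (c : ℝ) (η : EuclideanSpace ℝ (Fin m)) :
    ∑ i, radialPartialPartial y i c η = -c ^ 2 * radial y c η := by
  have h := besselClifford_contiguous (μ := m / 2) (by positivity) (c ^ 2 * ‖y - η‖ ^ 2)
  have hn : ‖y - η‖ ^ 2 = ∑ i, (η i - y i) ^ 2 := by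
    rw [EuclideanSpace.norm_sq_eq]
    refine Finset.sum_congr rfl fun i _ => ?_
    rw [Real.norm_eq_abs, sq_abs, PiLp.sub_apply]
    ring
  have e : ∑ i, (c ^ 2 * (2 * (η i - y i))) ^ 2 = 4 * c ^ 4 * ‖y - η‖ ^ 2 := by
    rw [hn, Finset.mul_sum]
    exact Finset.sum_congr rfl fun i _ => by ring
  simp only [radialPartialPartial, Finset.sum_add_distrib, ← Finset.mul_sum, e, Finset.sum_const,
    Finset.card_univ, Fintype.card_fin, nsmul_eq_mul, radial]
  linear_combination c ^ 2 * h

theorem abs_radial_le (c : ℝ) (η : EuclideanSpace ℝ (Fin m)) :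
    |radial y c η| ≤ |besselClifford (m / 2) 0| := by
  have hm1 : (1 : ℝ) ≤ m := by exact_mod_cast hm
  exact abs_besselClifford_le (by linarith) (by positivity)

/-- By the chain rule the partial derivative is `c` times the derivative in `z = c ‖y - η‖` times a
direction cosine, so the energy bound is uniform in `η`. -/
theorem abs_radialPartial_le (i : Fin m) (c : ℝ) (η : EuclideanSpace ℝ (Fin m)) :
    |radialPartial y i c η| ≤ |c| * |besselClifford (m / 2) 0| := by
  have hm1 : (1 : ℝ) ≤ m := by exact_mod_cast hm
  have h := abs_deriv_besselClifford_le (μ := m / 2) (by linarith) (c * ‖y - η‖)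
  have hi : |η i - y i| ≤ ‖y - η‖ := by
    have := PiLp.norm_apply_le (y - η) i
    rwa [PiLp.sub_apply, Real.norm_eq_abs, abs_sub_comm] at this
  refine le_trans ?_ (mul_le_mul_of_nonneg_left h (abs_nonneg c))
  rw [radialPartial, mul_pow]
  simp only [abs_mul, abs_norm, abs_pow]
  have := mul_le_mul_of_nonneg_left hi (show 0 ≤ |(-1 / 4 : ℝ)| *
    |besselClifford (m / 2 + 1) (c ^ 2 * ‖y - η‖ ^ 2)| * (|c| ^ 2 * |2|) by positivity)
  linarith

end Radial

/-! ### Twice differentiable functions of `(ξ, η)` -/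

/-- `p₁`, `p₂` are the first two derivatives of `p` in the first variable, `q i` and `q' i` the first
two in the `i`-th coordinate of the second; all are jointly continuous. -/
structure HasPartials {m : ℕ} (p p₁ p₂ : ℝ → EuclideanSpace ℝ (Fin m) → ℂ)
    (q q' : Fin m → ℝ → EuclideanSpace ℝ (Fin m) → ℂ) : Prop where
  cont : Continuous (Function.uncurry p)
  cont₁ : Continuous (Function.uncurry p₁)
  cont₂ : Continuous (Function.uncurry p₂)
  contq : ∀ i, Continuous (Function.uncurry (q i))
  contq' : ∀ i, Continuous (Function.uncurry (q' i))
  deriv₁ : ∀ ξ η, HasDerivAt (fun t => p t η) (p₁ ξ η) ξ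
  deriv₂ : ∀ ξ η, HasDerivAt (fun t => p₁ t η) (p₂ ξ η) ξ
  derivq : ∀ i ξ η, HasLineDerivAt ℝ (p ξ) (q i ξ η) η (EuclideanSpace.single i 1)
  derivq' : ∀ i ξ η, HasLineDerivAt ℝ (q i ξ) (q' i ξ η) η (EuclideanSpace.single i 1)

theorem hasDerivAt_intervalIntegral_of_continuous {F F' : ℝ → ℝ → ℂ} {a b : ℝ}
    (hF : ∀ t, Continuous (F t)) (hF' : Continuous (Function.uncurry F'))
    (h : ∀ t θ, HasDerivAt (fun t => F t θ) (F' t θ) t) (t : ℝ) :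
    HasDerivAt (fun t => ∫ θ in a..b, F t θ) (∫ θ in a..b, F' t θ) t := by
  obtain ⟨C, hC⟩ := ((isCompact_Icc (a := t - 1) (b := t + 1)).prod
    (isCompact_uIcc (a := a) (b := b))).exists_bound_of_continuousOn hF'.continuousOn
  refine (intervalIntegral.hasDerivAt_integral_of_dominated_loc_of_deriv_le (bound := fun _ => C)
    (Icc_mem_nhds (by linarith : t - 1 < t) (by linarith : t < t + 1))
    (Eventually.of_forall fun t => (hF t).aestronglyMeasurable)
    ((hF t).intervalIntegrable _ _)
    (hF'.comp (Continuous.prodMk_right t)).aestronglyMeasurable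
    (Eventually.of_forall fun θ hθ s hs => ?_)
    intervalIntegrable_const (Eventually.of_forall fun θ _ s _ => h s θ)).2
  exact hC (s, θ) ⟨hs, Set.uIoc_subset_uIcc hθ⟩

theorem continuous_intervalIntegral_mul {m : ℕ} {c : ℝ → ℝ} (hc : Continuous c) {a b : ℝ}
    {g : ℝ → EuclideanSpace ℝ (Fin m) → ℝ}
    (hg : Continuous fun q : ℝ × EuclideanSpace ℝ (Fin m) => g q.1 q.2)
    {κ : ℝ → ℝ → ℂ} (hκ : Continuous (Function.uncurry κ)) :
    Continuous (Function.uncurry fun (ξ : ℝ) (η : EuclideanSpace ℝ (Fin m)) =>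
      ∫ θ in a..b, (g (c θ) η : ℂ) * κ ξ θ) := by
  refine intervalIntegral.continuous_parametric_intervalIntegral_of_continuous' (X := ℝ × _)
    (f := fun q θ => (g (c θ) q.2 : ℂ) * κ q.1 θ) ?_ a b
  have h1 : Continuous fun q : (ℝ × EuclideanSpace ℝ (Fin m)) × ℝ => g (c q.2) q.1.2 :=
    hg.comp (f := fun q : (ℝ × EuclideanSpace ℝ (Fin m)) × ℝ => (c q.2, q.1.2)) (by fun_prop)
  have h2 : Continuous fun q : (ℝ × EuclideanSpace ℝ (Fin m)) × ℝ => κ q.1.1 q.2 :=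
    hκ.comp (f := fun q : (ℝ × EuclideanSpace ℝ (Fin m)) × ℝ => (q.1.1, q.2)) (by fun_prop)
  exact (Complex.continuous_ofReal.comp h1).mul h2

/-- The integrand separates variables for each `θ`: derivatives in `ξ` fall on `κ`, those in `η` on
the radial factor. Joint continuity justifies differentiation under the integral over a bounded
interval. -/
theorem hasPartials_integral_radial {m : ℕ} (hm : 1 ≤ m) (y : EuclideanSpace ℝ (Fin m)) {a b : ℝ}
    {c : ℝ → ℝ} (hc : Continuous c) {κ κ₁ κ₂ : ℝ → ℝ → ℂ} (h0 : Continuous (Function.uncurry κ))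
    (h1 : Continuous (Function.uncurry κ₁)) (h2 : Continuous (Function.uncurry κ₂))
    (hd1 : ∀ t θ, HasDerivAt (fun t => κ t θ) (κ₁ t θ) t)
    (hd2 : ∀ t θ, HasDerivAt (fun t => κ₁ t θ) (κ₂ t θ) t) :
    HasPartials (fun ξ η => ∫ θ in a..b, (radial y (c θ) η : ℂ) * κ ξ θ)
      (fun ξ η => ∫ θ in a..b, (radial y (c θ) η : ℂ) * κ₁ ξ θ)
      (fun ξ η => ∫ θ in a..b, (radial y (c θ) η : ℂ) * κ₂ ξ θ)
      (fun i ξ η => ∫ θ in a..b, (radialPartial y i (c θ) η : ℂ) * κ ξ θ)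
      (fun i ξ η => ∫ θ in a..b, (radialPartialPartial y i (c θ) η : ℂ) * κ ξ θ) := by
  have hcont : ∀ {g : ℝ → EuclideanSpace ℝ (Fin m) → ℝ}
      (_ : Continuous fun q : ℝ × EuclideanSpace ℝ (Fin m) => g q.1 q.2) {κ : ℝ → ℝ → ℂ}
      (_ : Continuous (Function.uncurry κ)) {X : Type} [TopologicalSpace X] {u : X → ℝ}
      {v : X → EuclideanSpace ℝ (Fin m)} {w : X → ℝ} (_ : Continuous u) (_ : Continuous v)
      (_ : Continuous w), Continuous fun x => (g (c (u x)) (v x) : ℂ) * κ (w x) (u x) := by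
    intro g hg κ hκ X _ u v w hu hv hw
    have e1 : Continuous fun x => g (c (u x)) (v x) :=
      hg.comp (f := fun x => (c (u x), v x)) (by fun_prop)
    have e2 : Continuous fun x => κ (w x) (u x) := hκ.comp (f := fun x => (w x, u x)) (by fun_prop)
    exact (Complex.continuous_ofReal.comp e1).mul e2
  have hξ : ∀ {κ κ₁ : ℝ → ℝ → ℂ}, Continuous (Function.uncurry κ) →
      Continuous (Function.uncurry κ₁) → (∀ t θ, HasDerivAt (fun t => κ t θ) (κ₁ t θ) t) →
      ∀ ξ η, HasDerivAt (fun t => ∫ θ in a..b, (radial y (c θ) η : ℂ) * κ t θ)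
        (∫ θ in a..b, (radial y (c θ) η : ℂ) * κ₁ ξ θ) ξ := by
    intro κ κ₁ h0 h1 hd ξ η
    exact hasDerivAt_intervalIntegral_of_continuous
      (F := fun t θ => (radial y (c θ) η : ℂ) * κ t θ)
      (F' := fun t θ => (radial y (c θ) η : ℂ) * κ₁ t θ)
      (fun t => hcont (continuous_radial y hm) h0 continuous_id continuous_const continuous_const)
      (hcont (continuous_radial y hm) h1 continuous_snd continuous_const continuous_fst)
      (fun t θ => (hd t θ).const_mul _) ξ
  have hη : ∀ {g g' : ℝ → EuclideanSpace ℝ (Fin m) → ℝ} (i : Fin m),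
      (Continuous fun q : ℝ × EuclideanSpace ℝ (Fin m) => g q.1 q.2) →
      (Continuous fun q : ℝ × EuclideanSpace ℝ (Fin m) => g' q.1 q.2) →
      (∀ c η t, HasDerivAt (fun t : ℝ => g c (η + t • EuclideanSpace.single i 1))
        (g' c (η + t • EuclideanSpace.single i 1)) t) →
      ∀ ξ η, HasLineDerivAt ℝ (fun η => ∫ θ in a..b, (g (c θ) η : ℂ) * κ ξ θ)
        (∫ θ in a..b, (g' (c θ) η : ℂ) * κ ξ θ) η (EuclideanSpace.single i 1) := by
    intro g g' i hg hg' hd ξ η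
    have := hasDerivAt_intervalIntegral_of_continuous (a := a) (b := b)
      (F := fun t θ => (g (c θ) (η + t • EuclideanSpace.single i 1) : ℂ) * κ ξ θ)
      (F' := fun t θ => (g' (c θ) (η + t • EuclideanSpace.single i 1) : ℂ) * κ ξ θ)
      (fun t => hcont hg h0 continuous_id continuous_const continuous_const)
      (hcont hg' h0 continuous_snd (by fun_prop) continuous_const)
      (fun t θ => (hd (c θ) η t).ofReal_comp.mul_const _) 0
    rw [HasLineDerivAt]
    simpa only [zero_smul, add_zero] using this
  exact
  { cont := continuous_intervalIntegral_mul hc (continuous_radial y hm) h0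
    cont₁ := continuous_intervalIntegral_mul hc (continuous_radial y hm) h1
    cont₂ := continuous_intervalIntegral_mul hc (continuous_radial y hm) h2
    contq := fun i => continuous_intervalIntegral_mul hc (continuous_radialPartial y hm i) h0
    contq' := fun i => continuous_intervalIntegral_mul hc (continuous_radialPartialPartial y hm i) h0
    deriv₁ := hξ h0 h1 hd1
    deriv₂ := hξ h1 h2 hd2
    derivq := fun i => hη i (continuous_radial y hm) (continuous_radialPartial y hm i)
      fun c η t => hasDerivAt_radial y hm c η i t
    derivq' := fun i => hη i (continuous_radialPartial y hm i)
      (continuous_radialPartialPartial y hm i) fun c η t => hasDerivAt_radialPartial y hm c η i t }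

/-! ### Integration by parts -/

section ByParts

variable {m : ℕ}

theorem hasLineDerivAt_fderiv {g : EuclideanSpace ℝ (Fin m) → ℂ} (hg : Differentiable ℝ g)
    (η v : EuclideanSpace ℝ (Fin m)) : HasLineDerivAt ℝ g (fderiv ℝ g η v) η v :=
  (hg η).hasFDerivAt.hasLineDerivAt v

theorem laplacian_eq_sum_fderiv {g : EuclideanSpace ℝ (Fin m) → ℂ} (hg : ContDiff ℝ 2 g)
    (η : EuclideanSpace ℝ (Fin m)) :
    Laplacian.laplacian g η = ∑ i, fderiv ℝ (fun η => fderiv ℝ g η (EuclideanSpace.single i 1)) η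
      (EuclideanSpace.single i 1) := by
  have h1 : ContDiff ℝ 1 (fderiv ℝ g) := hg.fderiv_right (by norm_num)
  rw [InnerProductSpace.laplacian_eq_iteratedFDeriv_orthonormalBasis g
    (EuclideanSpace.basisFun (Fin m) ℝ)]
  refine Finset.sum_congr rfl fun i _ => ?_
  rw [iteratedFDeriv_two_apply, fderiv_clm_apply (h1.differentiable (by norm_num) η)
    (differentiableAt_const _)]
  simp

/-- Two integrations by parts in each coordinate. The compact support of `p` and its derivatives
removes boundary terms and makes every product integrable, whatever the growth of `g`. -/
theorem integral_mul_laplacian {S : Set (EuclideanSpace ℝ (Fin m))} (hS : IsCompact S)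
    {p : EuclideanSpace ℝ (Fin m) → ℂ} {q q' : Fin m → EuclideanSpace ℝ (Fin m) → ℂ}
    (hp : Continuous p) (hq : ∀ i, Continuous (q i)) (hq' : ∀ i, Continuous (q' i))
    (hp0 : ∀ η ∉ S, p η = 0) (hq0 : ∀ i, ∀ η ∉ S, q i η = 0) (hq'0 : ∀ i, ∀ η ∉ S, q' i η = 0)
    (hpq : ∀ i η, HasLineDerivAt ℝ p (q i η) η (EuclideanSpace.single i 1))
    (hqq' : ∀ i η, HasLineDerivAt ℝ (q i) (q' i η) η (EuclideanSpace.single i 1))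
    {g : EuclideanSpace ℝ (Fin m) → ℂ} (hg : ContDiff ℝ 2 g) :
    ∫ η, p η * Laplacian.laplacian g η = ∫ η, (∑ i, q' i η) * g η := by
  have hint : ∀ {p g : EuclideanSpace ℝ (Fin m) → ℂ}, Continuous p → Continuous g →
      (∀ η ∉ S, p η = 0) → Integrable fun η => p η * g η := by
    intro p g hp hg h0
    exact (hp.mul hg).integrable_of_hasCompactSupport
      (HasCompactSupport.intro hS fun η hη => by rw [Pi.mul_apply, h0 η hη, zero_mul])
  have h1 : ∀ i, ContDiff ℝ 1 fun η => fderiv ℝ g η (EuclideanSpace.single i 1) := fun i =>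
    (hg.fderiv_right (m := 1) (by norm_num)).clm_apply contDiff_const
  have h2 : ∀ i, Continuous fun η => fderiv ℝ (fun η => fderiv ℝ g η (EuclideanSpace.single i 1)) η
      (EuclideanSpace.single i 1) := fun i =>
    ((h1 i).continuous_fderiv (by norm_num)).clm_apply continuous_const
  have key : ∀ {p p' g g' : EuclideanSpace ℝ (Fin m) → ℂ} (i : Fin m), Continuous p → Continuous p' →
      Continuous g → Continuous g' → (∀ η ∉ S, p η = 0) → (∀ η ∉ S, p' η = 0) →
      (∀ η, HasLineDerivAt ℝ p (p' η) η (EuclideanSpace.single i 1)) →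
      (∀ η, HasLineDerivAt ℝ g (g' η) η (EuclideanSpace.single i 1)) →
      ∫ η, p η * g' η = -∫ η, p' η * g η := by
    intro p p' g g' i hp hp' hg hg' h0 h0' hd hd'
    exact integral_bilinear_hasLineDerivAt_right_eq_neg_left_of_integrable
      (B := ContinuousLinearMap.mul ℝ ℂ) (hint hp' hg h0') (hint hp hg' h0) (hint hp hg h0)
      (fun x _ => hd x) (fun x _ => hd' x)
  simp only [laplacian_eq_sum_fderiv hg, Finset.mul_sum, Finset.sum_mul]
  rw [integral_finsetSum _ fun i _ => hint hp (h2 i) hp0,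
    integral_finsetSum _ fun i _ => hint (hq' i) hg.continuous (hq'0 i)]
  refine Finset.sum_congr rfl fun i _ => ?_
  rw [key i hp (hq i) (h1 i).continuous (h2 i) hp0 (hq0 i) (hpq i)
      fun η => hasLineDerivAt_fderiv ((h1 i).differentiable (by norm_num)) η _,
    key i (hq i) (hq' i) hg.continuous (h1 i).continuous (hq0 i) (hq'0 i) (hqq' i)
      fun η => hasLineDerivAt_fderiv (hg.differentiable (by norm_num)) η _, neg_neg]

theorem hasDerivAt_integral_of_compact {S : Set (EuclideanSpace ℝ (Fin m))} (hS : IsCompact S)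
    {I : Set ℝ} (hI : IsOpen I) {F F' : ℝ → EuclideanSpace ℝ (Fin m) → ℂ}
    (hF : ContinuousOn (Function.uncurry F) (I ×ˢ Set.univ))
    (hF' : ContinuousOn (Function.uncurry F') (I ×ˢ Set.univ))
    (h0 : ∀ ξ, ∀ η ∉ S, F ξ η = 0) (h0' : ∀ ξ, ∀ η ∉ S, F' ξ η = 0)
    (hd : ∀ ξ ∈ I, ∀ η, HasDerivAt (fun t => F t η) (F' ξ η) ξ) {ξ : ℝ} (hξ : ξ ∈ I) :
    HasDerivAt (fun t => ∫ η, F t η) (∫ η, F' ξ η) ξ := by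
  have hsec : ∀ {F : ℝ → EuclideanSpace ℝ (Fin m) → ℂ},
      ContinuousOn (Function.uncurry F) (I ×ˢ Set.univ) → ∀ t ∈ I, Continuous (F t) := by
    intro F hF t ht
    exact hF.comp_continuous (Continuous.prodMk_right t) fun η => ⟨ht, trivial⟩
  obtain ⟨ε, hε, hball⟩ := Metric.nhds_basis_closedBall.mem_iff.1 (hI.mem_nhds hξ)
  obtain ⟨C, hC⟩ := ((isCompact_closedBall ξ ε).prod hS).exists_bound_of_continuousOn
    (hF'.mono (Set.prod_mono hball (Set.subset_univ S)))
  refine (hasDerivAt_integral_of_dominated_loc_of_deriv_le (bound := S.indicator fun _ => C)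
    (Metric.closedBall_mem_nhds ξ hε) ?_ ?_ (hsec hF' ξ hξ).aestronglyMeasurable ?_ ?_ ?_).2
  · filter_upwards [hI.mem_nhds hξ] with t ht
    exact (hsec hF t ht).aestronglyMeasurable
  · exact (hsec hF ξ hξ).integrable_of_hasCompactSupport (HasCompactSupport.intro hS (h0 ξ))
  · refine Eventually.of_forall fun η t ht => ?_
    by_cases hη : η ∈ S
    · rw [Set.indicator_of_mem hη]
      exact hC (t, η) ⟨ht, hη⟩
    · rw [Set.indicator_of_notMem hη, h0' t η hη, norm_zero]
  · exact (integrable_indicator_iff hS.measurableSet).2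
      (integrableOn_const hS.measure_lt_top.ne)
  · exact Eventually.of_forall fun η t ht => hd t (hball ht) η

end ByParts

/-! ### Functions of class `C²` on a slab -/

section Slab

variable {m r : ℕ} {I : Set ℝ} {f : ℝ → EuclideanSpace ℝ (Fin m) → Fin r → ℂ}

theorem hasDerivAt_dx (hI : IsOpen I)
    (hf : ContDiffOn ℝ 1 (fun p : ℝ × EuclideanSpace ℝ (Fin m) => f p.1 p.2) (I ×ˢ Set.univ))
    {ξ : ℝ} (hξ : ξ ∈ I) (η : EuclideanSpace ℝ (Fin m)) :
    HasDerivAt (fun t => f t η) (dx f ξ η) ξ ∧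
      dx f ξ η = fderiv ℝ (fun p : ℝ × EuclideanSpace ℝ (Fin m) => f p.1 p.2) (ξ, η) (1, 0) := by
  have hU : I ×ˢ (Set.univ : Set (EuclideanSpace ℝ (Fin m))) ∈ 𝓝 (ξ, η) :=
    (hI.prod isOpen_univ).mem_nhds ⟨hξ, trivial⟩
  have h1 := ((hf.contDiffAt hU).differentiableAt (by norm_num)).hasFDerivAt
  have h2 : HasDerivAt (fun t : ℝ => (t, η)) ((1 : ℝ), (0 : EuclideanSpace ℝ (Fin m))) ξ :=
    (hasDerivAt_id ξ).prodMk (hasDerivAt_const ξ η)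
  have h3 : HasDerivAt (fun t => f t η)
      (fderiv ℝ (fun p : ℝ × EuclideanSpace ℝ (Fin m) => f p.1 p.2) (ξ, η) (1, 0)) ξ :=
    h1.comp_hasDerivAt (f := fun t : ℝ => (t, η)) ξ h2
  have h4 : dx f ξ η = _ := h3.deriv
  exact ⟨h4 ▸ h3, h4⟩

theorem contDiffOn_dx (hI : IsOpen I)
    (hf : ContDiffOn ℝ 2 (fun p : ℝ × EuclideanSpace ℝ (Fin m) => f p.1 p.2) (I ×ˢ Set.univ)) :
    ContDiffOn ℝ 1 (fun p : ℝ × EuclideanSpace ℝ (Fin m) => dx f p.1 p.2) (I ×ˢ Set.univ) := by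
  have h := (hf.fderiv_of_isOpen (m := 1) (hI.prod isOpen_univ) (by norm_num)).clm_apply
    (contDiffOn_const (c := ((1 : ℝ), (0 : EuclideanSpace ℝ (Fin m)))))
  exact h.congr fun p hp => (hasDerivAt_dx hI (hf.of_le (by norm_num)) hp.1 p.2).2

theorem continuousOn_dx_dx (hI : IsOpen I)
    (hf : ContDiffOn ℝ 2 (fun p : ℝ × EuclideanSpace ℝ (Fin m) => f p.1 p.2) (I ×ˢ Set.univ)) :
    ContinuousOn (fun p : ℝ × EuclideanSpace ℝ (Fin m) => dx (dx f) p.1 p.2) (I ×ˢ Set.univ) := by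
  have h1 := contDiffOn_dx hI hf
  have h := (h1.continuousOn_fderiv_of_isOpen (hI.prod isOpen_univ) le_rfl).clm_apply
    (continuousOn_const (c := ((1 : ℝ), (0 : EuclideanSpace ℝ (Fin m)))))
  exact h.congr fun p hp => (hasDerivAt_dx hI h1 hp.1 p.2).2

theorem contDiff_section
    (hf : ContDiffOn ℝ 2 (fun p : ℝ × EuclideanSpace ℝ (Fin m) => f p.1 p.2) (I ×ˢ Set.univ))
    {ξ : ℝ} (hξ : ξ ∈ I) : ContDiff ℝ 2 (f ξ) := by
  rw [← contDiffOn_univ]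
  exact hf.comp (f := fun η => (ξ, η)) (contDiff_prodMk_right ξ).contDiffOn fun η _ => ⟨hξ, trivial⟩

theorem laplacian_apply {g : EuclideanSpace ℝ (Fin m) → Fin r → ℂ} (hg : ContDiff ℝ 2 g)
    (η : EuclideanSpace ℝ (Fin m)) (b : Fin r) :
    Laplacian.laplacian g η b = Laplacian.laplacian (fun η => g η b) η := by
  have h := (hg.contDiffAt (x := η)).laplacian_CLM_comp_left
    (l := ContinuousLinearMap.proj (R := ℝ) (φ := fun _ : Fin r => ℂ) b)
  exact h.symm

end Slab

/-! ### Green's identity on a slab -/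

/-- A `C²` row-vector valued function on `ℝ × ℝᵐ` together with its partial derivatives. -/
structure TestRow (m r : ℕ) where
  P : ℝ → EuclideanSpace ℝ (Fin m) → Fin r → ℂ
  P₁ : ℝ → EuclideanSpace ℝ (Fin m) → Fin r → ℂ
  P₂ : ℝ → EuclideanSpace ℝ (Fin m) → Fin r → ℂ
  Q : Fin m → ℝ → EuclideanSpace ℝ (Fin m) → Fin r → ℂ
  Q' : Fin m → ℝ → EuclideanSpace ℝ (Fin m) → Fin r → ℂ
  partials : ∀ b, HasPartials (fun ξ η => P ξ η b) (fun ξ η => P₁ ξ η b) (fun ξ η => P₂ ξ η b)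
    (fun i ξ η => Q i ξ η b) (fun i ξ η => Q' i ξ η b)

namespace TestRow

variable {m r : ℕ} (T : TestRow m r) (A : Matrix (Fin r) (Fin r) ℂ)

/-- The transposed operator applied to the test function. -/
def adj (ξ : ℝ) (η : EuclideanSpace ℝ (Fin m)) : Fin r → ℂ :=
  T.P₂ ξ η ᵥ* A ^ 2 + ∑ i, T.Q' i ξ η

/-- The function and its derivatives vanish at a point. -/
def VanishesAt (ξ : ℝ) (η : EuclideanSpace ℝ (Fin m)) : Prop :=
  T.P ξ η = 0 ∧ T.P₁ ξ η = 0 ∧ T.P₂ ξ η = 0 ∧ ∀ i, T.Q i ξ η = 0 ∧ T.Q' i ξ η = 0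

/-- The boundary flux density. -/
def flux (ξ : ℝ) (η : EuclideanSpace ℝ (Fin m)) (u v : Fin r → ℂ) : ℂ :=
  (T.P ξ η ᵥ* A ^ 2) ⬝ᵥ v - (T.P₁ ξ η ᵥ* A ^ 2) ⬝ᵥ u

theorem continuous_P : Continuous (Function.uncurry T.P) := continuous_pi fun b => (T.partials b).cont

theorem continuous_P₁ : Continuous (Function.uncurry T.P₁) :=
  continuous_pi fun b => (T.partials b).cont₁

theorem continuous_P₂ : Continuous (Function.uncurry T.P₂) :=
  continuous_pi fun b => (T.partials b).cont₂

theorem continuous_Q' (i : Fin m) : Continuous (Function.uncurry (T.Q' i)) :=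
  continuous_pi fun b => (T.partials b).contq' i

theorem continuous_adj : Continuous (Function.uncurry (T.adj A)) := by
  have h1 := T.continuous_P₂.matrix_vecMul (continuous_const (y := A ^ 2))
  exact h1.add (continuous_finsetSum _ fun i _ => T.continuous_Q' i)

theorem flux_eq_zero {ξ : ℝ} {η : EuclideanSpace ℝ (Fin m)} (h : T.VanishesAt ξ η)
    (u v : Fin r → ℂ) : T.flux A ξ η u v = 0 := by
  simp [flux, h.1, h.2.1]

theorem adj_eq_zero {ξ : ℝ} {η : EuclideanSpace ℝ (Fin m)} (h : T.VanishesAt ξ η) :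
    T.adj A ξ η = 0 := by
  simp [adj, h.2.2.1, fun i => (h.2.2.2 i).2]

end TestRow

theorem continuousOn_dotProduct {X : Type*} [TopologicalSpace X] {r : ℕ} {s : Set X}
    {u v : X → Fin r → ℂ} (hu : ContinuousOn u s) (hv : ContinuousOn v s) :
    ContinuousOn (fun x => u x ⬝ᵥ v x) s := by
  rw [continuousOn_iff_continuous_domRestrict] at *
  exact hu.dotProduct hv

theorem hasDerivAt_dotProduct {r : ℕ} {u v : ℝ → Fin r → ℂ} {u' v' : Fin r → ℂ} {t : ℝ}
    (hu : HasDerivAt u u' t) (hv : HasDerivAt v v' t) :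
    HasDerivAt (fun t => u t ⬝ᵥ v t) (u' ⬝ᵥ v t + u t ⬝ᵥ v') t := by
  simp only [dotProduct, ← Finset.sum_add_distrib]
  exact HasDerivAt.fun_sum fun b _ => (hasDerivAt_pi.1 hu b).mul (hasDerivAt_pi.1 hv b)

theorem hasDerivAt_vecMul {r : ℕ} {u : ℝ → Fin r → ℂ} {u' : Fin r → ℂ} {t : ℝ}
    (hu : HasDerivAt u u' t) (M : Matrix (Fin r) (Fin r) ℂ) :
    HasDerivAt (fun t => u t ᵥ* M) (u' ᵥ* M) t := by
  refine hasDerivAt_pi.2 fun c => ?_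
  simpa [Matrix.vecMul] using hasDerivAt_dotProduct hu (hasDerivAt_const t fun b => M b c)

section Green

variable {m r : ℕ} {I : Set ℝ} {f : ℝ → EuclideanSpace ℝ (Fin m) → Fin r → ℂ}
  {S : Set (EuclideanSpace ℝ (Fin m))} (T : TestRow m r) (A : Matrix (Fin r) (Fin r) ℂ)

theorem TestRow.integral_dotProduct_laplacian (hS : IsCompact S) {ξ : ℝ}
    (h0 : ∀ η ∉ S, T.VanishesAt ξ η) {g : EuclideanSpace ℝ (Fin m) → Fin r → ℂ}
    (hg : ContDiff ℝ 2 g) :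
    Integrable (fun η => T.P ξ η ⬝ᵥ Laplacian.laplacian g η) ∧
      Integrable (fun η => (∑ i, T.Q' i ξ η) ⬝ᵥ g η) ∧
      ∫ η, T.P ξ η ⬝ᵥ Laplacian.laplacian g η = ∫ η, (∑ i, T.Q' i ξ η) ⬝ᵥ g η := by
  have hgb : ∀ b, ContDiff ℝ 2 fun η => g η b := fun b => contDiff_pi.1 hg b
  have hΔ : ∀ b, Continuous (Laplacian.laplacian fun η => g η b) := by
    intro b
    rw [funext (laplacian_eq_sum_fderiv (hgb b))]
    exact continuous_finsetSum _ fun i _ =>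
      (((hgb b).fderiv_right (m := 1) (by norm_num)).clm_apply
        contDiff_const).continuous_fderiv (by norm_num) |>.clm_apply continuous_const
  have hsec : ∀ {p : ℝ → EuclideanSpace ℝ (Fin m) → ℂ}, Continuous (Function.uncurry p) →
      Continuous (p ξ) := fun hp => hp.comp (Continuous.prodMk_right ξ)
  have e1 : ∀ η, T.P ξ η ⬝ᵥ Laplacian.laplacian g η =
      ∑ b, T.P ξ η b * Laplacian.laplacian (fun η => g η b) η := fun η => by
    simp only [dotProduct, laplacian_apply hg]
  have e2 : ∀ η, (∑ i, T.Q' i ξ η) ⬝ᵥ g η = ∑ b, (∑ i, T.Q' i ξ η b) * g η b := fun η => by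
    simp only [dotProduct, Finset.sum_apply]
  have i1 : ∀ b, Integrable fun η => T.P ξ η b * Laplacian.laplacian (fun η => g η b) η := fun b =>
    ((hsec (T.partials b).cont).mul (hΔ b)).integrable_of_hasCompactSupport
      (HasCompactSupport.intro hS fun η hη => by simp [(h0 η hη).1])
  have i2 : ∀ b, Integrable fun η => (∑ i, T.Q' i ξ η b) * g η b := fun b =>
    ((continuous_finsetSum _ fun i _ => hsec ((T.partials b).contq' i)).mul
      (hgb b).continuous).integrable_of_hasCompactSupport
      (HasCompactSupport.intro hS fun η hη => by simp [fun i => ((h0 η hη).2.2.2 i).2])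
  simp only [e1, e2]
  refine ⟨integrable_finsetSum _ fun b _ => i1 b, integrable_finsetSum _ fun b _ => i2 b, ?_⟩
  rw [integral_finsetSum _ fun b _ => i1 b, integral_finsetSum _ fun b _ => i2 b]
  refine Finset.sum_congr rfl fun b _ => ?_
  exact LayeredFourier.integral_mul_laplacian hS (p := fun η => T.P ξ η b)
    (q := fun i η => T.Q i ξ η b) (q' := fun i η => T.Q' i ξ η b)
    (hsec (T.partials b).cont) (fun i => hsec ((T.partials b).contq i))
    (fun i => hsec ((T.partials b).contq' i)) (fun η hη => by simp [(h0 η hη).1])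
    (fun i η hη => by simp [((h0 η hη).2.2.2 i).1]) (fun i η hη => by simp [((h0 η hη).2.2.2 i).2])
    (fun i η => (T.partials b).derivq i ξ η) (fun i η => (T.partials b).derivq' i ξ η) (hgb b)

/-- The integrand in Green's identity. -/
def TestRow.defect (f : ℝ → EuclideanSpace ℝ (Fin m) → Fin r → ℂ) (ξ : ℝ)
    (η : EuclideanSpace ℝ (Fin m)) : ℂ :=
  T.P ξ η ⬝ᵥ (A ^ 2 *ᵥ dx (dx f) ξ η + Laplacian.laplacian (f ξ) η) - T.adj A ξ η ⬝ᵥ f ξ η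

/-- In the derivative of the flux the terms with one derivative on each factor cancel. What remains
is the `ξ` part of the defect, and the `η` part integrates to zero over a slice. -/
theorem TestRow.hasDerivAt_integral_flux (hI : IsOpen I)
    (hf : ContDiffOn ℝ 2 (fun p : ℝ × EuclideanSpace ℝ (Fin m) => f p.1 p.2) (I ×ˢ Set.univ))
    (hS : IsCompact S) (h0 : ∀ ξ, ∀ η ∉ S, T.VanishesAt ξ η) {ξ : ℝ} (hξ : ξ ∈ I) :
    HasDerivAt (fun t => ∫ η, T.flux A t η (f t η) (dx f t η)) (∫ η, T.defect A f ξ η) ξ := by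
  have hf1 := contDiffOn_dx hI hf
  have hf2 := continuousOn_dx_dx hI hf
  have hPA := (T.continuous_P.matrix_vecMul (continuous_const (y := A ^ 2))).continuousOn
    (s := I ×ˢ (Set.univ : Set (EuclideanSpace ℝ (Fin m))))
  have hP1A := (T.continuous_P₁.matrix_vecMul (continuous_const (y := A ^ 2))).continuousOn
    (s := I ×ˢ (Set.univ : Set (EuclideanSpace ℝ (Fin m))))
  have hP2A := (T.continuous_P₂.matrix_vecMul (continuous_const (y := A ^ 2))).continuousOn
    (s := I ×ˢ (Set.univ : Set (EuclideanSpace ℝ (Fin m))))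
  have hF' : ContinuousOn (Function.uncurry fun ξ η => (T.P ξ η ᵥ* A ^ 2) ⬝ᵥ dx (dx f) ξ η -
      (T.P₂ ξ η ᵥ* A ^ 2) ⬝ᵥ f ξ η) (I ×ˢ Set.univ) :=
    (continuousOn_dotProduct hPA hf2).sub (continuousOn_dotProduct hP2A hf.continuousOn)
  have h0' : ∀ ξ, ∀ η ∉ S, (T.P ξ η ᵥ* A ^ 2) ⬝ᵥ dx (dx f) ξ η -
      (T.P₂ ξ η ᵥ* A ^ 2) ⬝ᵥ f ξ η = 0 := fun ξ η hη => by
    simp [(h0 ξ η hη).1, (h0 ξ η hη).2.2.1]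
  have h := hasDerivAt_integral_of_compact hS hI
    (F := fun t η => T.flux A t η (f t η) (dx f t η))
    (F' := fun ξ η => (T.P ξ η ᵥ* A ^ 2) ⬝ᵥ dx (dx f) ξ η - (T.P₂ ξ η ᵥ* A ^ 2) ⬝ᵥ f ξ η)
    ((continuousOn_dotProduct hPA hf1.continuousOn).sub
      (continuousOn_dotProduct hP1A hf.continuousOn)) hF'
    (fun ξ η hη => T.flux_eq_zero A (h0 ξ η hη) _ _) h0'
    (fun t ht η => by
      have d0 : HasDerivAt (fun t => T.P t η) (T.P₁ t η) t :=
        hasDerivAt_pi.2 fun b => (T.partials b).deriv₁ t η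
      have d1 : HasDerivAt (fun t => T.P₁ t η) (T.P₂ t η) t :=
        hasDerivAt_pi.2 fun b => (T.partials b).deriv₂ t η
      have e0 := (hasDerivAt_dx hI (hf.of_le (by norm_num)) ht η).1
      have e1 := (hasDerivAt_dx hI hf1 ht η).1
      refine ((hasDerivAt_dotProduct (hasDerivAt_vecMul d0 (A ^ 2)) e1).sub
        (hasDerivAt_dotProduct (hasDerivAt_vecMul d1 (A ^ 2)) e0)).congr_deriv ?_
      ring) hξ
  refine h.congr_deriv ?_
  obtain ⟨i1, i2, e⟩ := T.integral_dotProduct_laplacian hS (h0 ξ) (contDiff_section hf hξ)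
  have i0 : Integrable fun η => (T.P ξ η ᵥ* A ^ 2) ⬝ᵥ dx (dx f) ξ η -
      (T.P₂ ξ η ᵥ* A ^ 2) ⬝ᵥ f ξ η :=
    (hF'.comp_continuous (Continuous.prodMk_right ξ)
      fun η => ⟨hξ, trivial⟩).integrable_of_hasCompactSupport (HasCompactSupport.intro hS (h0' ξ))
  have e3 : ∀ η, T.defect A f ξ η = ((T.P ξ η ᵥ* A ^ 2) ⬝ᵥ dx (dx f) ξ η -
      (T.P₂ ξ η ᵥ* A ^ 2) ⬝ᵥ f ξ η) + (T.P ξ η ⬝ᵥ Laplacian.laplacian (f ξ) η -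
      (∑ i, T.Q' i ξ η) ⬝ᵥ f ξ η) := by
    intro η
    rw [TestRow.defect, TestRow.adj, dotProduct_add, add_dotProduct, Matrix.dotProduct_mulVec]
    ring
  simp only [e3]
  refine ((integral_add i0 (i1.sub i2)).trans ?_).symm
  rw [integral_sub' i1 i2, e, sub_self, add_zero]

/-- Green's identity on the slab `I × ℝᵐ`; `u` and `v` extend `f` and `∂f/∂x` to the boundary. -/
theorem TestRow.integral_defect (hI : IsOpen I)
    (hf : ContDiffOn ℝ 2 (fun p : ℝ × EuclideanSpace ℝ (Fin m) => f p.1 p.2) (I ×ˢ Set.univ))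
    (hS : IsCompact S) (h0 : ∀ ξ, ∀ η ∉ S, T.VanishesAt ξ η)
    {a b : ℝ} (hab : a ≤ b) (hsub : Set.Ioo a b ⊆ I)
    (hI0 : ∀ ξ ∈ I, ξ ∉ Set.Ioo a b → ∀ η, T.VanishesAt ξ η)
    {u v : ℝ → EuclideanSpace ℝ (Fin m) → Fin r → ℂ}
    (hu : ContinuousOn (Function.uncurry u) (Set.Icc a b ×ˢ Set.univ))
    (hv : ContinuousOn (Function.uncurry v) (Set.Icc a b ×ˢ Set.univ))
    (huf : ∀ ξ ∈ Set.Ioo a b, ∀ η, u ξ η = f ξ η) (hvf : ∀ ξ ∈ Set.Ioo a b, ∀ η, v ξ η = dx f ξ η)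
    (hint : IntegrableOn (Function.uncurry (T.defect A f)) (I ×ˢ Set.univ)) :
    ∫ p in I ×ˢ Set.univ, T.defect A f p.1 p.2 =
      (∫ η, T.flux A b η (u b η) (v b η)) - ∫ η, T.flux A a η (u a η) (v a η) := by
  have hPA := (T.continuous_P.matrix_vecMul (continuous_const (y := A ^ 2))).continuousOn
    (s := Set.Icc a b ×ˢ (Set.univ : Set (EuclideanSpace ℝ (Fin m))))
  have hP1A := (T.continuous_P₁.matrix_vecMul (continuous_const (y := A ^ 2))).continuousOn
    (s := Set.Icc a b ×ˢ (Set.univ : Set (EuclideanSpace ℝ (Fin m))))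
  have hcont : ContinuousOn (fun t => ∫ η, T.flux A t η (u t η) (v t η)) (Set.Icc a b) :=
    continuousOn_integral_of_compact_support hS
      ((continuousOn_dotProduct hPA hv).sub (continuousOn_dotProduct hP1A hu))
      fun t η _ hη => T.flux_eq_zero A (h0 t η hη) _ _
  have hder : ∀ ξ ∈ Set.Ioo a b, HasDerivAt (fun t => ∫ η, T.flux A t η (u t η) (v t η))
      (∫ η, T.defect A f ξ η) ξ := by
    intro ξ hξ
    refine (T.hasDerivAt_integral_flux A hI hf hS h0 (hsub hξ)).congr_of_eventuallyEq ?_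
    filter_upwards [isOpen_Ioo.mem_nhds hξ] with t ht
    simp only [huf t ht, hvf t ht]
  have hprod : (volume : Measure (ℝ × EuclideanSpace ℝ (Fin m))).restrict (I ×ˢ Set.univ) =
      (volume.restrict I).prod volume := by
    rw [Measure.volume_eq_prod, ← Measure.prod_restrict, Measure.restrict_univ]
  have hint' : IntegrableOn (fun ξ => ∫ η, T.defect A f ξ η) I := by
    rw [IntegrableOn, hprod] at hint
    exact hint.integral_prod_left
  have hFTC := intervalIntegral.integral_eq_sub_of_hasDerivAt_of_le hab hcont hder
    ((intervalIntegrable_iff_integrableOn_Ioo_of_le hab).2 (hint'.mono_set hsub))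
  rw [← hFTC, intervalIntegral.integral_of_le hab, integral_Ioc_eq_integral_Ioo]
  rw [hprod, integral_prod _ (by rwa [IntegrableOn, hprod] at hint)]
  -- The layer may be unbounded, but the test row vanishes on its part outside `(a, b)`.
  refine setIntegral_eq_of_subset_of_forall_sdiff_eq_zero hI.measurableSet hsub fun ξ hξ => ?_
  refine integral_eq_zero_of_ae (Eventually.of_forall fun η => ?_)
  have h := hI0 ξ hξ.1 hξ.2 η
  simp [TestRow.defect, T.adj_eq_zero A h, h.1]

end Green

/-! ### Geometry of the layers -/

section Layers

variable {n r : ℕ} (D : Medium n r) (N : ℝ)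

theorem Medium.isOpen_layer (k : Fin (n + 1)) : IsOpen (D.layer k) := by
  have h : D.layer k = (⋂ i : Fin n, {x | i.castSucc < k → D.l i < x}) ∩
      ⋂ i : Fin n, {x | k ≤ i.castSucc → x < D.l i} := by
    ext x
    simp [Medium.layer]
  rw [h]
  refine (isOpen_iInter_of_finite fun i => ?_).inter (isOpen_iInter_of_finite fun i => ?_)
  · by_cases hi : i.castSucc < k
    · simp only [hi, forall_const]
      exact isOpen_Ioi
    · simp [hi]
  · by_cases hi : k ≤ i.castSucc
    · simp only [hi, forall_const]
      exact isOpen_Iio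
    · simp [hi]

/-- The left end point of the layer `j`, truncated at `-N`. -/
def Medium.lo : Fin (n + 1) → ℝ := Fin.cons (-N) D.l

/-- The right end point of the layer `j`, truncated at `N`. -/
def Medium.hi : Fin (n + 1) → ℝ := Fin.snoc (α := fun _ => ℝ) D.l N

@[simp] theorem Medium.lo_zero : D.lo N 0 = -N := rfl

@[simp] theorem Medium.lo_succ (i : Fin n) : D.lo N i.succ = D.l i := rfl

@[simp] theorem Medium.hi_last : D.hi N (Fin.last n) = N := by simp [Medium.hi]

@[simp] theorem Medium.hi_castSucc (i : Fin n) : D.hi N i.castSucc = D.l i := by simp [Medium.hi]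

variable {N}

theorem Medium.mem_layer_of_lo_lt_of_lt_hi {j : Fin (n + 1)} {x : ℝ} (h1 : D.lo N j < x)
    (h2 : x < D.hi N j) : x ∈ D.layer j := by
  refine ⟨fun i hi => lt_of_le_of_lt ?_ h1, fun i hi => lt_of_lt_of_le h2 ?_⟩
  · cases j using Fin.cases with
    | zero => simp at hi
    | succ i' => exact D.strictMono_l.monotone (Fin.castSucc_lt_succ_iff.1 hi)
  · cases j using Fin.lastCases with
    | last => exact absurd hi (not_le.2 (Fin.castSucc_lt_last i))
    | cast i' =>
      rw [D.hi_castSucc]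
      exact D.strictMono_l.monotone (Fin.castSucc_le_castSucc_iff.1 hi)

theorem Medium.lo_lt_of_mem_layer {j : Fin (n + 1)} {x : ℝ} (hx : x ∈ D.layer j) (h : -N < x) :
    D.lo N j < x := by
  cases j using Fin.cases with
  | zero => exact h
  | succ i => exact hx.1 i Fin.castSucc_lt_succ

theorem Medium.lt_hi_of_mem_layer {j : Fin (n + 1)} {x : ℝ} (hx : x ∈ D.layer j) (h : x < N) :
    x < D.hi N j := by
  cases j using Fin.lastCases with
  | last => simpa using h
  | cast i => simpa using hx.2 i le_rfl

variable (hN : ∀ i, |D.l i| < N) (hN0 : 0 < N)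
include hN hN0

theorem Medium.lo_lt_hi (j : Fin (n + 1)) : D.lo N j < D.hi N j := by
  cases j using Fin.cases with
  | zero =>
    -- Without interfaces, layer `0` is also the last one, so the right end point needs its own case
    -- distinction.
    generalize hk : (0 : Fin (n + 1)) = k
    cases k using Fin.lastCases with
    | last => rw [← hk, D.lo_zero, hk, D.hi_last]; linarith
    | cast i =>
      rw [← hk, D.lo_zero, hk, D.hi_castSucc]
      exact (abs_lt.1 (hN i)).1
  | succ i =>
    rw [D.lo_succ]
    generalize hk : i.succ = k
    cases k using Fin.lastCases with
    | last => rw [D.hi_last]; exact (abs_lt.1 (hN i)).2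
    | cast i' =>
      rw [D.hi_castSucc]
      exact D.strictMono_l (Fin.castSucc_lt_castSucc_iff.1 (hk ▸ Fin.castSucc_lt_succ))

/-- The artificial ends `-N` and `N` lie inside the unbounded layers, so limits have to be supplied
only at true interfaces. -/
theorem Medium.mem_Icc_cases {j : Fin (n + 1)} {x : ℝ} (hx : x ∈ Set.Icc (D.lo N j) (D.hi N j)) :
    x ∈ D.layer j ∨ (∃ i : Fin n, j = i.castSucc ∧ x = D.l i) ∨
      ∃ i : Fin n, j = i.succ ∧ x = D.l i := by
  have hlt := D.lo_lt_hi hN hN0 j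
  rcases eq_or_lt_of_le hx.1 with h1 | h1
  · cases j using Fin.cases with
    | zero =>
      left
      refine ⟨fun i hi => absurd hi (by simp), fun i _ => ?_⟩
      rw [← h1, D.lo_zero]
      exact (abs_lt.1 (hN i)).1
    | succ i => exact Or.inr (Or.inr ⟨i, rfl, h1.symm⟩)
  · rcases eq_or_lt_of_le hx.2 with h2 | h2
    · cases j using Fin.lastCases with
      | last =>
        left
        refine ⟨fun i _ => ?_, fun i hi => absurd hi (not_le.2 (Fin.castSucc_lt_last i))⟩
        rw [h2, D.hi_last]
        exact (abs_lt.1 (hN i)).2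
      | cast i => exact Or.inr (Or.inl ⟨i, rfl, by rw [h2, D.hi_castSucc]⟩)
    · exact Or.inl (D.mem_layer_of_lo_lt_of_lt_hi h1 h2)

theorem Medium.Icc_prod_subset_closure_slab (m : ℕ) (j : Fin (n + 1)) :
    Set.Icc (D.lo N j) (D.hi N j) ×ˢ Set.univ ⊆ closure (D.slab m j) := by
  rw [Medium.slab, closure_prod_eq, closure_univ, ← closure_Ioo (D.lo_lt_hi hN hN0 j).ne]
  exact Set.prod_mono (closure_mono fun x hx => D.mem_layer_of_lo_lt_of_lt_hi hx.1 hx.2) le_rfl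

end Layers

/-! ### Green's identity on the layered medium -/

section Global

variable {n r m : ℕ} {D : Medium n r}
  {f : Fin (n + 1) → ℝ → EuclideanSpace ℝ (Fin m) → Fin r → ℂ}

/-- The coupling conditions of the dual problem for a family of test functions. -/
def DualCoupling (D : Medium n r) (T : Fin (n + 1) → TestRow m r) : Prop :=
  ∀ i η, Sum.elim ((T i.castSucc).P (D.l i) η ᵥ* D.A i.castSucc ^ 2)
      (-((T i.castSucc).P₁ (D.l i) η ᵥ* D.A i.castSucc ^ 2)) ᵥ* (D.M₁ i)⁻¹ =
    Sum.elim ((T i.succ).P (D.l i) η ᵥ* D.A i.succ ^ 2)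
      (-((T i.succ).P₁ (D.l i) η ᵥ* D.A i.succ ^ 2)) ᵥ* (D.M₂ i)⁻¹

/-- Inserting `M⁻¹ M` splits the flux into the factor governed by the dual coupling and the one
governed by the direct coupling. The order `(v, u)` follows the columns of `M`: first `α`, then `β`.
-/
theorem TestRow.flux_eq_of_isUnit (T : TestRow m r) (A : Matrix (Fin r) (Fin r) ℂ)
    {M : Matrix (Fin r ⊕ Fin r) (Fin r ⊕ Fin r) ℂ} (hM : IsUnit M.det) (ξ : ℝ)
    (η : EuclideanSpace ℝ (Fin m)) (u v : Fin r → ℂ) :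
    T.flux A ξ η u v = (Sum.elim (T.P ξ η ᵥ* A ^ 2) (-(T.P₁ ξ η ᵥ* A ^ 2)) ᵥ* M⁻¹) ⬝ᵥ
      (M *ᵥ Sum.elim v u) := by
  rw [Matrix.dotProduct_mulVec, Matrix.vecMul_vecMul, Matrix.nonsing_inv_mul _ hM,
    Matrix.vecMul_one, sumElim_dotProduct_sumElim, neg_dotProduct, ← sub_eq_add_neg, TestRow.flux]

theorem flux_eq_flux {T : Fin (n + 1) → TestRow m r} (hT : DualCoupling D T) (i : Fin n)
    (η : EuclideanSpace ℝ (Fin m)) {u₁ v₁ u₂ v₂ : Fin r → ℂ}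
    (h : ∀ q : Fin 2, D.α₁ i q *ᵥ v₁ + D.β₁ i q *ᵥ u₁ = D.α₂ i q *ᵥ v₂ + D.β₂ i q *ᵥ u₂) :
    (T i.castSucc).flux (D.A i.castSucc) (D.l i) η u₁ v₁ =
      (T i.succ).flux (D.A i.succ) (D.l i) η u₂ v₂ := by
  rw [TestRow.flux_eq_of_isUnit _ _ (isUnit_iff_ne_zero.2 (D.det₁_ne_zero i) : IsUnit (D.M₁ i).det),
    TestRow.flux_eq_of_isUnit _ _ (isUnit_iff_ne_zero.2 (D.det₂_ne_zero i) : IsUnit (D.M₂ i).det),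
    hT i η]
  congr 1
  rw [Medium.M₁, Medium.M₂, Matrix.fromBlocks_mulVec, Matrix.fromBlocks_mulVec]
  simp only [Sum.elim_comp_inl, Sum.elim_comp_inr, h]

/-- Because the limits at an interface are taken in all variables together, the extension is jointly
continuous on the closed strip. The slice integrals of the flux then remain continuous up to the end
points. -/
theorem continuousOn_extendFrom_slab {N : ℝ} (hN : ∀ i, |D.l i| < N) (hN0 : 0 < N)
    (j : Fin (n + 1)) {g : ℝ × EuclideanSpace ℝ (Fin m) → Fin r → ℂ}
    (hg : ContinuousOn g (D.slab m j))
    (hleft : ∀ i : Fin n, j = i.castSucc → ∀ y, ∃ u, Tendsto g (𝓝[D.slab m j] (D.l i, y)) (𝓝 u))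
    (hright : ∀ i : Fin n, j = i.succ → ∀ y, ∃ u, Tendsto g (𝓝[D.slab m j] (D.l i, y)) (𝓝 u)) :
    ContinuousOn (extendFrom (D.slab m j) g) (Set.Icc (D.lo N j) (D.hi N j) ×ˢ Set.univ) := by
  refine continuousOn_extendFrom (D.Icc_prod_subset_closure_slab hN hN0 m j) ?_
  rintro ⟨x, y⟩ ⟨hx, -⟩
  rcases D.mem_Icc_cases hN hN0 hx with h | ⟨i, rfl, rfl⟩ | ⟨i, rfl, rfl⟩
  · exact ⟨_, hg (x, y) ⟨h, trivial⟩⟩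
  · exact hleft i rfl y
  · exact hright i rfl y

theorem extendFrom_slab_eq {j : Fin (n + 1)} {g : ℝ × EuclideanSpace ℝ (Fin m) → Fin r → ℂ}
    (hg : ContinuousOn g (D.slab m j)) {p : ℝ × EuclideanSpace ℝ (Fin m)} (hp : p ∈ D.slab m j) :
    extendFrom (D.slab m j) g p = g p :=
  extendFrom_eq (subset_closure hp) (hg p hp)

theorem sum_integral_defect_eq_zero {T : Fin (n + 1) → TestRow m r} (hT : DualCoupling D T)
    (hf : ∀ k, ContDiffOn ℝ 2
      (fun p : ℝ × EuclideanSpace ℝ (Fin m) => f k p.1 p.2) (D.slab m k))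
    (hcoup : SatisfiesCoupling D f) {S : Set (EuclideanSpace ℝ (Fin m))} (hS : IsCompact S)
    (h0 : ∀ j ξ, ∀ η ∉ S, (T j).VanishesAt ξ η) {N : ℝ} (hN : ∀ i, |D.l i| < N) (hN0 : 0 < N)
    (hN' : ∀ j ξ η, N ≤ |ξ| → (T j).VanishesAt ξ η)
    (hint : ∀ j, IntegrableOn (Function.uncurry ((T j).defect (D.A j) (f j))) (D.slab m j)) :
    ∑ j, ∫ p in D.slab m j, (T j).defect (D.A j) (f j) p.1 p.2 = 0 := by
  set u : Fin (n + 1) → ℝ → EuclideanSpace ℝ (Fin m) → Fin r → ℂ := fun j ξ η =>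
    extendFrom (D.slab m j) (fun p => f j p.1 p.2) (ξ, η) with hu
  set v : Fin (n + 1) → ℝ → EuclideanSpace ℝ (Fin m) → Fin r → ℂ := fun j ξ η =>
    extendFrom (D.slab m j) (fun p => dx (f j) p.1 p.2) (ξ, η) with hv
  have hdx : ∀ j, ContinuousOn (fun p : ℝ × EuclideanSpace ℝ (Fin m) => dx (f j) p.1 p.2)
      (D.slab m j) := fun j => (contDiffOn_dx (D.isOpen_layer j) (hf j)).continuousOn
  have hsub : ∀ j, Set.Ioo (D.lo N j) (D.hi N j) ⊆ D.layer j := fun j x hx =>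
    D.mem_layer_of_lo_lt_of_lt_hi hx.1 hx.2
  have key : ∀ j, ∫ p in D.slab m j, (T j).defect (D.A j) (f j) p.1 p.2 =
      (∫ η, (T j).flux (D.A j) (D.hi N j) η (u j (D.hi N j) η) (v j (D.hi N j) η)) -
      ∫ η, (T j).flux (D.A j) (D.lo N j) η (u j (D.lo N j) η) (v j (D.lo N j) η) := by
    intro j
    refine (T j).integral_defect (D.A j) (D.isOpen_layer j) (hf j) hS (h0 j)
      (D.lo_lt_hi hN hN0 j).le (hsub j) (fun ξ hξ hξ' η => hN' j ξ η ?_) ?_ ?_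
      (fun ξ hξ η => extendFrom_slab_eq (hf j).continuousOn ⟨hsub j hξ, trivial⟩)
      (fun ξ hξ η => extendFrom_slab_eq (hdx j) ⟨hsub j hξ, trivial⟩) (hint j)
    · by_contra! h
      exact hξ' ⟨D.lo_lt_of_mem_layer hξ (abs_lt.1 h).1, D.lt_hi_of_mem_layer hξ (abs_lt.1 h).2⟩
    · refine continuousOn_extendFrom_slab hN hN0 j (hf j).continuousOn ?_ ?_
      · rintro i rfl y
        obtain ⟨u₁, v₁, u₂, v₂, h1, h2, h3, h4, -⟩ := hcoup i y
        exact ⟨u₁, h1⟩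
      · rintro i rfl y
        obtain ⟨u₁, v₁, u₂, v₂, h1, h2, h3, h4, -⟩ := hcoup i y
        exact ⟨u₂, h3⟩
    · refine continuousOn_extendFrom_slab hN hN0 j (hdx j) ?_ ?_
      · rintro i rfl y
        obtain ⟨u₁, v₁, u₂, v₂, h1, h2, h3, h4, -⟩ := hcoup i y
        exact ⟨v₁, h2⟩
      · rintro i rfl y
        obtain ⟨u₁, v₁, u₂, v₂, h1, h2, h3, h4, -⟩ := hcoup i y
        exact ⟨v₂, h4⟩
  simp only [key]
  -- The last right end and the first left end are split off, where the test rows vanish. The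
  -- remaining ends pair up at each `l i`.
  rw [Finset.sum_sub_distrib, Fin.sum_univ_castSucc, Fin.sum_univ_succ
    (f := fun j => ∫ η, (T j).flux (D.A j) (D.lo N j) η (u j (D.lo N j) η) (v j (D.lo N j) η))]
  have e1 : ∀ η, (T (Fin.last n)).flux (D.A (Fin.last n)) (D.hi N (Fin.last n)) η
      (u (Fin.last n) (D.hi N (Fin.last n)) η) (v (Fin.last n) (D.hi N (Fin.last n)) η) = 0 :=
    fun η => TestRow.flux_eq_zero _ _ (hN' _ _ _ (by rw [D.hi_last, abs_of_pos hN0])) _ _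
  have e2 : ∀ η, (T 0).flux (D.A 0) (D.lo N 0) η (u 0 (D.lo N 0) η) (v 0 (D.lo N 0) η) = 0 :=
    fun η => TestRow.flux_eq_zero _ _ (hN' _ _ _ (by rw [D.lo_zero, abs_neg, abs_of_pos hN0])) _ _
  simp only [e1, e2, integral_zero, add_zero, zero_add]
  refine sub_eq_zero.2 (Finset.sum_congr rfl fun i _ => integral_congr_ae (Eventually.of_forall ?_))
  intro η
  obtain ⟨u₁, v₁, u₂, v₂, h1, h2, h3, h4, h5⟩ := hcoup i η
  have c1 : (D.l i, η) ∈ closure (D.slab m i.castSucc) :=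
    D.Icc_prod_subset_closure_slab hN hN0 m _
      ⟨by rw [← D.hi_castSucc N i]; exact Set.right_mem_Icc.2 (D.lo_lt_hi hN hN0 _).le, trivial⟩
  have c2 : (D.l i, η) ∈ closure (D.slab m i.succ) :=
    D.Icc_prod_subset_closure_slab hN hN0 m _
      ⟨by rw [← D.lo_succ N i]; exact Set.left_mem_Icc.2 (D.lo_lt_hi hN hN0 _).le, trivial⟩
  simp only [D.hi_castSucc, D.lo_succ, hu, hv, extendFrom_eq c1 h1, extendFrom_eq c1 h2,
    extendFrom_eq c2 h3, extendFrom_eq c2 h4]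
  exact flux_eq_flux hT i η h5

end Global

/-! ### Cutoff functions -/

section Cutoff

variable {m : ℕ}

theorem HasPartials.mul {χ χ₁ χ₂ p p₁ p₂ : ℝ → EuclideanSpace ℝ (Fin m) → ℂ}
    {ζ ζ' q q' : Fin m → ℝ → EuclideanSpace ℝ (Fin m) → ℂ} (hχ : HasPartials χ χ₁ χ₂ ζ ζ')
    (hp : HasPartials p p₁ p₂ q q') :
    HasPartials (fun ξ η => χ ξ η * p ξ η) (fun ξ η => χ₁ ξ η * p ξ η + χ ξ η * p₁ ξ η)
      (fun ξ η => χ₂ ξ η * p ξ η + 2 * (χ₁ ξ η * p₁ ξ η) + χ ξ η * p₂ ξ η)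
      (fun i ξ η => ζ i ξ η * p ξ η + χ ξ η * q i ξ η)
      (fun i ξ η => ζ' i ξ η * p ξ η + 2 * (ζ i ξ η * q i ξ η) + χ ξ η * q' i ξ η) where
  cont := hχ.cont.mul hp.cont
  cont₁ := (hχ.cont₁.mul hp.cont).add (hχ.cont.mul hp.cont₁)
  cont₂ := ((hχ.cont₂.mul hp.cont).add (continuous_const.mul (hχ.cont₁.mul hp.cont₁))).add
    (hχ.cont.mul hp.cont₂)
  contq i := ((hχ.contq i).mul hp.cont).add (hχ.cont.mul (hp.contq i))
  contq' i := (((hχ.contq' i).mul hp.cont).add (continuous_const.mul ((hχ.contq i).mul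
    (hp.contq i)))).add (hχ.cont.mul (hp.contq' i))
  deriv₁ ξ η := (hχ.deriv₁ ξ η).mul (hp.deriv₁ ξ η)
  deriv₂ ξ η := (((hχ.deriv₂ ξ η).mul (hp.deriv₁ ξ η)).add
    ((hχ.deriv₁ ξ η).mul (hp.deriv₂ ξ η))).congr_deriv (by ring)
  derivq i ξ η := by
    have h1 := hχ.derivq i ξ η
    have h2 := hp.derivq i ξ η
    rw [HasLineDerivAt] at *
    simpa only [zero_smul, add_zero] using h1.fun_mul h2
  derivq' i ξ η := by
    have h1 := hχ.derivq i ξ η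
    have h2 := hp.derivq i ξ η
    have h1' := hχ.derivq' i ξ η
    have h2' := hp.derivq' i ξ η
    rw [HasLineDerivAt] at *
    have := (h1'.fun_mul h2).fun_add (h1.fun_mul h2')
    simp only [zero_smul, add_zero] at this
    refine this.congr_deriv ?_
    ring

theorem hasPartials_prod {α α₁ α₂ : ℝ → ℝ} {β : EuclideanSpace ℝ (Fin m) → ℝ}
    {γ γ' : Fin m → EuclideanSpace ℝ (Fin m) → ℝ} (c0 : Continuous α) (c1 : Continuous α₁)
    (c2 : Continuous α₂) (b0 : Continuous β) (b1 : ∀ i, Continuous (γ i))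
    (b2 : ∀ i, Continuous (γ' i)) (h1 : ∀ t, HasDerivAt α (α₁ t) t)
    (h2 : ∀ t, HasDerivAt α₁ (α₂ t) t)
    (h3 : ∀ i η, HasLineDerivAt ℝ β (γ i η) η (EuclideanSpace.single i 1))
    (h4 : ∀ i η, HasLineDerivAt ℝ (γ i) (γ' i η) η (EuclideanSpace.single i 1)) :
    HasPartials (fun ξ η => ((α ξ * β η : ℝ) : ℂ)) (fun ξ η => ((α₁ ξ * β η : ℝ) : ℂ))
      (fun ξ η => ((α₂ ξ * β η : ℝ) : ℂ)) (fun i ξ η => ((α ξ * γ i η : ℝ) : ℂ))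
      (fun i ξ η => ((α ξ * γ' i η : ℝ) : ℂ)) := by
  have hc : ∀ {a : ℝ → ℝ} {b : EuclideanSpace ℝ (Fin m) → ℝ}, Continuous a → Continuous b →
      Continuous (Function.uncurry fun ξ η => ((a ξ * b η : ℝ) : ℂ)) := fun ha hb =>
    Complex.continuous_ofReal.comp ((ha.comp continuous_fst).mul (hb.comp continuous_snd))
  exact
  { cont := hc c0 b0
    cont₁ := hc c1 b0
    cont₂ := hc c2 b0
    contq := fun i => hc c0 (b1 i)
    contq' := fun i => hc c0 (b2 i)
    deriv₁ := fun ξ η => ((h1 ξ).mul_const _).ofReal_comp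
    deriv₂ := fun ξ η => ((h2 ξ).mul_const _).ofReal_comp
    derivq := fun i ξ η => HasDerivAt.ofReal_comp (HasDerivAt.const_mul (α ξ) (h3 i η))
    derivq' := fun i ξ η => HasDerivAt.ofReal_comp (HasDerivAt.const_mul (α ξ) (h4 i η)) }

/-- A smooth bump function with its first two derivatives, rescaled. -/
theorem exists_bump_real : ∃ C, ∀ R : ℝ, 1 ≤ R → ∃ α α₁ α₂ : ℝ → ℝ,
    Continuous α ∧ Continuous α₁ ∧ Continuous α₂ ∧ (∀ t, HasDerivAt α (α₁ t) t) ∧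
    (∀ t, HasDerivAt α₁ (α₂ t) t) ∧ (∀ t, |t| ≤ R → α t = 1) ∧ (∀ t, |t| < R → α₁ t = 0) ∧
    (∀ t, 2 * R < |t| → α t = 0 ∧ α₁ t = 0 ∧ α₂ t = 0) ∧
    ∀ t, |α t| ≤ 1 ∧ |α₁ t| ≤ C / R ∧ |α₂ t| ≤ C / R := by
  let a : ContDiffBump (0 : ℝ) := ⟨1, 2, by norm_num, by norm_num⟩
  have ha : ContDiff ℝ 2 a := a.contDiff
  have ha1 : ContDiff ℝ 1 (deriv a) :=
    (contDiff_succ_iff_deriv (n := 1).1 (by simpa [one_add_one_eq_two] using ha)).2.2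
  have s1 : HasCompactSupport (deriv a) := a.hasCompactSupport.deriv
  have s2 : HasCompactSupport (deriv (deriv a)) := s1.deriv
  have ha2 : Continuous (deriv (deriv a)) := ha1.continuous_deriv le_rfl
  obtain ⟨C1, hC1⟩ := s1.exists_bound_of_continuous ha1.continuous
  obtain ⟨C2, hC2⟩ := s2.exists_bound_of_continuous ha2
  have d1 : ∀ t, HasDerivAt a (deriv a t) t := fun t =>
    (ha.differentiable (by norm_num) t).hasDerivAt
  have d2 : ∀ t, HasDerivAt (deriv a) (deriv (deriv a) t) t := fun t =>
    (ha1.differentiable (by norm_num) t).hasDerivAt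
  refine ⟨max C1 C2, fun R hR => ?_⟩
  have hR0 : 0 < R := by linarith
  have hlin : ∀ t : ℝ, HasDerivAt (fun t : ℝ => t / R) (1 / R) t := fun t =>
    (hasDerivAt_id t).div_const R
  have hscale : ∀ {g : ℝ → ℝ} {g' t : ℝ}, HasDerivAt g g' (t / R) →
      HasDerivAt (fun t => g (t / R)) (g' * (1 / R)) t := fun {g g' t} h =>
    HasDerivAt.comp (h := fun t : ℝ => t / R) t h (hlin t)
  have habs : ∀ t : ℝ, ‖t / R‖ = |t| / R := fun t => by
    rw [Real.norm_eq_abs, abs_div, abs_of_pos hR0]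
  have hout : ∀ t : ℝ, 2 * R < |t| → t / R ∉ tsupport a := fun t ht => by
    rw [a.tsupport_eq, mem_closedBall_zero_iff, habs, not_le, lt_div_iff₀ hR0]
    exact ht
  refine ⟨fun t => a (t / R), fun t => deriv a (t / R) * (1 / R),
    fun t => deriv (deriv a) (t / R) * (1 / R) * (1 / R),
    ha.continuous.comp (by fun_prop), (ha1.continuous.comp (by fun_prop)).mul continuous_const,
    ((ha2.comp (by fun_prop)).mul continuous_const).mul continuous_const,
    fun t => hscale (d1 (t / R)), fun t => (hscale (d2 (t / R))).mul_const _,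
    fun t ht => ?_, fun t ht => ?_, fun t ht => ⟨?_, ?_, ?_⟩, fun t => ⟨?_, ?_, ?_⟩⟩
  · refine a.one_of_mem_closedBall ?_
    rw [mem_closedBall_zero_iff, habs, div_le_iff₀ hR0]
    simpa [a] using ht
  · have hb : t / R ∈ Metric.ball (0 : ℝ) a.rIn := by
      rw [mem_ball_zero_iff, habs, div_lt_iff₀ hR0]
      simpa [a] using ht
    beta_reduce
    rw [(a.eventuallyEq_one_of_mem_ball hb).deriv_eq]
    simp
  · exact image_eq_zero_of_notMem_tsupport (hout t ht)
  · beta_reduce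
    rw [image_eq_zero_of_notMem_tsupport fun h => hout t ht (tsupport_deriv_subset h), zero_mul]
  · beta_reduce
    rw [image_eq_zero_of_notMem_tsupport fun h => hout t ht (tsupport_deriv_subset
      (tsupport_deriv_subset h)), zero_mul, zero_mul]
  · rw [abs_of_nonneg a.nonneg]
    exact a.le_one
  · rw [abs_mul, abs_of_pos (one_div_pos.2 hR0), mul_one_div]
    gcongr
    exact (hC1 _).trans (le_max_left _ _)
  · rw [abs_mul, abs_mul, abs_of_pos (one_div_pos.2 hR0)]
    -- The second derivative is in fact `O(1 / R²)`. It is weakened, using `1 ≤ R`, so that one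
    -- bound serves both derivatives.
    have h1 : 1 / R ≤ 1 := (div_le_one hR0).2 hR
    have h2 := (hC2 (t / R)).trans (le_max_right C1 C2)
    have h3 : 0 ≤ 1 / R := by positivity
    rw [Real.norm_eq_abs] at h2
    have h4 : 0 ≤ max C1 C2 := (abs_nonneg _).trans h2
    calc _ ≤ max C1 C2 * (1 / R) * 1 := by gcongr
      _ = _ := by ring

theorem exists_bump_euclidean (m : ℕ) : ∃ C, ∀ R : ℝ, 1 ≤ R →
    ∃ (β : EuclideanSpace ℝ (Fin m) → ℝ) (γ γ' : Fin m → EuclideanSpace ℝ (Fin m) → ℝ),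
    Continuous β ∧ (∀ i, Continuous (γ i)) ∧ (∀ i, Continuous (γ' i)) ∧
    (∀ i η, HasLineDerivAt ℝ β (γ i η) η (EuclideanSpace.single i 1)) ∧
    (∀ i η, HasLineDerivAt ℝ (γ i) (γ' i η) η (EuclideanSpace.single i 1)) ∧
    (∀ η, ‖η‖ ≤ R → β η = 1) ∧
    (∀ η, 2 * R < ‖η‖ → β η = 0 ∧ ∀ i, γ i η = 0 ∧ γ' i η = 0) ∧
    ∀ η, |β η| ≤ 1 ∧ ∀ i, |γ i η| ≤ C / R ∧ |γ' i η| ≤ C / R := by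
  let a : ContDiffBump (0 : EuclideanSpace ℝ (Fin m)) := ⟨1, 2, by norm_num, by norm_num⟩
  have ha : ContDiff ℝ 2 a := a.contDiff
  set g : Fin m → EuclideanSpace ℝ (Fin m) → ℝ := fun i η =>
    fderiv ℝ a η (EuclideanSpace.single i 1) with hg
  set g' : Fin m → EuclideanSpace ℝ (Fin m) → ℝ := fun i η =>
    fderiv ℝ (g i) η (EuclideanSpace.single i 1) with hg'
  have hg1 : ∀ i, ContDiff ℝ 1 (g i) := fun i =>
    (ha.fderiv_right (m := 1) (by norm_num)).clm_apply contDiff_const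
  have hg2 : ∀ i, Continuous (g' i) := fun i =>
    ((hg1 i).continuous_fderiv (by norm_num)).clm_apply continuous_const
  have t1 : ∀ i, tsupport (g i) ⊆ tsupport a := fun i =>
    tsupport_fderiv_apply_subset ℝ (EuclideanSpace.single i 1)
  have t2 : ∀ i, tsupport (g' i) ⊆ tsupport a := fun i =>
    (tsupport_fderiv_apply_subset ℝ (EuclideanSpace.single i 1)).trans (t1 i)
  have s1 : ∀ i, HasCompactSupport (g i) := fun i =>
    a.hasCompactSupport.isCompact.of_isClosed_subset (isClosed_tsupport _) (t1 i)
  have s2 : ∀ i, HasCompactSupport (g' i) := fun i =>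
    a.hasCompactSupport.isCompact.of_isClosed_subset (isClosed_tsupport _) (t2 i)
  choose C1 hC1 using fun i => (s1 i).exists_bound_of_continuous (hg1 i).continuous
  choose C2 hC2 using fun i => (s2 i).exists_bound_of_continuous (hg2 i)
  have n1 : ∀ i, 0 ≤ C1 i := fun i => (norm_nonneg _).trans (hC1 i 0)
  have n2 : ∀ i, 0 ≤ C2 i := fun i => (norm_nonneg _).trans (hC2 i 0)
  -- The sum dominates the bounds of both orders in every coordinate at once.
  set C := ∑ i, (C1 i + C2 i) with hC
  have hCi : ∀ i, C1 i + C2 i ≤ C := fun i =>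
    Finset.single_le_sum (f := fun i => C1 i + C2 i) (fun j _ => add_nonneg (n1 j) (n2 j))
      (Finset.mem_univ i)
  have d1 : ∀ i η, HasLineDerivAt ℝ a (g i η) η (EuclideanSpace.single i 1) := fun i η =>
    (ha.differentiable (by norm_num) η).hasFDerivAt.hasLineDerivAt _
  have d2 : ∀ i η, HasLineDerivAt ℝ (g i) (g' i η) η (EuclideanSpace.single i 1) := fun i η =>
    ((hg1 i).differentiable (by norm_num) η).hasFDerivAt.hasLineDerivAt _
  refine ⟨C, fun R hR => ?_⟩
  have hR0 : 0 < R := by linarith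
  have hscale : ∀ {h : EuclideanSpace ℝ (Fin m) → ℝ} {h' : ℝ} {η v : EuclideanSpace ℝ (Fin m)},
      HasLineDerivAt ℝ h h' (R⁻¹ • η) v →
      HasLineDerivAt ℝ (fun η => h (R⁻¹ • η)) (h' * R⁻¹) η v := by
    intro h h' η v hh
    rw [HasLineDerivAt] at *
    have hl : HasDerivAt (fun t : ℝ => t * R⁻¹) R⁻¹ 0 := by
      simpa using (hasDerivAt_id (0 : ℝ)).mul_const R⁻¹
    have := hh.comp_of_eq (h := fun t : ℝ => t * R⁻¹) (0 : ℝ) hl (by simp)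
    refine this.congr_of_eventuallyEq (Eventually.of_forall fun t => ?_)
    simp only [Function.comp_apply]
    rw [smul_add, smul_smul, mul_comm]
  have habs : ∀ η : EuclideanSpace ℝ (Fin m), ‖R⁻¹ • η‖ = ‖η‖ / R := fun η => by
    rw [norm_smul, norm_inv, Real.norm_eq_abs, abs_of_pos hR0, inv_mul_eq_div]
  have hout : ∀ η : EuclideanSpace ℝ (Fin m), 2 * R < ‖η‖ → R⁻¹ • η ∉ tsupport a := fun t ht => by
    rw [a.tsupport_eq, mem_closedBall_zero_iff, habs, not_le, lt_div_iff₀ hR0]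
    exact ht
  refine ⟨fun η => a (R⁻¹ • η), fun i η => g i (R⁻¹ • η) * R⁻¹, fun i η => g' i (R⁻¹ • η) * R⁻¹ * R⁻¹,
    ha.continuous.comp (by fun_prop),
    fun i => ((hg1 i).continuous.comp (by fun_prop)).mul continuous_const,
    fun i => (((hg2 i).comp (by fun_prop)).mul continuous_const).mul continuous_const,
    fun i η => hscale (d1 i _), fun i η => HasDerivAt.mul_const (hscale (d2 i _)) _,
    fun η hη => ?_, fun η hη => ⟨?_, fun i => ⟨?_, ?_⟩⟩, fun η => ⟨?_, fun i => ⟨?_, ?_⟩⟩⟩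
  · refine a.one_of_mem_closedBall ?_
    rw [mem_closedBall_zero_iff, habs, div_le_iff₀ hR0]
    simpa [a] using hη
  · exact image_eq_zero_of_notMem_tsupport (hout η hη)
  · beta_reduce
    rw [image_eq_zero_of_notMem_tsupport fun h => hout η hη (t1 i h), zero_mul]
  · beta_reduce
    rw [image_eq_zero_of_notMem_tsupport fun h => hout η hη (t2 i h), zero_mul, zero_mul]
  · rw [abs_of_nonneg a.nonneg]
    exact a.le_one
  · rw [abs_mul, abs_of_pos (inv_pos.2 hR0), ← div_eq_mul_inv]
    gcongr
    exact (hC1 i _).trans (by linarith [hCi i, n2 i])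
  · rw [abs_mul, abs_mul, abs_of_pos (inv_pos.2 hR0)]
    have h1 : R⁻¹ ≤ 1 := inv_le_one_of_one_le₀ hR
    have h2 : |g' i (R⁻¹ • η)| ≤ C := (hC2 i _).trans (by linarith [hCi i, n1 i])
    have h3 : 0 ≤ R⁻¹ := by positivity
    have h4 : 0 ≤ C := (abs_nonneg _).trans h2
    calc _ ≤ C * R⁻¹ * 1 := by gcongr
      _ = _ := by rw [mul_one, div_eq_mul_inv]

/-- Cutoff functions on `ℝ × ℝᵐ`, at scale `R`. -/
structure IsCutoff (C R : ℝ) (χ χ₁ χ₂ : ℝ → EuclideanSpace ℝ (Fin m) → ℂ)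
    (ζ ζ' : Fin m → ℝ → EuclideanSpace ℝ (Fin m) → ℂ) : Prop where
  partials : HasPartials χ χ₁ χ₂ ζ ζ'
  eq_one : ∀ ξ η, |ξ| ≤ R → ‖η‖ ≤ R → χ ξ η = 1
  eq_zero₁ : ∀ ξ η, |ξ| < R → χ₁ ξ η = 0
  eq_zero : ∀ ξ η, 2 * R < |ξ| ∨ 2 * R < ‖η‖ →
    χ ξ η = 0 ∧ χ₁ ξ η = 0 ∧ χ₂ ξ η = 0 ∧ ∀ i, ζ i ξ η = 0 ∧ ζ' i ξ η = 0
  norm_le : ∀ ξ η, ‖χ ξ η‖ ≤ 1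
  norm_le₁ : ∀ ξ η, ‖χ₁ ξ η‖ ≤ C / R
  norm_le₂ : ∀ ξ η, ‖χ₂ ξ η‖ ≤ C / R
  norm_leq : ∀ i ξ η, ‖ζ i ξ η‖ ≤ C / R
  norm_leq' : ∀ i ξ η, ‖ζ' i ξ η‖ ≤ C / R

/-- A product of a cutoff in `ξ` and one in `η`. The product form makes `χ₁` vanish for `|ξ| < R` at
every `η`, which preserves the coupling at interfaces with `|l i| < R`. -/
theorem exists_isCutoff (m : ℕ) : ∃ C, 0 ≤ C ∧ ∀ R : ℝ, 1 ≤ R →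
    ∃ (χ χ₁ χ₂ : ℝ → EuclideanSpace ℝ (Fin m) → ℂ)
      (ζ ζ' : Fin m → ℝ → EuclideanSpace ℝ (Fin m) → ℂ), IsCutoff C R χ χ₁ χ₂ ζ ζ' := by
  obtain ⟨C1, h1⟩ := exists_bump_real
  obtain ⟨C2, h2⟩ := exists_bump_euclidean m
  refine ⟨max (max C1 C2) 0, le_max_right _ _, fun R hR => ?_⟩
  obtain ⟨α, α₁, α₂, c0, c1, c2, d1, d2, e1, e2, e3, e4⟩ := h1 R hR
  obtain ⟨β, γ, γ', b0, b1, b2, d3, d4, e5, e6, e7⟩ := h2 R hR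
  have hR0 : 0 < R := by linarith
  have hC1 : C1 / R ≤ max (max C1 C2) 0 / R := by
    gcongr
    exact (le_max_left _ _).trans (le_max_left _ _)
  have hC2 : C2 / R ≤ max (max C1 C2) 0 / R := by
    gcongr
    exact (le_max_right _ _).trans (le_max_left _ _)
  have hmul1 : ∀ {x y K : ℝ}, |x| ≤ K → |y| ≤ 1 → ‖((x * y : ℝ) : ℂ)‖ ≤ K := by
    intro x y K hx hy
    rw [Complex.norm_real, Real.norm_eq_abs, abs_mul]
    exact (mul_le_of_le_one_right (abs_nonneg x) hy).trans hx
  have hmul2 : ∀ {x y K : ℝ}, |x| ≤ 1 → |y| ≤ K → ‖((x * y : ℝ) : ℂ)‖ ≤ K := by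
    intro x y K hx hy
    rw [mul_comm]
    exact hmul1 hy hx
  refine ⟨_, _, _, _, _, ⟨hasPartials_prod c0 c1 c2 b0 b1 b2 d1 d2 d3 d4, ?_, ?_, ?_, ?_, ?_, ?_, ?_,
    ?_⟩⟩
  · intro ξ η hξ hη
    rw [e1 ξ hξ, e5 η hη]
    simp
  · intro ξ η hξ
    rw [e2 ξ hξ]
    simp
  · rintro ξ η (h | h)
    · simp [e3 ξ h]
    · simp [e6 η h]
  · exact fun ξ η => hmul1 (e4 ξ).1 (e7 η).1
  · exact fun ξ η => hmul1 ((e4 ξ).2.1.trans hC1) (e7 η).1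
  · exact fun ξ η => hmul1 ((e4 ξ).2.2.trans hC1) (e7 η).1
  · exact fun i ξ η => hmul2 (e4 ξ).1 (((e7 η).2 i).1.trans hC2)
  · exact fun i ξ η => hmul2 (e4 ξ).1 (((e7 η).2 i).2.trans hC2)

end Cutoff

/-! ### Removing the cutoff -/

section Limit

variable {n m r : ℕ}

/-- Multiplication of a test function by a scalar function. -/
def TestRow.mul (T : TestRow m r) {χ χ₁ χ₂ : ℝ → EuclideanSpace ℝ (Fin m) → ℂ}
    {ζ ζ' : Fin m → ℝ → EuclideanSpace ℝ (Fin m) → ℂ} (hχ : HasPartials χ χ₁ χ₂ ζ ζ') :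
    TestRow m r where
  P ξ η := χ ξ η • T.P ξ η
  P₁ ξ η := χ₁ ξ η • T.P ξ η + χ ξ η • T.P₁ ξ η
  P₂ ξ η := χ₂ ξ η • T.P ξ η + (2 : ℂ) • (χ₁ ξ η • T.P₁ ξ η) + χ ξ η • T.P₂ ξ η
  Q i ξ η := ζ i ξ η • T.P ξ η + χ ξ η • T.Q i ξ η
  Q' i ξ η := ζ' i ξ η • T.P ξ η + (2 : ℂ) • (ζ i ξ η • T.Q i ξ η) + χ ξ η • T.Q' i ξ η
  partials b := hχ.mul (T.partials b)

theorem TestRow.mul_adj (T : TestRow m r) {χ χ₁ χ₂ : ℝ → EuclideanSpace ℝ (Fin m) → ℂ}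
    {ζ ζ' : Fin m → ℝ → EuclideanSpace ℝ (Fin m) → ℂ} (hχ : HasPartials χ χ₁ χ₂ ζ ζ')
    (A : Matrix (Fin r) (Fin r) ℂ) (ξ : ℝ) (η : EuclideanSpace ℝ (Fin m)) :
    (T.mul hχ).adj A ξ η = χ ξ η • T.adj A ξ η +
      ((χ₂ ξ η • T.P ξ η + (2 : ℂ) • (χ₁ ξ η • T.P₁ ξ η)) ᵥ* A ^ 2 +
        ∑ i, (ζ' i ξ η • T.P ξ η + (2 : ℂ) • (ζ i ξ η • T.Q i ξ η))) := by
  simp only [TestRow.adj, TestRow.mul, Matrix.add_vecMul, Matrix.smul_vecMul, smul_add,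
    Finset.sum_add_distrib, Finset.smul_sum]
  abel

/-- At most linear growth in the first variable. -/
structure TestRow.Growth (T : TestRow m r) (K : ℝ) : Prop where
  P : ∀ ξ η, ‖T.P ξ η‖ ≤ K * (1 + |ξ|)
  P₁ : ∀ ξ η, ‖T.P₁ ξ η‖ ≤ K * (1 + |ξ|)
  Q : ∀ i ξ η, ‖T.Q i ξ η‖ ≤ K * (1 + |ξ|)

theorem exists_norm_vecMul_le (M : Matrix (Fin r) (Fin r) ℂ) :
    ∃ B, 0 ≤ B ∧ ∀ v : Fin r → ℂ, ‖v ᵥ* M‖ ≤ B * ‖v‖ :=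
  let L := LinearMap.toContinuousLinearMap (M.vecMulLinear)
  ⟨‖L‖, norm_nonneg _, L.le_opNorm⟩

/-- The commutator of the cutoff with the operator is `O(1 / R)`. -/
theorem TestRow.exists_commutator_bound (T : TestRow m r) {K : ℝ} (hT : T.Growth K)
    (A : Matrix (Fin r) (Fin r) ℂ) {C : ℝ} (hC : 0 ≤ C) :
    ∃ B, 0 ≤ B ∧ ∀ {R : ℝ} {χ χ₁ χ₂ : ℝ → EuclideanSpace ℝ (Fin m) → ℂ}
      {ζ ζ' : Fin m → ℝ → EuclideanSpace ℝ (Fin m) → ℂ} (_ : 1 ≤ R)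
      (hχ : IsCutoff C R χ χ₁ χ₂ ζ ζ') (ξ : ℝ) (η : EuclideanSpace ℝ (Fin m)),
      ‖(T.mul hχ.partials).adj A ξ η - χ ξ η • T.adj A ξ η‖ ≤ B * (1 + |ξ|) / R ∧
      ‖(T.mul hχ.partials).adj A ξ η - χ ξ η • T.adj A ξ η‖ ≤ 3 * B := by
  obtain ⟨M, hM0, hM⟩ := exists_norm_vecMul_le (A ^ 2)
  have hK : 0 ≤ K := by
    have := (norm_nonneg _).trans (hT.P 0 0)
    simpa using this
  refine ⟨M * (3 * (C * K)) + m * (3 * (C * K)), by positivity, ?_⟩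
  intro R χ χ₁ χ₂ ζ ζ' hR hχ ξ η
  have hR0 : 0 < R := by linarith
  have hCR : 0 ≤ C / R := by positivity
  rw [T.mul_adj, add_sub_cancel_left]
  have two : ∀ (c d : ℂ) (u v : Fin r → ℂ), ‖c‖ ≤ C / R → ‖d‖ ≤ C / R → ‖u‖ ≤ K * (1 + |ξ|) →
      ‖v‖ ≤ K * (1 + |ξ|) → ‖c • u + (2 : ℂ) • (d • v)‖ ≤ 3 * (C * K) * ((1 + |ξ|) / R) := by
    intro c d u v hc hd hu hv
    have h1 : ‖c • u‖ ≤ C / R * (K * (1 + |ξ|)) := by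
      rw [norm_smul]
      gcongr
    have h2 : ‖d • v‖ ≤ C / R * (K * (1 + |ξ|)) := by
      rw [norm_smul]
      gcongr
    have h3 : ‖(2 : ℂ) • (d • v)‖ = 2 * ‖d • v‖ := by
      rw [norm_smul]
      norm_num
    calc _ ≤ ‖c • u‖ + ‖(2 : ℂ) • (d • v)‖ := norm_add_le _ _
      _ ≤ C / R * (K * (1 + |ξ|)) + 2 * (C / R * (K * (1 + |ξ|))) := by
        rw [h3]
        gcongr
      _ = _ := by ring
  have key : ‖(χ₂ ξ η • T.P ξ η + (2 : ℂ) • (χ₁ ξ η • T.P₁ ξ η)) ᵥ* A ^ 2 +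
        ∑ i, (ζ' i ξ η • T.P ξ η + (2 : ℂ) • (ζ i ξ η • T.Q i ξ η))‖ ≤
      (M * (3 * (C * K)) + m * (3 * (C * K))) * ((1 + |ξ|) / R) := by
    refine (norm_add_le _ _).trans ?_
    rw [add_mul, mul_assoc M, mul_assoc (m : ℝ)]
    refine add_le_add ((hM _).trans (mul_le_mul_of_nonneg_left ?_ hM0)) ?_
    · exact two _ _ _ _ (hχ.norm_le₂ ξ η) (hχ.norm_le₁ ξ η) (hT.P ξ η) (hT.P₁ ξ η)
    · refine (norm_sum_le _ _).trans ((Finset.sum_le_sum fun i _ =>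
        two _ _ _ _ (hχ.norm_leq' i ξ η) (hχ.norm_leq i ξ η) (hT.P ξ η) (hT.Q i ξ η)).trans ?_)
      simp
  refine ⟨by rwa [mul_div_assoc], ?_⟩
  -- Beyond `2R` the commutator vanishes. Elsewhere `1 + |ξ| ≤ 3R` since `1 ≤ R`, which gives the
  -- factor `3`.
  by_cases h : 2 * R < |ξ|
  · obtain ⟨-, z1, z2, z3⟩ := hχ.eq_zero ξ η (Or.inl h)
    simp only [z1, z2, z3, zero_smul, smul_zero, add_zero, Matrix.zero_vecMul, Finset.sum_const_zero,
      norm_zero]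
    positivity
  · refine key.trans ?_
    rw [mul_comm]
    refine mul_le_mul_of_nonneg_right ?_ (by positivity)
    rw [div_le_iff₀ hR0]
    linarith

theorem norm_dotProduct_le (u v : Fin r → ℂ) : ‖u ⬝ᵥ v‖ ≤ r * (‖u‖ * ‖v‖) := by
  refine (norm_sum_le _ _).trans ((Finset.sum_le_sum fun b _ => ?_).trans
    (b := ∑ _ : Fin r, ‖u‖ * ‖v‖) ?_)
  · rw [norm_mul]
    exact mul_le_mul (norm_le_pi_norm u b) (norm_le_pi_norm v b) (norm_nonneg _) (norm_nonneg _)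
  · simp

theorem aestronglyMeasurable_dotProduct {X : Type*} [MeasurableSpace X] {μ : Measure X}
    {u v : X → Fin r → ℂ} (hu : AEStronglyMeasurable u μ) (hv : AEStronglyMeasurable v μ) :
    AEStronglyMeasurable (fun x => u x ⬝ᵥ v x) μ :=
  (continuous_fst.dotProduct continuous_snd :
    Continuous fun q : (Fin r → ℂ) × (Fin r → ℂ) => q.1 ⬝ᵥ q.2).comp_aestronglyMeasurable
      (hu.prodMk hv)

/-- Green's identity holds for the truncated rows. Their defect is the cutoff times the original
defect minus commutator times `f`, and both terms have majorants independent of the scale, so the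
limit is taken under the integral. -/
theorem sum_integral_eq_zero {D : Medium n r}
    {f : Fin (n + 1) → ℝ → EuclideanSpace ℝ (Fin m) → Fin r → ℂ}
    {T : Fin (n + 1) → TestRow m r} (hT : DualCoupling D T) {K : Fin (n + 1) → ℝ}
    (hK : ∀ j, (T j).Growth (K j))
    (hf : ∀ k, ContDiffOn ℝ 2
      (fun p : ℝ × EuclideanSpace ℝ (Fin m) => f k p.1 p.2) (D.slab m k))
    (hcoup : SatisfiesCoupling D f)
    (hfint : ∀ k, IntegrableOn
      (fun p : ℝ × EuclideanSpace ℝ (Fin m) => f k p.1 p.2) (D.slab m k))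
    (hint : ∀ j, IntegrableOn (fun p : ℝ × EuclideanSpace ℝ (Fin m) =>
      (T j).defect (D.A j) (f j) p.1 p.2) (D.slab m j)) :
    ∑ j, ∫ p in D.slab m j, (T j).defect (D.A j) (f j) p.1 p.2 = 0 := by
  obtain ⟨C, hC, hcut⟩ := exists_isCutoff m
  choose B hB0 hB using fun j => (T j).exists_commutator_bound (hK j) (D.A j) hC
  obtain ⟨R₀, hR₀1, hR₀⟩ : ∃ R₀ : ℝ, 1 ≤ R₀ ∧ ∀ i, |D.l i| < R₀ := by
    refine ⟨1 + ∑ i, |D.l i|, ?_, fun i => ?_⟩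
    · have := Finset.sum_nonneg fun i (_ : i ∈ Finset.univ) => abs_nonneg (D.l i)
      linarith
    · have := Finset.single_le_sum (f := fun i => |D.l i|) (fun i _ => abs_nonneg _)
        (Finset.mem_univ i)
      linarith
  have hR1 : ∀ N : ℕ, 1 ≤ R₀ + N := fun N => by
    have : (0 : ℝ) ≤ N := N.cast_nonneg
    linarith
  choose χ χ₁ χ₂ ζ ζ' hχ using fun N : ℕ => hcut (R₀ + N) (hR1 N)
  have hlR : ∀ N : ℕ, ∀ i, |D.l i| < R₀ + N := fun N i => by
    have : (0 : ℝ) ≤ N := N.cast_nonneg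
    linarith [hR₀ i]
  have hcomm : ∀ N j ξ η, ((T j).mul (hχ N).partials).defect (D.A j) (f j) ξ η =
      χ N ξ η * (T j).defect (D.A j) (f j) ξ η - (((T j).mul (hχ N).partials).adj (D.A j) ξ η -
        χ N ξ η • (T j).adj (D.A j) ξ η) ⬝ᵥ f j ξ η := by
    intro N j ξ η
    simp only [TestRow.defect, sub_dotProduct, smul_dotProduct, smul_eq_mul]
    simp only [TestRow.mul, smul_dotProduct, smul_eq_mul]
    ring
  have hbound : ∀ N j ξ η, ‖((T j).mul (hχ N).partials).defect (D.A j) (f j) ξ η‖ ≤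
      ‖(T j).defect (D.A j) (f j) ξ η‖ + r * (3 * B j) * ‖f j ξ η‖ := by
    intro N j ξ η
    rw [hcomm]
    refine (norm_sub_le _ _).trans (add_le_add ?_ ((norm_dotProduct_le _ _).trans ?_))
    · rw [norm_mul]
      exact mul_le_of_le_one_left (norm_nonneg _) ((hχ N).norm_le ξ η)
    · rw [mul_assoc]
      gcongr
      exact (hB j (hR1 N) (hχ N) ξ η).2
  have hmeas : ∀ N j, AEStronglyMeasurable (fun p : ℝ × EuclideanSpace ℝ (Fin m) =>
      ((T j).mul (hχ N).partials).defect (D.A j) (f j) p.1 p.2)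
      (volume.restrict (D.slab m j)) := by
    intro N j
    simp only [hcomm]
    refine ((hχ N).partials.cont.aestronglyMeasurable.mul (hint j).aestronglyMeasurable).sub
      (aestronglyMeasurable_dotProduct ?_ (hfint j).aestronglyMeasurable)
    have h1 := ((T j).mul (hχ N).partials).continuous_adj (D.A j)
    have h2 := (hχ N).partials.cont.smul ((T j).continuous_adj (D.A j))
    exact (h1.sub h2).aestronglyMeasurable
  have hdom : ∀ j, IntegrableOn (fun p : ℝ × EuclideanSpace ℝ (Fin m) =>
      ‖(T j).defect (D.A j) (f j) p.1 p.2‖ + r * (3 * B j) * ‖f j p.1 p.2‖) (D.slab m j) :=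
    fun j => (hint j).norm.add ((hfint j).norm.const_mul _)
  have hzero : ∀ N, ∑ j, ∫ p in D.slab m j,
      ((T j).mul (hχ N).partials).defect (D.A j) (f j) p.1 p.2 = 0 := by
    intro N
    have hR0 : 0 < R₀ + N := by linarith [hR1 N]
    have hvan : ∀ j ξ η, 2 * (R₀ + N) < |ξ| ∨ 2 * (R₀ + N) < ‖η‖ →
        ((T j).mul (hχ N).partials).VanishesAt ξ η := by
      intro j ξ η h
      obtain ⟨z0, z1, z2, z3⟩ := (hχ N).eq_zero ξ η h
      simp [TestRow.VanishesAt, TestRow.mul, z0, z1, z2, z3]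
    -- Vanishing is needed for `N ≤ |ξ|`, while the cutoff is known to vanish only strictly beyond
    -- twice its scale. A height of three times the scale leaves room.
    refine sum_integral_defect_eq_zero (T := fun j => (T j).mul (hχ N).partials) ?_ hf hcoup
      (isCompact_closedBall (0 : EuclideanSpace ℝ (Fin m)) (2 * (R₀ + N)))
      (fun j ξ η hη => hvan j ξ η (Or.inr ?_)) (N := 3 * (R₀ + N)) (fun i => ?_) (by linarith)
      (fun j ξ η hξ => hvan j ξ η (Or.inl ?_)) (fun j => (hdom j).mono' (hmeas N j) ?_)
    · intro i η
      -- At an interface the `ξ` derivative of the cutoff is zero, so both sides of the coupling are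
      -- multiplied by the same scalar.
      have z := (hχ N).eq_zero₁ (D.l i) η (hlR N i)
      have hs : ∀ (a : ℂ) (u v : Fin r → ℂ), Sum.elim (a • u) (-(a • v)) = a • Sum.elim u (-v) := by
        intro a u v
        ext (b | b) <;> simp
      simp only [TestRow.mul, z, zero_smul, zero_add, Matrix.smul_vecMul, hs, hT i η]
    · simpa using hη
    · linarith [hlR N i]
    · linarith
    · exact Eventually.of_forall fun p => hbound N j p.1 p.2
  have hlim : Tendsto (fun N => ∑ j, ∫ p in D.slab m j,
      ((T j).mul (hχ N).partials).defect (D.A j) (f j) p.1 p.2) atTop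
      (𝓝 (∑ j, ∫ p in D.slab m j, (T j).defect (D.A j) (f j) p.1 p.2)) := by
    refine tendsto_finsetSum _ fun j _ => tendsto_integral_of_dominated_convergence _
      (hmeas · j) (hdom j) (fun N => Eventually.of_forall fun p => hbound N j p.1 p.2)
      (Eventually.of_forall fun p => ?_)
    have hRt : Tendsto (fun N : ℕ => R₀ + (N : ℝ)) atTop atTop :=
      tendsto_atTop_add_const_left _ _ tendsto_natCast_atTop_atTop
    simp only [hcomm]
    have hone : ∀ᶠ N in atTop, χ N p.1 p.2 = 1 := by
      filter_upwards [hRt.eventually_ge_atTop |p.1|, hRt.eventually_ge_atTop ‖p.2‖] with N h1 h2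
      exact (hχ N).eq_one _ _ h1 h2
    have t1 : Tendsto (fun N => χ N p.1 p.2 * (T j).defect (D.A j) (f j) p.1 p.2) atTop
        (𝓝 ((T j).defect (D.A j) (f j) p.1 p.2)) := by
      refine tendsto_const_nhds.congr' ?_
      filter_upwards [hone] with N hN
      rw [hN, one_mul]
    have t2 : Tendsto (fun N => (((T j).mul (hχ N).partials).adj (D.A j) p.1 p.2 -
        χ N p.1 p.2 • (T j).adj (D.A j) p.1 p.2) ⬝ᵥ f j p.1 p.2) atTop (𝓝 0) := by
      refine squeeze_zero_norm (a := fun N : ℕ => (r * (B j * (1 + |p.1|) * ‖f j p.1 p.2‖)) /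
        (R₀ + (N : ℝ))) (fun N => (norm_dotProduct_le _ _).trans ?_)
        (hRt.const_div_atTop _)
      have := (hB j (hR1 N) (hχ N) p.1 p.2).1
      calc _ ≤ r * (B j * (1 + |p.1|) / (R₀ + N) * ‖f j p.1 p.2‖) := by gcongr
        _ = _ := by ring
    simpa using t1.sub t2
  simp only [hzero] at hlim
  exact (tendsto_nhds_unique hlim tendsto_const_nhds)

end Limit

/-! ### The rows of the kernel as test functions -/

section Kernel

variable {n r m : ℕ}

/-- The density in `θ` of the rows of the kernel, up to the radial factor. -/
def rowDensity (m : ℕ) (Φ : ℝ → Fin r → ℂ) (M : ℝ → ℝ → Matrix (Fin r) (Fin r) ℂ) (ρ ξ θ : ℝ) :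
    Fin r → ℂ :=
  ((((ρ / 2) ^ (((m : ℝ) - 2) / 2) * Real.sin θ ^ (m - 1) : ℝ)) : ℂ) •
    (Φ (ρ * Real.cos θ) ᵥ* M ξ (ρ * Real.cos θ))

theorem linearGrowth_vecMul {Φ : ℝ → Fin r → ℂ} (hΦ : Continuous Φ)
    {M : ℝ → ℝ → Matrix (Fin r) (Fin r) ℂ} (hM : ∀ a b, LinearGrowth fun t s => M t s a b)
    (b : Fin r) : LinearGrowth fun t s => (Φ s ᵥ* M t s) b :=
  LinearGrowth.sum Finset.univ fun c _ => (hM c b).mul_left ((continuous_apply c).comp hΦ)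

theorem continuous_rowDensity {Φ : ℝ → Fin r → ℂ} (hΦ : Continuous Φ)
    {M : ℝ → ℝ → Matrix (Fin r) (Fin r) ℂ}
    (hM : Continuous fun q : ℝ × ℝ => M q.1 q.2) (ρ : ℝ) (b : Fin r) :
    Continuous (Function.uncurry fun ξ θ => rowDensity m Φ M ρ ξ θ b) := by
  have h1 : Continuous fun q : ℝ × ℝ => M q.1 (ρ * Real.cos q.2) :=
    hM.comp (f := fun q : ℝ × ℝ => (q.1, ρ * Real.cos q.2)) (by fun_prop)
  have h2 : Continuous fun q : ℝ × ℝ => Φ (ρ * Real.cos q.2) := hΦ.comp (by fun_prop)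
  have h3 := (continuous_apply b).comp (h2.matrix_vecMul h1)
  exact Continuous.mul (by fun_prop) h3

theorem hasDerivAt_rowDensity {Φ : ℝ → Fin r → ℂ} {M M' : ℝ → ℝ → Matrix (Fin r) (Fin r) ℂ}
    (h : ∀ t s a b, HasDerivAt (fun t => M t s a b) (M' t s a b) t) (ρ : ℝ) (b : Fin r) (t θ : ℝ) :
    HasDerivAt (fun t => rowDensity m Φ M ρ t θ b) (rowDensity m Φ M' ρ t θ b) t :=
  (HasDerivAt.fun_sum fun c _ => (h t _ c b).const_mul _).const_mul _

/-- The frequencies `ρ cos θ` stay in `[-ρ, ρ]`, where linear growth is uniform. That `K` does not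
depend on `g` makes the bound uniform in `η`. -/
theorem exists_norm_integral_rowDensity_le {Φ : ℝ → Fin r → ℂ} (hΦ : Continuous Φ)
    {M : ℝ → ℝ → Matrix (Fin r) (Fin r) ℂ} (hM : ∀ a b, LinearGrowth fun t s => M t s a b)
    {ρ : ℝ} (hρ : 0 < ρ) (H : ℝ) :
    ∃ K, ∀ g : ℝ → ℝ, (∀ θ, |g θ| ≤ H) → ∀ ξ b,
      ‖∫ θ in (0 : ℝ)..Real.pi, (g θ : ℂ) * rowDensity m Φ M ρ ξ θ b‖ ≤ K * (1 + |ξ|) := by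
  choose C hC using fun b => (linearGrowth_vecMul hΦ hM b).bound ρ
  have hC0 : ∀ b, 0 ≤ C b := fun b => by
    simpa using (norm_nonneg _).trans (hC b 0 0 (by simpa using hρ.le))
  set W := (ρ / 2) ^ (((m : ℝ) - 2) / 2) with hW
  have hW0 : 0 ≤ W := by positivity
  refine ⟨H * (W * ∑ b, C b) * |Real.pi - 0|, fun g hg ξ b => ?_⟩
  have hH : 0 ≤ H := (abs_nonneg _).trans (hg 0)
  rw [mul_right_comm]
  refine intervalIntegral.norm_integral_le_of_norm_le_const fun θ _ => ?_
  rw [rowDensity, Pi.smul_apply, smul_eq_mul, norm_mul, norm_mul, Complex.norm_real,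
    Complex.norm_real, Real.norm_eq_abs, Real.norm_eq_abs, abs_mul, abs_pow, abs_of_nonneg hW0]
  have hs : |Real.sin θ| ^ (m - 1) ≤ 1 := pow_le_one₀ (abs_nonneg _) (Real.abs_sin_le_one θ)
  have hcos : |ρ * Real.cos θ| ≤ ρ := by
    rw [abs_mul, abs_of_pos hρ]
    exact mul_le_of_le_one_right hρ.le (Real.abs_cos_le_one θ)
  have h1 := hC b ξ _ hcos
  have h2 : C b ≤ ∑ b, C b := Finset.single_le_sum (fun b _ => hC0 b) (Finset.mem_univ b)
  have h3 : 0 ≤ 1 + |ξ| := by positivity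
  have h4 : 0 ≤ ∑ b, C b := (hC0 b).trans h2
  calc _ ≤ H * (W * 1 * ((∑ b, C b) * (1 + |ξ|))) := by
        gcongr
        · exact hg θ
        · exact h1.trans (by gcongr)
    _ = _ := by ring

theorem integral_vecMul {ι : Type*} [Fintype ι] {κ : Type*} {g : ℝ → ι → ℂ}
    (hg : ∀ b, Continuous fun θ => g θ b) (M : Matrix ι κ ℂ) (u v : ℝ) :
    (fun b => ∫ θ in u..v, g θ b) ᵥ* M = fun c => ∫ θ in u..v, (g θ ᵥ* M) c := by
  funext c
  have h : ∀ b ∈ Finset.univ, IntervalIntegrable (fun θ => g θ b * M b c) volume u v := fun b _ =>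
    ((hg b).mul continuous_const).intervalIntegrable _ _
  change ∑ b, (∫ θ in u..v, g θ b) * M b c = ∫ θ in u..v, ∑ b, g θ b * M b c
  rw [intervalIntegral.integral_finsetSum h]
  simp only [intervalIntegral.integral_mul_const]

end Kernel

section Rows

variable {n r m : ℕ} {D : Medium n r} {ψ : Fin (n + 1) → ℝ → ℝ → Matrix (Fin r) (Fin r) ℂ}

namespace IsDualEigenfunction

theorem continuous (hψ : IsDualEigenfunction D ψ) (j : Fin (n + 1)) :
    Continuous fun q : ℝ × ℝ => ψ j q.1 q.2 :=
  continuous_matrix fun a b => (hψ.linearGrowth j a b).1.cont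

theorem continuous_deriv (hψ : IsDualEigenfunction D ψ) (j : Fin (n + 1)) :
    Continuous fun q : ℝ × ℝ => matDeriv (fun t => ψ j t q.2) q.1 :=
  continuous_matrix fun a b => (hψ.linearGrowth j a b).2.cont

/-- The equation expresses the second derivative through `ψ` itself, whose joint continuity is
known. -/
theorem continuous_deriv_deriv (hψ : IsDualEigenfunction D ψ) (j : Fin (n + 1)) :
    Continuous fun q : ℝ × ℝ => matDeriv (matDeriv fun t => ψ j t q.2) q.1 := by
  have e : ∀ q : ℝ × ℝ, matDeriv (matDeriv fun t => ψ j t q.2) q.1 =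
      (-(((q.2 : ℂ) ^ 2) • ψ j q.1 q.2)) * (D.A j ^ 2)⁻¹ := fun q => by
    rw [← eq_neg_of_add_eq_zero_left (hψ.ode j q.2 q.1), Matrix.mul_assoc, D.A_sq_mul_inv,
      Matrix.mul_one]
  simp only [e]
  have h1 : Continuous fun q : ℝ × ℝ => (q.2 : ℂ) ^ 2 := by fun_prop
  exact (h1.smul (hψ.continuous j)).neg.matrix_mul continuous_const

/-- The row of the kernel obtained from the row `Φ` of the direct eigenfunction. -/
def testRow (hψ : IsDualEigenfunction D ψ) (hm : 1 ≤ m) (y : EuclideanSpace ℝ (Fin m))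
    {Φ : ℝ → Fin r → ℂ} (hΦ : Continuous Φ) (ρ : ℝ) (j : Fin (n + 1)) : TestRow m r where
  P ξ η b := ∫ θ in (0 : ℝ)..Real.pi, (radial y (ρ * Real.sin θ) η : ℂ) *
    rowDensity m Φ (ψ j) ρ ξ θ b
  P₁ ξ η b := ∫ θ in (0 : ℝ)..Real.pi, (radial y (ρ * Real.sin θ) η : ℂ) *
    rowDensity m Φ (fun t s => matDeriv (fun t => ψ j t s) t) ρ ξ θ b
  P₂ ξ η b := ∫ θ in (0 : ℝ)..Real.pi, (radial y (ρ * Real.sin θ) η : ℂ) *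
    rowDensity m Φ (fun t s => matDeriv (matDeriv fun t => ψ j t s) t) ρ ξ θ b
  Q i ξ η b := ∫ θ in (0 : ℝ)..Real.pi, (radialPartial y i (ρ * Real.sin θ) η : ℂ) *
    rowDensity m Φ (ψ j) ρ ξ θ b
  Q' i ξ η b := ∫ θ in (0 : ℝ)..Real.pi, (radialPartialPartial y i (ρ * Real.sin θ) η : ℂ) *
    rowDensity m Φ (ψ j) ρ ξ θ b
  partials b := hasPartials_integral_radial hm y (by fun_prop)
    (continuous_rowDensity hΦ (hψ.continuous j) ρ b)
    (continuous_rowDensity hΦ (hψ.continuous_deriv j) ρ b)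
    (continuous_rowDensity hΦ (hψ.continuous_deriv_deriv j) ρ b)
    (hasDerivAt_rowDensity (fun t s a b => hasDerivAt_matDeriv (hψ.contDiff j s a b) t) ρ b)
    (hasDerivAt_rowDensity (fun t s a b => hasDerivAt_matDeriv_matDeriv (hψ.contDiff j s a b) t) ρ b)

theorem testRow_growth (hψ : IsDualEigenfunction D ψ) (hm : 1 ≤ m) (y : EuclideanSpace ℝ (Fin m))
    {Φ : ℝ → Fin r → ℂ} (hΦ : Continuous Φ) {ρ : ℝ} (hρ : 0 < ρ) (j : Fin (n + 1)) :
    ∃ K, (hψ.testRow hm y hΦ ρ j).Growth K := by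
  set G := |besselClifford ((m : ℝ) / 2) 0|
  have hG : 0 ≤ G := abs_nonneg _
  obtain ⟨K0, h0⟩ := exists_norm_integral_rowDensity_le (m := m) hΦ
    (fun a b => (hψ.linearGrowth j a b).1) hρ ((1 + ρ) * G)
  obtain ⟨K1, h1⟩ := exists_norm_integral_rowDensity_le (m := m) hΦ
    (fun a b => (hψ.linearGrowth j a b).2) hρ ((1 + ρ) * G)
  have g0 : ∀ η θ, |radial y (ρ * Real.sin θ) η| ≤ (1 + ρ) * G := fun η θ =>
    (abs_radial_le y hm _ η).trans (le_mul_of_one_le_left hG (by linarith))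
  have g1 : ∀ i η θ, |radialPartial y i (ρ * Real.sin θ) η| ≤ (1 + ρ) * G := fun i η θ => by
    refine (abs_radialPartial_le y hm i _ η).trans (mul_le_mul_of_nonneg_right ?_ hG)
    rw [abs_mul, abs_of_pos hρ]
    have := mul_le_of_le_one_right hρ.le (Real.abs_sin_le_one θ)
    linarith
  -- Entrywise bounds with constant `K0` or `K1` become norm bounds with their common majorant. The
  -- second alternative is excluded for both constants.
  have hpi : ∀ {K : ℝ} {v : Fin r → ℂ} {ξ : ℝ}, (∀ b, ‖v b‖ ≤ K * (1 + |ξ|)) →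
      ‖v‖ ≤ max (max K0 K1) 0 * (1 + |ξ|) ∨ ¬ K ≤ max (max K0 K1) 0 := by
    intro K v ξ hv
    by_cases hK : K ≤ max (max K0 K1) 0
    · refine Or.inl ((pi_norm_le_iff_of_nonneg (by positivity)).2 fun b => (hv b).trans ?_)
      gcongr
    · exact Or.inr hK
  have k0 : K0 ≤ max (max K0 K1) 0 := (le_max_left _ _).trans (le_max_left _ _)
  have k1 : K1 ≤ max (max K0 K1) 0 := (le_max_right _ _).trans (le_max_left _ _)
  exact ⟨max (max K0 K1) 0, fun ξ η => (hpi fun b => h0 _ (g0 η) ξ b).resolve_right (not_not.2 k0),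
    fun ξ η => (hpi fun b => h1 _ (g0 η) ξ b).resolve_right (not_not.2 k1),
    fun i ξ η => (hpi fun b => h0 _ (g1 i η) ξ b).resolve_right (not_not.2 k0)⟩

theorem continuous_mul_rowDensity {g : ℝ → EuclideanSpace ℝ (Fin m) → ℝ}
    (hg : Continuous fun q : ℝ × EuclideanSpace ℝ (Fin m) => g q.1 q.2) {Φ : ℝ → Fin r → ℂ}
    (hΦ : Continuous Φ) {M : ℝ → ℝ → Matrix (Fin r) (Fin r) ℂ}
    (hM : Continuous fun q : ℝ × ℝ => M q.1 q.2) (ρ ξ : ℝ) (η : EuclideanSpace ℝ (Fin m))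
    (b : Fin r) :
    Continuous fun θ => (g (ρ * Real.sin θ) η : ℂ) * rowDensity m Φ M ρ ξ θ b := by
  have h1 : Continuous fun θ => g (ρ * Real.sin θ) η :=
    hg.comp (f := fun θ => (ρ * Real.sin θ, η)) (by fun_prop)
  have h2 := (continuous_rowDensity (m := m) hΦ hM ρ b).comp (Continuous.prodMk_right ξ)
  exact (Complex.continuous_ofReal.comp h1).mul h2

/-- For each `θ` the Laplacian contributes `-(ρ sin θ)²` and the second `ξ` derivative times `A²`
contributes `-(ρ cos θ)²`. Their sum no longer depends on `θ` and leaves the integral. -/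
theorem testRow_adj (hψ : IsDualEigenfunction D ψ) (hm : 1 ≤ m) (y : EuclideanSpace ℝ (Fin m))
    {Φ : ℝ → Fin r → ℂ} (hΦ : Continuous Φ) (ρ : ℝ) (j : Fin (n + 1)) (ξ : ℝ)
    (η : EuclideanSpace ℝ (Fin m)) :
    (hψ.testRow hm y hΦ ρ j).adj (D.A j) ξ η =
      (-(ρ : ℂ) ^ 2) • (hψ.testRow hm y hΦ ρ j).P ξ η := by
  have c2 := fun b => continuous_mul_rowDensity (continuous_radial y hm) hΦ
    (M := fun t s => matDeriv (matDeriv fun t => ψ j t s) t) (hψ.continuous_deriv_deriv j) ρ ξ η b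
  have cq := fun i b => continuous_mul_rowDensity (continuous_radialPartialPartial y hm i) hΦ
    (hψ.continuous j) ρ ξ η b
  have c2A : ∀ b, Continuous fun θ => ((fun b => (radial y (ρ * Real.sin θ) η : ℂ) * rowDensity m Φ
      (fun t s => matDeriv (matDeriv fun t => ψ j t s) t) ρ ξ θ b) ᵥ* D.A j ^ 2) b := fun b =>
    (continuous_apply b).comp ((continuous_pi c2).matrix_vecMul continuous_const)
  rw [TestRow.adj]
  simp only [testRow]
  rw [integral_vecMul c2]
  funext b
  simp only [Pi.add_apply, Finset.sum_apply, Pi.smul_apply, smul_eq_mul]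
  rw [← intervalIntegral.integral_finsetSum fun i _ => (cq i b).intervalIntegrable _ _,
    ← intervalIntegral.integral_add ((c2A b).intervalIntegrable _ _)
      ((continuous_finsetSum _ fun i _ => cq i b).intervalIntegrable _ _),
    ← intervalIntegral.integral_const_mul]
  refine intervalIntegral.integral_congr fun θ _ => ?_
  have h1 : ∑ i, (radialPartialPartial y i (ρ * Real.sin θ) η : ℂ) * rowDensity m Φ (ψ j) ρ ξ θ b =
      -((ρ : ℂ) * (Real.sin θ : ℝ)) ^ 2 * radial y (ρ * Real.sin θ) η *
        rowDensity m Φ (ψ j) ρ ξ θ b := by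
    rw [← Finset.sum_mul, ← Complex.ofReal_sum, sum_radialPartialPartial y hm]
    push_cast
    ring
  have h2 : (fun b => (radial y (ρ * Real.sin θ) η : ℂ) * rowDensity m Φ
      (fun t s => matDeriv (matDeriv fun t => ψ j t s) t) ρ ξ θ b) ᵥ* D.A j ^ 2 =
      (-((ρ : ℂ) * (Real.cos θ : ℝ)) ^ 2 * radial y (ρ * Real.sin θ) η) •
        rowDensity m Φ (ψ j) ρ ξ θ := by
    have e : (fun b => (radial y (ρ * Real.sin θ) η : ℂ) * rowDensity m Φ
      (fun t s => matDeriv (matDeriv fun t => ψ j t s) t) ρ ξ θ b) =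
      (radial y (ρ * Real.sin θ) η : ℂ) • rowDensity m Φ
      (fun t s => matDeriv (matDeriv fun t => ψ j t s) t) ρ ξ θ := rfl
    rw [e, Matrix.smul_vecMul, rowDensity, rowDensity, Matrix.smul_vecMul, Matrix.vecMul_vecMul,
      eq_neg_of_add_eq_zero_left (hψ.ode j _ ξ), Matrix.vecMul_neg, Matrix.vecMul_smul]
    rw [smul_smul, smul_smul, smul_neg, ← neg_smul, smul_smul]
    congr 1
    push_cast
    ring
  have h3 : ((Real.sin θ : ℝ) : ℂ) ^ 2 + ((Real.cos θ : ℝ) : ℂ) ^ 2 = 1 := by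
    exact_mod_cast Real.sin_sq_add_cos_sq θ
  rw [h1, h2, Pi.smul_apply, smul_eq_mul]
  linear_combination (-(ρ : ℂ) ^ 2 * radial y (ρ * Real.sin θ) η * rowDensity m Φ (ψ j) ρ ξ θ b) * h3

/-- The dual coupling is linear with matrices independent of the frequency, and it holds at each `ρ
cos θ`. The row `Φ` acts from the left and the scalar weight is the same in all layers, so the
condition passes through the integral over `θ`. -/
theorem testRow_coupling (hψ : IsDualEigenfunction D ψ) (hm : 1 ≤ m)
    (y : EuclideanSpace ℝ (Fin m)) {Φ : ℝ → Fin r → ℂ} (hΦ : Continuous Φ) (ρ : ℝ) :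
    DualCoupling D (hψ.testRow hm y hΦ ρ) := by
  have key : ∀ (j : Fin (n + 1)) (ξ : ℝ) (η : EuclideanSpace ℝ (Fin m))
      (M : Matrix (Fin r ⊕ Fin r) (Fin r ⊕ Fin r) ℂ),
      Sum.elim ((hψ.testRow hm y hΦ ρ j).P ξ η ᵥ* D.A j ^ 2)
        (-((hψ.testRow hm y hΦ ρ j).P₁ ξ η ᵥ* D.A j ^ 2)) ᵥ* M =
      fun e => ∫ θ in (0 : ℝ)..Real.pi, ((radial y (ρ * Real.sin θ) η : ℂ) *
        (((ρ / 2) ^ (((m : ℝ) - 2) / 2) * Real.sin θ ^ (m - 1) : ℝ) : ℂ)) *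
        (Φ (ρ * Real.cos θ) ᵥ* (Matrix.fromCols (ψ j ξ (ρ * Real.cos θ) * D.A j ^ 2)
          (-(matDeriv (fun t => ψ j t (ρ * Real.cos θ)) ξ * D.A j ^ 2)) * M)) e := by
    intro j ξ η M
    have c0 := fun b =>
      continuous_mul_rowDensity (continuous_radial y hm) hΦ (hψ.continuous j) ρ ξ η b
    have c1 := fun b => continuous_mul_rowDensity (continuous_radial y hm) hΦ
      (M := fun t s => matDeriv (fun t => ψ j t s) t) (hψ.continuous_deriv j) ρ ξ η b
    have d0 := (continuous_pi c0).matrix_vecMul (continuous_const (y := D.A j ^ 2))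
    have d1 := (continuous_pi c1).matrix_vecMul (continuous_const (y := D.A j ^ 2))
    have e1 : Sum.elim ((hψ.testRow hm y hΦ ρ j).P ξ η ᵥ* D.A j ^ 2)
        (-((hψ.testRow hm y hΦ ρ j).P₁ ξ η ᵥ* D.A j ^ 2)) =
        fun e => ∫ θ in (0 : ℝ)..Real.pi, Sum.elim
          ((fun b => (radial y (ρ * Real.sin θ) η : ℂ) * rowDensity m Φ (ψ j) ρ ξ θ b) ᵥ* D.A j ^ 2)
          (-((fun b => (radial y (ρ * Real.sin θ) η : ℂ) * rowDensity m Φ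
            (fun t s => matDeriv (fun t => ψ j t s) t) ρ ξ θ b) ᵥ* D.A j ^ 2)) e := by
      simp only [testRow]
      rw [integral_vecMul c0, integral_vecMul c1]
      ext (b | b)
      · rfl
      · exact (intervalIntegral.integral_neg).symm
    rw [e1, integral_vecMul]
    · funext e
      refine intervalIntegral.integral_congr fun θ _ => ?_
      have hrow : ∀ N : ℝ → ℝ → Matrix (Fin r) (Fin r) ℂ,
          (fun b => (radial y (ρ * Real.sin θ) η : ℂ) * rowDensity m Φ N ρ ξ θ b) ᵥ* D.A j ^ 2 =
          ((radial y (ρ * Real.sin θ) η : ℂ) *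
            (((ρ / 2) ^ (((m : ℝ) - 2) / 2) * Real.sin θ ^ (m - 1) : ℝ) : ℂ)) •
            (Φ (ρ * Real.cos θ) ᵥ* (N ξ (ρ * Real.cos θ) * D.A j ^ 2)) := by
        intro N
        rw [← smul_smul, ← Matrix.vecMul_vecMul, ← Matrix.smul_vecMul, ← Matrix.smul_vecMul]
        rfl
      have hs : ∀ (c : ℂ) (u v : Fin r → ℂ), Sum.elim (c • u) (-(c • v)) = c • Sum.elim u (-v) := by
        intro c u v
        ext (b | b) <;> simp
      have hcols : Sum.elim (Φ (ρ * Real.cos θ) ᵥ* (ψ j ξ (ρ * Real.cos θ) * D.A j ^ 2))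
          (-(Φ (ρ * Real.cos θ) ᵥ* (matDeriv (fun t => ψ j t (ρ * Real.cos θ)) ξ * D.A j ^ 2))) =
          Φ (ρ * Real.cos θ) ᵥ* Matrix.fromCols (ψ j ξ (ρ * Real.cos θ) * D.A j ^ 2)
            (-(matDeriv (fun t => ψ j t (ρ * Real.cos θ)) ξ * D.A j ^ 2)) := by
        rw [Matrix.vecMul_fromCols, Matrix.vecMul_neg]
      rw [hrow, hrow, hs, hcols, Matrix.smul_vecMul, Matrix.vecMul_vecMul, Pi.smul_apply, smul_eq_mul]
    · rintro (b | b)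
      · exact (continuous_apply b).comp d0
      · exact ((continuous_apply b).comp d1).neg
  intro i η
  rw [key, key]
  simp only [hψ.coupling i]

end IsDualEigenfunction

end Rows

/-! ### The transform -/

section Transform

variable {n r m : ℕ} {D : Medium n r}
  {φ ψ : Fin (n + 1) → ℝ → ℝ → Matrix (Fin r) (Fin r) ℂ}

/-- The kernel divides by a power of `‖y - η‖`, so agreement with the smooth row is claimed only for
`η ≠ y`. The excluded set is null. -/
theorem kernel_eq_testRow (hψ : IsDualEigenfunction D ψ) (hm : 1 ≤ m)
    (y : EuclideanSpace ℝ (Fin m)) (k : Fin (n + 1)) (x : ℝ) (a : Fin r)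
    (hΦ : Continuous fun s => φ k x s a) {ρ : ℝ} (hρ : 0 < ρ) (j : Fin (n + 1)) (ξ : ℝ)
    {η : EuclideanSpace ℝ (Fin m)} (hη : η ≠ y) :
    kernel m φ ψ k j ρ x ξ ‖y - η‖ a = (hψ.testRow hm y hΦ ρ j).P ξ η := by
  have hd : 0 < ‖y - η‖ := norm_pos_iff.2 (sub_ne_zero.2 hη.symm)
  funext b
  simp only [kernel, Matrix.of_apply, IsDualEigenfunction.testRow]
  -- The end points `0` and `π` are dropped because the power identities require `sin θ > 0`.
  rw [intervalIntegral.integral_of_le Real.pi_pos.le, intervalIntegral.integral_of_le Real.pi_pos.le,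
    integral_Ioc_eq_integral_Ioo, integral_Ioc_eq_integral_Ioo]
  refine setIntegral_congr_fun measurableSet_Ioo fun θ hθ => ?_
  beta_reduce
  rw [sin_rpow_mul_besselJ hm hρ hd (Real.sin_pos_of_mem_Ioo hθ), rowDensity, radial, Pi.smul_apply,
    Matrix.mul_apply_eq_vecMul, smul_eq_mul]
  push_cast
  ring

theorem restrict_slab (D : Medium n r) (m : ℕ) (j : Fin (n + 1)) :
    (volume : Measure (ℝ × EuclideanSpace ℝ (Fin m))).restrict (D.slab m j) =
      (volume.restrict (D.layer j)).prod volume := by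
  rw [Medium.slab, Measure.volume_eq_prod, ← Measure.prod_restrict, Measure.restrict_univ]

/-- Absolute convergence allows Fubini, turning the iterated integral into integrals over the slabs.
-/
theorem fourierTransform_eq_sum {f : Fin (n + 1) → ℝ → EuclideanSpace ℝ (Fin m) → Fin r → ℂ}
    {k : Fin (n + 1)} {x : ℝ} {y : EuclideanSpace ℝ (Fin m)} {ρ : ℝ}
    (h : TransformConverges D φ ψ f k x y ρ) :
    fourierTransform D φ ψ f k x y ρ = (1 / Real.sqrt (2 * Real.pi) ^ m) •
      ∑ j, ∫ p in D.slab m j, kernel m φ ψ k j ρ x p.1 ‖y - p.2‖ *ᵥ f j p.1 p.2 := by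
  have h' : ∀ j, Integrable (fun p : ℝ × EuclideanSpace ℝ (Fin m) =>
      kernel m φ ψ k j ρ x p.1 ‖y - p.2‖ *ᵥ f j p.1 p.2)
      ((volume.restrict (D.layer j)).prod volume) := fun j => by
    rw [← restrict_slab]
    exact h j
  rw [fourierTransform, integral_finsetSum _ fun j _ => (h' j).integral_prod_right]
  congr 1
  refine Finset.sum_congr rfl fun j _ => ?_
  rw [restrict_slab, integral_prod_symm _ (h' j)]

theorem ae_snd_ne (hm : 1 ≤ m) (y : EuclideanSpace ℝ (Fin m))
    (s : Set (ℝ × EuclideanSpace ℝ (Fin m))) : ∀ᵐ p ∂volume.restrict s, p.2 ≠ y := by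
  -- With `m ≥ 1` the space is nontrivial, so a single point has measure zero.
  have : Nonempty (Fin m) := ⟨⟨0, hm⟩⟩
  refine ae_restrict_of_ae ?_
  have h : ∀ᵐ η : EuclideanSpace ℝ (Fin m), η ≠ y := by
    simp [ae_iff]
  exact (Measure.quasiMeasurePreserving_snd (μ := (volume : Measure ℝ))).ae h

theorem transformConverges_apply (hψ : IsDualEigenfunction D ψ) (hm : 1 ≤ m)
    {f : Fin (n + 1) → ℝ → EuclideanSpace ℝ (Fin m) → Fin r → ℂ}
    {k : Fin (n + 1)} {x : ℝ} {y : EuclideanSpace ℝ (Fin m)} {ρ : ℝ} (hρ : 0 < ρ) (a : Fin r)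
    (hΦ : Continuous fun s => φ k x s a)
    (h : TransformConverges D φ ψ f k x y ρ) :
    (∀ j, IntegrableOn (fun p : ℝ × EuclideanSpace ℝ (Fin m) =>
      (hψ.testRow hm y hΦ ρ j).P p.1 p.2 ⬝ᵥ f j p.1 p.2) (D.slab m j)) ∧
    fourierTransform D φ ψ f k x y ρ a = (1 / Real.sqrt (2 * Real.pi) ^ m) •
      ∑ j, ∫ p in D.slab m j, (hψ.testRow hm y hΦ ρ j).P p.1 p.2 ⬝ᵥ f j p.1 p.2 := by
  have e : ∀ j, (fun p : ℝ × EuclideanSpace ℝ (Fin m) =>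
      (kernel m φ ψ k j ρ x p.1 ‖y - p.2‖ *ᵥ f j p.1 p.2) a) =ᵐ[volume.restrict (D.slab m j)]
      fun p => (hψ.testRow hm y hΦ ρ j).P p.1 p.2 ⬝ᵥ f j p.1 p.2 := fun j => by
    filter_upwards [ae_snd_ne hm y (D.slab m j)] with p hp
    rw [← kernel_eq_testRow hψ hm y k x a hΦ hρ j p.1 hp]
    rfl
  refine ⟨fun j => ((h j).eval a).congr (e j), ?_⟩
  rw [fourierTransform_eq_sum h, Pi.smul_apply, Finset.sum_apply]
  congr 1
  refine Finset.sum_congr rfl fun j _ => ?_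
  rw [eval_integral fun b => (h j).eval b]
  exact integral_congr_ae (e j)

end Transform

end LayeredFourier

end

/-! ### The operator under the transform -/

theorem mainTheorem1 {n r m : ℕ} (hm : 1 ≤ m) (D : LayeredFourier.Medium n r)
    (φ ψ : Fin (n + 1) → ℝ → ℝ → Matrix (Fin r) (Fin r) ℂ)
    (hφ : LayeredFourier.IsDirectEigenfunction D φ)
    (hψ : LayeredFourier.IsDualEigenfunction D ψ)
    (f : Fin (n + 1) → ℝ → EuclideanSpace ℝ (Fin m) → Fin r → ℂ)
    (hf : ∀ k, ContDiffOn ℝ 2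
      (fun p : ℝ × EuclideanSpace ℝ (Fin m) => f k p.1 p.2) (D.slab m k))
    (hinf : LayeredFourier.VanishesAtInfinity D f)
    (hcoup : LayeredFourier.SatisfiesCoupling D f)
    (hint : ∀ k, IntegrableOn
      (fun p : ℝ × EuclideanSpace ℝ (Fin m) => f k p.1 p.2) (D.slab m k))
    (k : Fin (n + 1)) (x : ℝ) (hx : x ∈ D.layer k) (y : EuclideanSpace ℝ (Fin m))
    (lam : ℝ) (hlam : 0 < lam)
    (hFf : LayeredFourier.TransformConverges D φ ψ f k x y lam)
    (hFB : LayeredFourier.TransformConverges D φ ψ (LayeredFourier.opB D f) k x y lam) :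
    LayeredFourier.fourierTransform D φ ψ (LayeredFourier.opB D f) k x y lam =
      (-(lam : ℂ) ^ 2) • LayeredFourier.fourierTransform D φ ψ f k x y lam := by
  funext a
  have hΦ : Continuous fun s => φ k x s a :=
    (continuous_apply a).comp (hφ.continuous_param k x).1
  obtain ⟨i1, e1⟩ := LayeredFourier.transformConverges_apply hψ hm hlam a hΦ hFf
  obtain ⟨i2, e2⟩ := LayeredFourier.transformConverges_apply hψ hm hlam a hΦ hFB
  choose K hK using fun j => hψ.testRow_growth hm y hΦ hlam j
  -- By the eigenvalue equation for the test row, its defect is the difference of the two transform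
  -- integrands, both integrable by assumption. The vanishing of the total defect is then the claim
  -- for component `a`.
  have hdef : ∀ j, (fun p : ℝ × EuclideanSpace ℝ (Fin m) =>
      (hψ.testRow hm y hΦ lam j).defect (D.A j) (f j) p.1 p.2) = fun p =>
      (hψ.testRow hm y hΦ lam j).P p.1 p.2 ⬝ᵥ LayeredFourier.opB D f j p.1 p.2 -
        (-(lam : ℂ) ^ 2) * ((hψ.testRow hm y hΦ lam j).P p.1 p.2 ⬝ᵥ f j p.1 p.2) := by
    intro j
    funext p
    rw [LayeredFourier.TestRow.defect, hψ.testRow_adj, smul_dotProduct, smul_eq_mul]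
    rfl
  have h0 := LayeredFourier.sum_integral_eq_zero (hψ.testRow_coupling hm y hΦ lam) hK hf hcoup hint
    (fun j => by rw [hdef]; exact (i2 j).sub ((i1 j).const_mul _))
  have hsum : ∀ j, ∫ p in D.slab m j, (hψ.testRow hm y hΦ lam j).defect (D.A j) (f j) p.1 p.2 =
      (∫ p in D.slab m j, (hψ.testRow hm y hΦ lam j).P p.1 p.2 ⬝ᵥ
        LayeredFourier.opB D f j p.1 p.2) - (-(lam : ℂ) ^ 2) *
        ∫ p in D.slab m j, (hψ.testRow hm y hΦ lam j).P p.1 p.2 ⬝ᵥ f j p.1 p.2 := by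
    intro j
    rw [hdef, integral_sub (i2 j) ((i1 j).const_mul _), integral_const_mul]
  simp only [hsum, Finset.sum_sub_distrib, ← Finset.mul_sum] at h0
  rw [Pi.smul_apply, e1, e2, sub_eq_zero.1 h0, smul_eq_mul, mul_smul_comm]
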